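/- **Conventions.** $\mathbf{Set}$ is the category of (small) sets. *Cartesian monads.* A cartesian monad $(\mathcal{E},T)$ is a category $\mathcal{E}$ with finite limits and a monad $T=(T,\eta,\mu)$ on it such that $T$ preserves pullbacks and all naturality squares of $\eta$ and $\mu$ are pullbacks. They form a category $\mathbf{CartMonad}$, in which a morphism $(U,\phi)\colon(\mathcal{E}_1,T_1)\to(\mathcal{E}_2,T_2)$ (a cartesian monad opfunctor) is a pullback-preserving functor $U\colon\mathcal{E}_1\to\mathcal{E}_2$ with a natural transformation $\phi\colon UT_1\to T_2U$ whose naturality squares are pullbacks and which satisfies $\phi\circ U\eta_1=\eta_2U$ and $\phi\circ U\mu_1=\mu_2U\circ T_2\phi\circ\phi T_1$. *Free operads.* An $(\mathcal{E},T)$-operad is an $(\mathcal{E},T)$-multicategory whose object of objects is the terminal object $1$: an object $A\to T1$ of $\mathcal{E}/T1$ with an identity map $1\to A$ over $\eta_1$ and a composition $A\times_{T1}TA\to A$ over $T1$ that is unital and associative. If the forgetful functor from $(\mathcal{E},T)$-operads to $\mathcal{E}/T1$ has a left adjoint, $(\mathcal{E},T)'$ denotes $\mathcal{E}/T1$ with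 the induced monad. Put $(\mathcal{E},T)^{0'}=(\mathcal{E},T)$ and $(\mathcal{E},T)^{k'}=((\mathcal{E},T)^{(k-1)'})'$ for $k\ge1$. *Symmetric multicategories.* A symmetric multicategory $Q$ has a category $o(Q)$ of objects, sets $Q(x_1,\dots,x_n;y)$ of arrows, a symmetric action $f\mapsto f\sigma$, an arrow $\iota(a)\in Q(x;y)$ for each object-morphism $a\colon x\to y$, and a composition which is associative, unital with respect to the $\iota(1_x)$ and equivariant, with $\iota$ respecting composition. A morphism $g\to g'$ of the category $\mathrm{elt}(Q)$ of arrows of $Q$ is a permutation together with object-morphisms at the sources and at the target, whose action takes $g$ to $g'$. $Q$ is *tidy* if $f\sigma=f$ implies that $\sigma$ is the identity, and $o(Q)$ is equivalent to a discrete category. *Slice.* The slice $Q^+$ has $o(Q^+)=\mathrm{elt}(Q)$, and an element of $Q^+(f_1,\dots,f_n;f)$ is a configuration for composing $f_1,\dots,f_n$ to yield $f$: a planar tree with nodes labelled bijectively by $f_1,\dots,f_n$, edges labelled by object-morphisms and leaves labelled bijectively by the inputs of $f$, such that composing according to the tree and applying the permutation of the leaves gives $f$; trees are composed by replacing nodes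 by trees. Put $Q^{0+}=Q$ and $Q^{k+}=(Q^{(k-1)+})^+$ for $k\ge1$. Let $I$ be the symmetric multicategory with exactly one object, one (identity) object-morphism and one (identity) arrow. *The functor $\zeta$ on objects.* For $Q$ tidy, $\zeta(Q)=(\mathbf{Set}/S_Q,T_Q)$, where $S_Q$ is the set of isomorphism classes of objects of $Q$, and $T_Q(A\to S_Q)$ is the set of isomorphism classes of pairs of an arrow $f\in Q(x_1,\dots,x_n;y)$ and labels $a_1,\dots,a_n\in A$ over the classes of $x_1,\dots,x_n$, mapped to the class of $y$ (isomorphisms being those of $\mathrm{elt}(Q)$ that respect labels). The unit sends $a$ to an identity labelled by $a$; the multiplication composes an arrow with the arrows in its labels, via object-isomorphisms. **Proposition.** For every $k\ge0$ the symmetric multicategory $I^{k+}$ is tidy, $\zeta(I^{k+})$ is a cartesian monad, $(\mathbf{Set},\mathrm{id})^{k'}$ is a cartesian monad that admits free operads (so that the iteration continues), and there is an isomorphism in $\mathbf{CartMonad}$ $$\zeta(I^{k+})\;\cong\;(\mathbf{Set},\mathrm{id})^{k'}.$$ Moreover there are sets $S_k$ and cartesian monads $T_k$ on $\mathbf{Set}/S_k$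 ($k\ge0$) such that $S_0=1$, the set $S_{k+1}$ is the underlying set of $T_k(\mathrm{id}\colon S_k\to S_k)$, and $(\mathbf{Set},\mathrm{id})^{k'}\cong(\mathbf{Set}/S_k,T_k)$ in $\mathbf{CartMonad}$ for every $k\ge0$. -/

import Mathlib

open CategoryTheory CategoryTheory.Limits

/-- A symmetric multicategory with a category of objects.

`Hom x y` is the set `Q(x₁, …, xₖ; y)`, where the family `x` of sources is indexed by a finite set
`ι` (a list of length `k` is a family indexed by `Fin k`), `iota` is the arrow associated with an
object-morphism, `comp` is composition, and `push e` is the symmetric action: for a permutation `σ`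
of `Fin k` the arrow `f σ : Hom (x ∘ σ) y` is `push σ⁻¹ f`. -/
structure SymMulticat where
  /-- The objects. -/
  Obj : Type
  /-- The object-category. -/
  [cat : Category.{0} Obj]
  /-- The arrows with given source and target. -/
  Hom : ∀ {ι : Type} [Finite ι], (ι → Obj) → Obj → Type
  /-- The arrow associated with an object-morphism. -/
  iota : ∀ {x y : Obj}, (x ⟶ y) → Hom (fun _ : Unit => x) y
  /-- The composite `f ∘ (gᵢ)ᵢ`. -/
  comp : ∀ {ι : Type} [Finite ι] {κ : ι → Type} [∀ i, Finite (κ i)] {x : ι → Obj} {y : Obj}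
    {z : ∀ i, κ i → Obj}, Hom x y → (∀ i, Hom (z i) (x i)) → Hom (fun p : Σ i, κ i => z p.1 p.2) y
  /-- The symmetric action. -/
  push : ∀ {ι κ : Type} [Finite ι] [Finite κ] (e : ι ≃ κ) {x : κ → Obj} {y : Obj},
    Hom (fun i => x (e i)) y → Hom x y
  /-- Left unit law. -/
  one_comp : ∀ {ι : Type} [Finite ι] {x : ι → Obj} {y : Obj} (f : Hom x y),
    push ⟨fun p : Σ _ : Unit, ι => p.2, fun i => ⟨(), i⟩, fun _ => rfl, fun _ => rfl⟩
      (comp (iota (𝟙 y)) (fun _ => f)) = f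
  /-- Right unit law. -/
  comp_one : ∀ {ι : Type} [Finite ι] {x : ι → Obj} {y : Obj} (f : Hom x y),
    push ⟨fun p : Σ _ : ι, Unit => p.1, fun i => ⟨i, ()⟩, fun _ => rfl, fun _ => rfl⟩
      (comp f (fun i => iota (𝟙 (x i)))) = f
  /-- Associativity. -/
  assoc : ∀ {ι : Type} [Finite ι] {κ : ι → Type} [∀ i, Finite (κ i)]
    {μ : ∀ i, κ i → Type} [∀ i k, Finite (μ i k)] {x : ι → Obj} {y : Obj}
    {z : ∀ i, κ i → Obj} {w : ∀ i k, μ i k → Obj}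
    (f : Hom x y) (g : ∀ i, Hom (z i) (x i)) (h : ∀ i k, Hom (w i k) (z i k)),
    push (x := fun q : Σ i, Σ k, μ i k => w q.1 q.2.1 q.2.2) (Equiv.sigmaAssoc μ)
      (comp (comp f g) (fun p => h p.1 p.2)) = comp f (fun i => comp (g i) (h i))
  /-- The symmetric action is an action. -/
  push_refl : ∀ {ι : Type} [Finite ι] {x : ι → Obj} {y : Obj} (f : Hom x y),
    push (Equiv.refl ι) f = f
  push_push : ∀ {ι κ μ : Type} [Finite ι] [Finite κ] [Finite μ] (e : ι ≃ κ) (e' : κ ≃ μ)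
    {x : μ → Obj} {y : Obj} (f : Hom (fun i => x (e' (e i))) y),
    push e' (push (x := fun k => x (e' k)) e f) = push (e.trans e') f
  /-- Composition is equivariant in its first argument. -/
  push_comp : ∀ {ι κ : Type} [Finite ι] [Finite κ] (e : ι ≃ κ) {μ : κ → Type} [∀ k, Finite (μ k)]
    {x : κ → Obj} {y : Obj} {z : ∀ k, μ k → Obj} (f : Hom (fun i => x (e i)) y)
    (g : ∀ k, Hom (z k) (x k)),
    comp (push e f) g = push (x := fun p : Σ k, μ k => z p.1 p.2) (Equiv.sigmaCongrLeft e)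
      (comp f (fun i => g (e i)))
  /-- Composition is equivariant in its other arguments. -/
  comp_push : ∀ {ι : Type} [Finite ι] {κ μ : ι → Type} [∀ i, Finite (κ i)] [∀ i, Finite (μ i)]
    (e : ∀ i, κ i ≃ μ i) {x : ι → Obj} {y : Obj} {z : ∀ i, μ i → Obj} (f : Hom x y)
    (g : ∀ i, Hom (fun k => z i (e i k)) (x i)),
    comp f (fun i => push (e i) (g i)) =
      push (x := fun p : Σ i, μ i => z p.1 p.2) (Equiv.sigmaCongrRight e) (comp f g)
  /-- `ι` respects composition of object-morphisms. -/
  iota_comp : ∀ {x y z : Obj} (a : x ⟶ y) (b : y ⟶ z),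
    push ⟨fun _ : Σ _ : Unit, Unit => (), fun _ => ⟨(), ()⟩, fun _ => rfl, fun _ => rfl⟩
      (comp (iota b) (fun _ => iota a)) = iota (a ≫ b)

namespace SymMulticat

attribute [instance] SymMulticat.cat

variable (Q : SymMulticat)

/-- The set `a(Q)` of all arrows of `Q`, with source a list of objects. -/
structure Arr where
  /-- The arity. -/
  n : ℕ
  /-- The source. -/
  src : Fin n → Q.Obj
  /-- The target. -/
  tgt : Q.Obj
  /-- The arrow. -/
  hom : Q.Hom src tgt

variable {Q}

/-- The composite `ι(b) ∘ f`. -/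
def post {ι : Type} [Finite ι] {x : ι → Q.Obj} {y z : Q.Obj} (b : y ⟶ z) (f : Q.Hom x y) :
    Q.Hom x z :=
  Q.push ⟨fun p : Σ _ : Unit, ι => p.2, fun i => ⟨(), i⟩, fun _ => rfl, fun _ => rfl⟩
    (Q.comp (Q.iota b) (fun _ => f))

/-- The composite `f ∘ (ι(aᵢ))ᵢ`. -/
def pre {ι : Type} [Finite ι] {x x' : ι → Q.Obj} {y : Q.Obj} (a : ∀ i, x' i ⟶ x i)
    (f : Q.Hom x y) : Q.Hom x' y :=
  Q.push ⟨fun p : Σ _ : ι, Unit => p.1, fun i => ⟨i, ()⟩, fun _ => rfl, fun _ => rfl⟩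
    (Q.comp f (fun i => Q.iota (a i)))

section lemmas
variable {ι κ : Type} [Finite ι] [Finite κ] {x x' x'' : ι → Q.Obj} {y z w : Q.Obj}

theorem post_id (f : Q.Hom x y) : post (𝟙 y) f = f := Q.one_comp f

theorem pre_id (f : Q.Hom x y) : pre (fun i => 𝟙 (x i)) f = f := Q.comp_one f

theorem post_push (e : ι ≃ κ) {x : κ → Q.Obj} (b : y ⟶ z) (f : Q.Hom (fun i => x (e i)) y) :
    post b (Q.push e f) = Q.push e (post b f) := by
  unfold post
  have := Q.comp_push (κ := fun _ : Unit => ι) (μ := fun _ : Unit => κ) (fun _ => e) (z := fun _ => x) (Q.iota b) (fun _ => f)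
  rw [this, Q.push_push]
  erw [Q.push_push]
  rfl

theorem pre_push (e : ι ≃ κ) {x x' : κ → Q.Obj} (a : ∀ k, x' k ⟶ x k)
    (f : Q.Hom (fun i => x (e i)) y) :
    pre a (Q.push e f) = Q.push e (pre (x' := fun i => x' (e i)) (fun i => a (e i)) f) := by
  unfold pre
  rw [Q.push_comp]
  erw [Q.push_push, Q.push_push]
  rfl

theorem post_post (b : y ⟶ z) (c : z ⟶ w) (f : Q.Hom x y) :
    post c (post b f) = post (b ≫ c) f := by
  unfold post
  rw [← Q.iota_comp, Q.comp_push (κ := fun _ : Unit => Σ _ : Unit, ι) (μ := fun _ : Unit => ι) (fun _ => _) (z := fun _ => x)]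
  rw [Q.push_comp]
  erw [Q.push_push, Q.push_push, ← Q.assoc, Q.push_push]
  rfl

theorem pre_pre (a : ∀ i, x' i ⟶ x i) (b : ∀ i, x'' i ⟶ x' i) (f : Q.Hom x y) :
    pre b (pre a f) = pre (fun i => b i ≫ a i) f := by
  unfold pre
  simp only [← Q.iota_comp]
  rw [Q.comp_push (κ := fun _ : ι => Σ _ : Unit, Unit) (μ := fun _ : ι => Unit) (fun _ => _) (z := fun i _ => x'' i)]
  rw [Q.push_comp]
  erw [Q.push_push, Q.push_push, ← Q.assoc, Q.push_push]
  rfl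

theorem pre_post (a : ∀ i, x' i ⟶ x i) (b : y ⟶ z) (f : Q.Hom x y) :
    pre a (post b f) = post b (pre a f) := by
  unfold pre post
  rw [Q.comp_push (κ := fun _ : Unit => Σ _ : ι, Unit) (μ := fun _ : Unit => ι) (fun _ => _) (z := fun _ => x')]
  rw [Q.push_comp]
  erw [Q.push_push, Q.push_push, ← Q.assoc, Q.push_push]
  rfl

theorem comp_post {μ : ι → Type} [∀ i, Finite (μ i)] {v : ∀ i, μ i → Q.Obj} (b : y ⟶ z)
    (f : Q.Hom x y) (g : ∀ i, Q.Hom (v i) (x i)) :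
    Q.comp (post b f) g = post b (Q.comp f g) := by
  unfold post
  rw [Q.push_comp, ← Q.assoc]
  erw [Q.push_push]
  rfl

/-- Relabelling of the inputs along a bijection `e`, when the sources match propositionally. -/
def reindex (e : ι ≃ κ) {x' : κ → Q.Obj} (h : ∀ i, x' (e i) = x i) (f : Q.Hom x y) : Q.Hom x' y :=
  Q.push e (cast (by rw [funext h]) f)

theorem reindex_rfl (e : ι ≃ κ) {x' : κ → Q.Obj} (f : Q.Hom (fun i => x' (e i)) y) :
    reindex e (fun _ => rfl) f = Q.push e f := rfl

theorem reindex_refl (f : Q.Hom x y) : reindex (Equiv.refl ι) (fun _ => rfl) f = f :=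
  Q.push_refl f

theorem reindex_reindex {μ : Type} [Finite μ] (e : ι ≃ κ) (e' : κ ≃ μ) {x' : κ → Q.Obj}
    {x'' : μ → Q.Obj} (h : ∀ i, x' (e i) = x i) (h' : ∀ k, x'' (e' k) = x' k) (f : Q.Hom x y) :
    reindex e' h' (reindex e h f) =
      reindex (e.trans e') (fun i => (h' (e i)).trans (h i)) f := by
  obtain rfl : x = fun i => x' (e i) := (funext h).symm
  obtain rfl : x' = fun k => x'' (e' k) := (funext h').symm
  exact Q.push_push e e' f

theorem post_reindex (e : ι ≃ κ) {x' : κ → Q.Obj} (h : ∀ i, x' (e i) = x i) (b : y ⟶ z)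
    (f : Q.Hom x y) : post b (reindex e h f) = reindex e h (post b f) := by
  obtain rfl : x = fun i => x' (e i) := (funext h).symm
  exact post_push e b f

theorem comp_reindex {κ μ : ι → Type} [∀ i, Finite (κ i)] [∀ i, Finite (μ i)]
    (e : ∀ i, κ i ≃ μ i) {v : ∀ i, κ i → Q.Obj} {v' : ∀ i, μ i → Q.Obj}
    (h : ∀ i k, v' i (e i k) = v i k) (f : Q.Hom x y) (g : ∀ i, Q.Hom (v i) (x i)) :
    Q.comp f (fun i => reindex (e i) (h i) (g i)) =
      reindex (Equiv.sigmaCongrRight e) (fun p => h p.1 p.2) (Q.comp f g) := by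
  obtain rfl : v = fun i k => v' i (e i k) := by funext i k; exact (h i k).symm
  exact Q.comp_push e f g

theorem post_comp_reindex {κ μ : ι → Type} [∀ i, Finite (κ i)] [∀ i, Finite (μ i)]
    (e : ∀ i, κ i ≃ μ i) {v : ∀ i, κ i → Q.Obj} {v' : ∀ i, μ i → Q.Obj}
    (h : ∀ i k, v' i (e i k) = v i k) (b : y ⟶ z) (f : Q.Hom x y) (g : ∀ i, Q.Hom (v i) (x i)) :
    post b (Q.comp f (fun i => reindex (e i) (h i) (g i))) =
      reindex (Equiv.sigmaCongrRight e) (fun p => h p.1 p.2) (post b (Q.comp f g)) := by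
  rw [comp_reindex]; erw [post_reindex]

theorem post_comp_reindex_comp {κ : ι → Type} [∀ i, Finite (κ i)] {μ : ∀ i, κ i → Type}
    [∀ i k, Finite (μ i k)] {ν : ι → Type} [∀ i, Finite (ν i)] {v : ∀ i, κ i → Q.Obj}
    {u : ∀ i k, μ i k → Q.Obj} {t : ∀ i, ν i → Q.Obj} (e : ∀ i, (Σ k, μ i k) ≃ ν i)
    (h : ∀ i p, t i (e i p) = u i p.1 p.2) (b : y ⟶ z) (f : Q.Hom x y)
    (g : ∀ i, Q.Hom (v i) (x i)) (k : ∀ i j, Q.Hom (u i j) (v i j)) :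
    post b (Q.comp f (fun i => reindex (e i) (h i) (Q.comp (g i) (k i)))) =
      reindex (x := fun p : Σ q : Σ i, κ i, μ q.1 q.2 => u p.1.1 p.1.2 p.2)
        (x' := fun p : Σ i, ν i => t p.1 p.2)
        ((Equiv.sigmaAssoc μ).trans (Equiv.sigmaCongrRight e)) (fun p => h p.1.1 ⟨p.1.2, p.2⟩)
        (Q.comp (post b (Q.comp f g)) (fun p => k p.1 p.2)) := by
  rw [post_comp_reindex, ← Q.assoc]; erw [post_push, comp_post]
  exact reindex_reindex (Q := Q) (Equiv.sigmaAssoc μ) (Equiv.sigmaCongrRight e) (fun _ => rfl) _ _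

theorem reindex_post_reindex_comp {lf : Type} [Finite lf] {κ μ : ι → Type} [∀ i, Finite (κ i)]
    [∀ i, Finite (μ i)] {ν ξ : Type} [Finite ν] [Finite ξ] (b : lf ≃ ι)
    (e : ∀ i, κ i ≃ μ i) (e₁ : (Σ m, μ (b m)) ≃ ν) (e₂ : ν ≃ ξ) {v : ∀ i, κ i → Q.Obj}
    {v' : ∀ i, μ i → Q.Obj} {t : ν → Q.Obj} {t' : ξ → Q.Obj} (h : ∀ i k, v' i (e i k) = v i k)
    (h₁ : ∀ p, t (e₁ p) = v' (b p.1) p.2) (h₂ : ∀ n, t' (e₂ n) = t n)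
    (e' : (Σ i, κ i) ≃ ξ) (he' : ∀ m k, e' ⟨b m, k⟩ = e₂ (e₁ ⟨m, e _ k⟩))
    (h' : ∀ p, t' (e' p) = v p.1 p.2) (a : y ⟶ z)
    (f : Q.Hom (fun m => x (b m)) y) (g : ∀ i, Q.Hom (v i) (x i)) :
    reindex e₂ h₂ (post a (reindex e₁ h₁
      (Q.comp f (fun m => reindex (e (b m)) (h (b m)) (g (b m)))))) =
    reindex e' h' (post a (Q.comp (Q.push b f) g)) := by
  rw [comp_reindex]; erw [reindex_reindex, post_reindex, reindex_reindex]; rw [Q.push_comp]; erw [post_push]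
  refine Eq.trans ?_ (reindex_reindex (Q := Q) (Equiv.sigmaCongrLeft b) e' (fun _ => rfl) h'
    (post a (Q.comp f (fun m => g (b m))))).symm
  congr 1
  ext p
  exact (he' p.1 p.2).symm

end lemmas

/-- The bijection used for the nodes of a graft. -/
def sumSigmaEquiv {J : Type} {A C L : J → Type} {B : ∀ j, L j → Type}
    (E : ∀ j, (A j ⊕ Σ l, B j l) ≃ C j) :
    ((Unit ⊕ Σ j, A j) ⊕ Σ p : Σ j, L j, B p.1 p.2) ≃ Unit ⊕ Σ j, C j where
  toFun p := Sum.elim (Sum.elim Sum.inl (fun q => Sum.inr ⟨q.1, E q.1 (Sum.inl q.2)⟩))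
    (fun q => Sum.inr ⟨q.1.1, E q.1.1 (Sum.inr ⟨q.1.2, q.2⟩)⟩) p
  invFun p := Sum.elim (fun u => Sum.inl (Sum.inl u)) (fun q => Sum.elim
    (fun N => Sum.inl (Sum.inr ⟨q.1, N⟩)) (fun r => Sum.inr ⟨⟨q.1, r.1⟩, r.2⟩)
    ((E q.1).symm q.2)) p
  left_inv := by rintro ((_ | ⟨j, N⟩) | ⟨⟨j, l⟩, N⟩) <;> simp
  right_inv := by
    rintro (_ | ⟨j, N⟩)
    · rfl
    · obtain ⟨p, rfl⟩ := (E j).surjective N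
      rcases p with N | ⟨l, N⟩ <;> simp

/-- Planar trees whose nodes are labelled by elements of `ι` (an element `i` standing for the arrow
`F i` of `Q`), whose leaves are labelled by elements of `L` (an element `l` standing for the object
`X l`), and whose edges are labelled by object-morphisms. The edge below a node labelled `i` carries
a morphism with domain the target of `F i`, the edge above it in position `j` carries a morphism
with codomain the `j`-th source of `F i`. The index of the type is the codomain of the label of the
root edge. A leaf is an edge whose upper end is not a node, and `leaf l a` is the tree with a single
edge and no nodes. -/
inductive Tree (Q : SymMulticat) {ι L : Type} (F : ι → Q.Arr) (X : L → Q.Obj) : Q.Obj → Type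
  | leaf {y : Q.Obj} (l : L) (a : X l ⟶ y) : Tree Q F X y
  | node {y : Q.Obj} (i : ι) (a : (F i).tgt ⟶ y) (s : ∀ j, Tree Q F X ((F i).src j)) : Tree Q F X y

namespace Tree

variable {ι κ L M : Type} {F : ι → Q.Arr} {G : κ → Q.Arr} {X : L → Q.Obj} {Y : M → Q.Obj}

/-- The set of leaves. -/
def Leaf {y : Q.Obj} : Tree Q F X y → Type
  | leaf _ _ => Unit
  | node _ _ s => Σ j, Leaf (s j)

/-- The label of a leaf. -/
def leafLabel {y : Q.Obj} : (T : Tree Q F X y) → T.Leaf → L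
  | leaf l _, _ => l
  | node _ _ s, p => leafLabel (s p.1) p.2

/-- The set of nodes. -/
def Node {y : Q.Obj} : Tree Q F X y → Type
  | leaf _ _ => Empty
  | node _ _ s => Unit ⊕ Σ j, Node (s j)

/-- The label of a node. -/
def nodeLabel {y : Q.Obj} : (T : Tree Q F X y) → T.Node → ι
  | node i _ s, p => Sum.elim (fun _ => i) (fun q => nodeLabel (s q.1) q.2) p

instance finiteLeaf {y : Q.Obj} : (T : Tree Q F X y) → Finite T.Leaf
  | leaf _ _ => inferInstanceAs (Finite Unit)
  | node _ _ s => have := fun j => finiteLeaf (s j); inferInstanceAs (Finite (Σ j, Leaf (s j)))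

/-- The arrow of `Q` obtained by composing the arrows at the nodes, its inputs being the leaves. -/
def eval {y : Q.Obj} : (T : Tree Q F X y) → Q.Hom (fun l : T.Leaf => X (T.leafLabel l)) y
  | leaf _ a => Q.iota a
  | node i a s => SymMulticat.post a (Q.comp (F i).hom (fun j => eval (s j)))

/-- Composing the label of the root edge with an object-morphism. -/
def post {y z : Q.Obj} (b : y ⟶ z) : Tree Q F X y → Tree Q F X z
  | leaf l a => leaf l (a ≫ b)
  | node i a s => node i (a ≫ b) s

/-- Grafting the tree `U l` onto each leaf labelled `l`. -/
def graft {y : Q.Obj} (T : Tree Q F X y) (U : ∀ l, Tree Q F Y (X l)) : Tree Q F Y y :=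
  match T with
  | leaf l a => (U l).post a
  | node i a s => node i a (fun j => (s j).graft U)

/-- Replacing each node labelled `i` by the tree `S i`. -/
def subst {y : Q.Obj} (T : Tree Q F X y) (S : ∀ i, Tree Q G (F i).src (F i).tgt) :
    Tree Q G X y :=
  match T with
  | leaf l a => leaf l a
  | node i a s => ((S i).graft (fun j => (s j).subst S)).post a

/-- Relabelling the nodes along a function. -/
def mapNode {y : Q.Obj} (h : ι → κ) : Tree Q (fun i => G (h i)) X y → Tree Q G X y
  | leaf l a => leaf l a
  | node i a s => node (h i) a (fun j => (s j).mapNode h)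

/-! Equations between trees. -/

theorem post_leaf {y z : Q.Obj} (l : L) (a : X l ⟶ y) (b : y ⟶ z) :
    (leaf l a : Tree Q F X y).post b = leaf l (a ≫ b) := rfl

theorem post_node {y z : Q.Obj} (i : ι) (a : (F i).tgt ⟶ y) (b : y ⟶ z)
    (s : ∀ j, Tree Q F X ((F i).src j)) : (node i a s).post b = node i (a ≫ b) s := rfl

theorem post_id {y : Q.Obj} (T : Tree Q F X y) : T.post (𝟙 y) = T := by
  cases T <;> simp [post_leaf, post_node]

theorem post_post {x y z : Q.Obj} (T : Tree Q F X x) (a : x ⟶ y) (b : y ⟶ z) :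
    (T.post a).post b = T.post (a ≫ b) := by
  cases T <;> simp [post_leaf, post_node]

theorem graft_post {y z : Q.Obj} (T : Tree Q F X y) (a : y ⟶ z) (U : ∀ l, Tree Q F Y (X l)) :
    (T.post a).graft U = (T.graft U).post a := by
  cases T <;> simp [post_leaf, post_node, graft, post_post]

theorem subst_post {y z : Q.Obj} (T : Tree Q F X y) (a : y ⟶ z)
    (S : ∀ i, Tree Q G (F i).src (F i).tgt) : (T.post a).subst S = (T.subst S).post a := by
  cases T <;> simp [post_leaf, post_node, subst, post_post]

theorem mapNode_post {y z : Q.Obj} (h : ι → κ) (T : Tree Q (fun i => G (h i)) X y) (a : y ⟶ z) :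
    (T.post a).mapNode h = (T.mapNode h).post a := by
  cases T <;> simp [post_leaf, post_node, mapNode]

theorem graft_leaf {y : Q.Obj} (T : Tree Q F X y) : T.graft (fun l => leaf l (𝟙 (X l))) = T := by
  induction T <;> simp_all [graft, post_leaf]

theorem graft_graft {N : Type} {Z : N → Q.Obj} {y : Q.Obj} (T : Tree Q F X y)
    (U : ∀ l, Tree Q F Y (X l)) (V : ∀ m, Tree Q F Z (Y m)) :
    (T.graft U).graft V = T.graft (fun l => (U l).graft V) := by
  induction T <;> simp_all [graft, graft_post]

theorem mapNode_graft {y : Q.Obj} (h : ι → κ) (T : Tree Q (fun i => G (h i)) X y)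
    (U : ∀ l, Tree Q (fun i => G (h i)) Y (X l)) :
    (T.graft U).mapNode h = (T.mapNode h).graft (fun l => (U l).mapNode h) := by
  induction T <;> simp_all [graft, mapNode, mapNode_post]

theorem subst_graft {y : Q.Obj} (T : Tree Q F X y) (U : ∀ l, Tree Q F Y (X l))
    (S : ∀ i, Tree Q G (F i).src (F i).tgt) :
    (T.graft U).subst S = (T.subst S).graft (fun l => (U l).subst S) := by
  induction T <;> simp_all [graft, subst, subst_post, graft_post, graft_graft]

theorem subst_subst {μ : Type} {H : μ → Q.Arr} {y : Q.Obj} (T : Tree Q F X y)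
    (S : ∀ i, Tree Q G (F i).src (F i).tgt) (R : ∀ k, Tree Q H (G k).src (G k).tgt) :
    (T.subst S).subst R = T.subst (fun i => (S i).subst R) := by
  induction T <;> simp_all [subst, subst_post, subst_graft]

theorem subst_mapNode {μ : Type} {H : μ → Q.Arr} {y : Q.Obj} (h : ι → κ)
    (T : Tree Q (fun i => G (h i)) X y) (S : ∀ k, Tree Q H (G k).src (G k).tgt) :
    (T.mapNode h).subst S = T.subst (fun i => S (h i)) := by
  induction T <;> simp_all [subst, mapNode]

theorem mapNode_subst {μ : Type} {H : μ → Q.Arr} {y : Q.Obj} (h : κ → μ)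
    (T : Tree Q F X y) (S : ∀ i, Tree Q (fun k => H (h k)) (F i).src (F i).tgt) :
    (T.subst S).mapNode h = T.subst (fun i => (S i).mapNode h) := by
  induction T <;> simp_all [subst, mapNode, mapNode_post, mapNode_graft]

theorem mapNode_mapNode {μ : Type} {H : μ → Q.Arr} {y : Q.Obj} (h : ι → κ) (h' : κ → μ)
    (T : Tree Q (fun i => H (h' (h i))) X y) :
    (mapNode (G := fun k => H (h' k)) h T).mapNode h' = mapNode (G := H) (fun i => h' (h i)) T := by
  induction T <;> simp_all [mapNode]

theorem mapNode_id {y : Q.Obj} (T : Tree Q F X y) : mapNode (G := F) (fun i => i) T = T := by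
  induction T <;> simp_all [mapNode]

theorem subst_corolla {y : Q.Obj} (T : Tree Q F X y) :
    T.subst (fun i => node i (𝟙 _) (fun j => leaf j (𝟙 _))) = T := by
  induction T <;> simp_all [subst, graft, post_node, post_id]

/-! The leaves, the nodes and the value of a tree obtained by grafting or substitution. -/

theorem eval_post {y z : Q.Obj} (T : Tree Q F X y) (b : y ⟶ z) :
    ∃ (E : T.Leaf ≃ (T.post b).Leaf) (h : ∀ l, (T.post b).leafLabel (E l) = T.leafLabel l),
      (T.post b).eval = reindex E (fun l => congrArg X (h l)) (SymMulticat.post b T.eval) := by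
  cases T with
  | leaf l a =>
    exact ⟨Equiv.refl _, fun _ => rfl, (Q.iota_comp a b).symm.trans (reindex_refl _).symm⟩
  | node i a s =>
    exact ⟨Equiv.refl _, fun _ => rfl,
      (SymMulticat.post_post a b _).symm.trans (reindex_refl _).symm⟩

theorem eval_graft {y : Q.Obj} (T : Tree Q F X y) (U : ∀ l, Tree Q F Y (X l)) :
    ∃ (E : (Σ l : T.Leaf, (U (T.leafLabel l)).Leaf) ≃ (T.graft U).Leaf)
      (h : ∀ p, (T.graft U).leafLabel (E p) = (U (T.leafLabel p.1)).leafLabel p.2),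
      (T.graft U).eval = reindex E (fun p => congrArg Y (h p))
        (Q.comp T.eval (fun l => (U (T.leafLabel l)).eval)) := by
  induction T with
  | leaf l a =>
    obtain ⟨E, h, hE⟩ := eval_post (U l) a
    let e : (Σ _ : Unit, (U l).Leaf) ≃ (U l).Leaf :=
      ⟨fun p => p.2, fun i => ⟨(), i⟩, fun _ => rfl, fun _ => rfl⟩
    refine ⟨e.trans E, fun p => h p.2, hE.trans ?_⟩
    exact reindex_reindex (Q := Q) (x' := fun m => Y ((U l).leafLabel m)) e E (fun _ => rfl)
      (fun l => congrArg Y (h l)) (Q.comp (Q.iota a) (fun _ => (U l).eval))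
  | node i a s ih =>
    choose E h hE using ih
    refine ⟨(Equiv.sigmaAssoc (fun j l => (U ((s j).leafLabel l)).Leaf)).trans
      (Equiv.sigmaCongrRight E), fun p => h _ _, ?_⟩
    exact (congrArg (fun g => SymMulticat.post a (Q.comp (F i).hom g)) (funext hE)).trans
      (post_comp_reindex_comp E (fun j p => congrArg Y (h j p)) a (F i).hom (fun j => (s j).eval)
        (fun j l => (U ((s j).leafLabel l)).eval))

theorem eval_subst {y : Q.Obj} (T : Tree Q F X y) (S : ∀ i, Tree Q G (F i).src (F i).tgt)
    (hb : ∀ i, (S i).leafLabel.Bijective)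
    (hS : ∀ i, Q.push (Equiv.ofBijective _ (hb i)) (S i).eval = (F i).hom) :
    ∃ (E : T.Leaf ≃ (T.subst S).Leaf)
      (h : ∀ l, (T.subst S).leafLabel (E l) = T.leafLabel l),
      (T.subst S).eval = reindex E (fun p => congrArg X (h p)) T.eval := by
  induction T with
  | leaf l a => exact ⟨Equiv.refl _, fun _ => rfl, (reindex_refl _).symm⟩
  | node i a s ih =>
    choose E h hE using ih
    obtain ⟨E₁, h₁, hE₁⟩ := eval_graft (S i) (fun j => (s j).subst S)
    obtain ⟨E₂, h₂, hE₂⟩ := eval_post ((S i).graft (fun j => (s j).subst S)) a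
    let b := Equiv.ofBijective _ (hb i)
    let e₀ : (Σ m, (s (b m)).Leaf) ≃ Σ j, (s j).Leaf :=
      Equiv.sigmaCongrLeft (β := fun j => (s j).Leaf) b
    let e₁ : (Σ m, (s (b m)).Leaf) ≃ Σ m, ((s (b m)).subst S).Leaf :=
      Equiv.sigmaCongrRight (fun m => E (b m))
    let E' : (Σ j, (s j).Leaf) ≃ (((S i).graft (fun j => (s j).subst S)).post a).Leaf :=
      e₀.symm.trans ((e₁.trans E₁).trans E₂)
    have he' : ∀ m k, E' ⟨b m, k⟩ = E₂ (E₁ ⟨m, E _ k⟩) := fun m k =>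
      congrArg (fun q => E₂ (E₁ (e₁ q))) (e₀.symm_apply_apply ⟨m, k⟩)
    have h' : ∀ p : Σ j, (s j).Leaf,
        leafLabel (((S i).graft (fun j => (s j).subst S)).post a) (E' p) =
        (s p.1).leafLabel p.2 := by
      rintro ⟨j, l⟩
      obtain ⟨m, rfl⟩ := b.surjective j
      rw [he', h₂, h₁]
      exact h _ _
    refine ⟨E', h', hE₂.trans ?_⟩
    rw [hE₁]
    have := reindex_post_reindex_comp (Q := Q)
      (v' := fun j l => X (((s j).subst S).leafLabel l))
      (t := fun l => X (((S i).graft (fun j => (s j).subst S)).leafLabel l))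
      (t' := fun l => X (leafLabel (((S i).graft (fun j => (s j).subst S)).post a) l)) b E E₁ E₂
      (fun j l => congrArg X (h j l)) (fun p => congrArg X (h₁ p)) (fun n => congrArg X (h₂ n)) E'
      he' (fun p => congrArg X (h' p)) a (S i).eval (fun j => (s j).eval)
    simp only [← hE] at this
    refine this.trans ?_
    rw [hS i]
    rfl

theorem nodes_post {y z : Q.Obj} (T : Tree Q F X y) (b : y ⟶ z) :
    ∃ E : T.Node ≃ (T.post b).Node, ∀ N, (T.post b).nodeLabel (E N) = T.nodeLabel N := by
  cases T with
  | leaf l a => exact ⟨Equiv.refl _, fun N => Empty.elim N⟩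
  | node i a s => exact ⟨Equiv.refl _, fun _ => rfl⟩

theorem nodes_graft {y : Q.Obj} (T : Tree Q F X y) (U : ∀ l, Tree Q F Y (X l)) :
    ∃ E : (T.Node ⊕ Σ l : T.Leaf, (U (T.leafLabel l)).Node) ≃ (T.graft U).Node,
      ∀ p, (T.graft U).nodeLabel (E p) =
        Sum.elim T.nodeLabel (fun q => (U (T.leafLabel q.1)).nodeLabel q.2) p := by
  induction T with
  | leaf l a =>
    obtain ⟨E, h⟩ := nodes_post (U l) a
    refine ⟨((Equiv.emptySum Empty (Σ _ : Unit, (U l).Node)).trans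
      ⟨fun p => p.2, fun i => ⟨(), i⟩, fun _ => rfl, fun _ => rfl⟩).trans E, ?_⟩
    rintro (e | ⟨_, N⟩)
    · exact Empty.elim e
    · exact h N
  | node i a s ih =>
    choose E h using ih
    refine ⟨sumSigmaEquiv E, ?_⟩
    rintro ((_ | ⟨j, N⟩) | ⟨⟨j, l⟩, N⟩)
    · rfl
    · exact h j _
    · exact h j _

theorem nodes_subst {y : Q.Obj} (T : Tree Q F X y) (S : ∀ i, Tree Q G (F i).src (F i).tgt)
    (hb : ∀ i, (S i).leafLabel.Bijective) :
    ∃ E : (Σ N : T.Node, (S (T.nodeLabel N)).Node) ≃ (T.subst S).Node,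
      ∀ p, (T.subst S).nodeLabel (E p) = (S (T.nodeLabel p.1)).nodeLabel p.2 := by
  induction T with
  | leaf l a =>
    exact ⟨⟨fun p => p.1, fun e => Empty.elim e, fun p => Empty.elim p.1, fun e => Empty.elim e⟩,
      fun p => Empty.elim p.1⟩
  | node i a s ih =>
    choose E h using ih
    obtain ⟨E₁, h₁⟩ := nodes_graft (S i) (fun j => (s j).subst S)
    obtain ⟨E₂, h₂⟩ := nodes_post ((S i).graft (fun j => (s j).subst S)) a
    let e₀ : (Σ m, ((s ((S i).leafLabel m)).subst S).Node) ≃ Σ j, ((s j).subst S).Node :=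
      Equiv.sigmaCongrLeft (β := fun j => ((s j).subst S).Node) (Equiv.ofBijective _ (hb i))
    let e₁ : (Σ N : Unit ⊕ Σ j, (s j).Node, (S ((node i a s).nodeLabel N)).Node) ≃
        (S i).Node ⊕ Σ j, Σ N : (s j).Node, (S ((s j).nodeLabel N)).Node :=
      ⟨fun p => match p with
        | ⟨Sum.inl _, N⟩ => Sum.inl N
        | ⟨Sum.inr q, N⟩ => Sum.inr ⟨q.1, q.2, N⟩,
       fun p => match p with
        | Sum.inl N => ⟨Sum.inl (), N⟩
        | Sum.inr q => ⟨Sum.inr ⟨q.1, q.2.1⟩, q.2.2⟩,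
       by rintro ⟨_ | q, N⟩ <;> rfl, by rintro (N | q) <;> rfl⟩
    have key : ∀ p : Σ j, ((s j).subst S).Node,
        ((s ((S i).leafLabel (e₀.symm p).1)).subst S).nodeLabel (e₀.symm p).2 =
          ((s p.1).subst S).nodeLabel p.2 := fun p => by
      obtain ⟨q, rfl⟩ := e₀.surjective p
      rw [e₀.symm_apply_apply]; rfl
    refine ⟨((e₁.trans ((Equiv.refl _).sumCongr ((Equiv.sigmaCongrRight E).trans e₀.symm))).trans
      E₁).trans E₂, ?_⟩
    rintro ⟨_ | ⟨j, N⟩, M⟩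
    · refine (h₂ _).trans ((h₁ _).trans ?_)
      rfl
    · refine (h₂ _).trans ((h₁ _).trans ?_)
      refine (key ⟨j, E j ⟨N, M⟩⟩).trans ?_
      exact h j _

theorem mapNode_spec {y : Q.Obj} (h : ι → κ) (T : Tree Q (fun i => G (h i)) X y) :
    ∃ (E : T.Leaf ≃ (T.mapNode h).Leaf)
      (hE : ∀ l, (T.mapNode h).leafLabel (E l) = T.leafLabel l)
      (E' : T.Node ≃ (T.mapNode h).Node),
      (T.mapNode h).eval = reindex E (fun p => congrArg X (hE p)) T.eval ∧
      ∀ N, (T.mapNode h).nodeLabel (E' N) = h (T.nodeLabel N) := by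
  induction T with
  | leaf l a =>
    exact ⟨Equiv.refl _, fun _ => rfl, Equiv.refl _, (reindex_refl _).symm, fun N => Empty.elim N⟩
  | node i a s ih =>
    choose E hE E' hv hN using ih
    refine ⟨Equiv.sigmaCongrRight E, fun p => hE _ _,
      (Equiv.refl Unit).sumCongr (Equiv.sigmaCongrRight E'), ?_, ?_⟩
    · exact (congrArg (fun g => SymMulticat.post a (Q.comp (G (h i)).hom g)) (funext hv)).trans
        (post_comp_reindex E (fun j l => congrArg X (hE j l)) a (G (h i)).hom
          (fun j => (s j).eval))
    · rintro (_ | ⟨j, N⟩)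
      · rfl
      · exact hN j N

end Tree
/-! The category `elt(Q)` of arrows of `Q`. -/

section elt

variable {ι κ μ : Type} [Finite ι] [Finite κ] [Finite μ] {x : ι → Q.Obj} {x' : κ → Q.Obj}
  {x'' : μ → Q.Obj} {y y' y'' : Q.Obj}

/-- A morphism `f ⟶ f'` in `elt(Q)`: a bijection of the inputs together with object-morphisms
between the sources and between the targets, whose action takes `f` to `f'`. -/
@[ext]
structure EltHom (f : Q.Hom x y) (f' : Q.Hom x' y') where
  /-- The bijection of the inputs. -/
  perm : ι ≃ κ
  /-- The object-morphisms at the inputs. -/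
  inp : ∀ i, x' (perm i) ⟶ x i
  /-- The object-morphism at the output. -/
  out : y ⟶ y'
  /-- The action takes `f` to `f'`. -/
  eq : Q.push perm (pre inp (post out f)) = f'

theorem act_act (p : ι ≃ κ) (p' : κ ≃ μ) (i : ∀ k, x' (p k) ⟶ x k) (i' : ∀ k, x'' (p' k) ⟶ x' k)
    (o : y ⟶ y') (o' : y' ⟶ y'') (f : Q.Hom x y) :
    Q.push p' (pre i' (post o' (Q.push p (pre i (post o f))))) =
      Q.push (p.trans p')
        (pre (x' := fun k => x'' (p' (p k))) (fun k => i' (p k) ≫ i k) (post (o ≫ o') f)) := by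
  rw [post_push, pre_push, ← pre_post, pre_pre, post_post]
  exact Q.push_push p p' _

/-- The identity. -/
def EltHom.id (f : Q.Hom x y) : EltHom f f where
  perm := Equiv.refl _
  inp := fun i => 𝟙 (x i)
  out := 𝟙 y
  eq := (Q.push_refl _).trans ((pre_id _).trans (post_id _))

/-- Composition. -/
def EltHom.comp {f : Q.Hom x y} {f' : Q.Hom x' y'} {f'' : Q.Hom x'' y''} (a : EltHom f f')
    (b : EltHom f' f'') : EltHom f f'' where
  perm := a.perm.trans b.perm
  inp := fun i => b.inp (a.perm i) ≫ a.inp i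
  out := a.out ≫ b.out
  eq := by
    obtain ⟨p, i, o, rfl⟩ := a
    obtain ⟨p', i', o', rfl⟩ := b
    exact (act_act p p' i i' o o' f).symm

end elt

instance eltCategory : Category.{0} Q.Arr where
  Hom g g' := EltHom g.hom g'.hom
  id g := EltHom.id g.hom
  comp a b := a.comp b
  id_comp a := by ext <;> simp [EltHom.comp, EltHom.id]
  comp_id a := by ext <;> simp [EltHom.comp, EltHom.id]
  assoc a b c := by ext <;> simp [EltHom.comp]

/-! The slice construction. -/

/-- An arrow of the slice multicategory with source `(Fᵢ)ᵢ` and target `f`: a configuration for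
composing the `Fᵢ` to yield `f`. It is a planar tree whose nodes are in bijection with the index set
of the family `F` and whose leaves are in bijection with the inputs of `f`. -/
@[ext]
structure Config {ι : Type} (F : ι → Q.Arr) (f : Q.Arr) where
  /-- The tree. -/
  tree : Tree Q F f.src f.tgt
  /-- Each `Fᵢ` labels exactly one node. -/
  node_bij : tree.nodeLabel.Bijective
  /-- Each input of `f` labels exactly one leaf. -/
  leaf_bij : tree.leafLabel.Bijective
  /-- The result of composing according to the tree and applying the symmetric action is `f`. -/
  eval_eq : Q.push (Equiv.ofBijective _ leaf_bij) tree.eval = f.hom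

/-- The tree with one node determined by a morphism of `elt(Q)`. -/
def Config.single {g g' : Q.Arr} (a : g ⟶ g') : Config (fun _ : Unit => g) g' where
  tree := .node () (EltHom.out a) (fun j => .leaf (EltHom.perm a j) (EltHom.inp a j))
  node_bij := by
    constructor
    · rintro (u | ⟨j, N⟩) (v | ⟨k, M⟩) _
      · rfl
      · exact Empty.elim M
      · exact Empty.elim N
      · exact Empty.elim N
    · exact fun _ => ⟨Sum.inl (), rfl⟩
  leaf_bij := by
    constructor
    · rintro ⟨j, ⟨⟩⟩ ⟨k, ⟨⟩⟩ h
      obtain rfl : j = k := (EltHom.perm a).injective h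
      rfl
    · exact fun l => ⟨⟨(EltHom.perm a).symm l, ()⟩, (EltHom.perm a).apply_symm_apply l⟩
  eval_eq := by
    refine Eq.trans ?_ (EltHom.eq a)
    rw [pre_post]
    unfold pre
    rw [post_push]
    refine Eq.trans ?_ (Q.push_push (⟨fun p : Σ _ : Fin g.n, Unit => p.1, fun i => ⟨i, ()⟩,
      fun _ => rfl, fun _ => rfl⟩ : (Σ _ : Fin g.n, Unit) ≃ Fin g.n) (EltHom.perm a) _).symm
    congr 1
    exact Equiv.ext fun _ => rfl

theorem Tree.transfer {ι κ L : Type} [Finite L] {F : ι → Q.Arr} {G : κ → Q.Arr} {X : L → Q.Obj}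
    {y : Q.Obj} {T : Tree Q F X y} {T' : Tree Q G X y} (hb : T.leafLabel.Bijective)
    (E : T.Leaf ≃ T'.Leaf) (h : ∀ l, T'.leafLabel (E l) = T.leafLabel l)
    (hv : T'.eval = reindex E (fun l => congrArg X (h l)) T.eval) :
    ∃ hb' : T'.leafLabel.Bijective,
      Q.push (Equiv.ofBijective _ hb') T'.eval = Q.push (Equiv.ofBijective _ hb) T.eval := by
  have hb' : T'.leafLabel.Bijective := by
    have : T'.leafLabel = T.leafLabel ∘ E.symm := by
      funext l
      simpa using h (E.symm l)
    rw [this]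
    exact hb.comp E.symm.bijective
  refine ⟨hb', ?_⟩
  rw [hv]
  refine (reindex_reindex (Q := Q) E (Equiv.ofBijective _ hb') (x' := fun l => X (T'.leafLabel l))
    (x'' := X) (fun l => congrArg X (h l)) (fun _ => rfl) T.eval).trans ?_
  have e : E.trans (Equiv.ofBijective _ hb') = Equiv.ofBijective _ hb := Equiv.ext h
  change reindex (E.trans (Equiv.ofBijective _ hb')) _ T.eval =
    reindex (Equiv.ofBijective _ hb) (fun _ => rfl) T.eval
  congr 1

theorem Config.push_aux {ι κ : Type} (e : ι ≃ κ) {F : κ → Q.Arr} {f : Q.Arr}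
    (T : Config (fun i => F (e i)) f) :
    (T.tree.mapNode (G := F) e).nodeLabel.Bijective ∧
    ∃ hb : (T.tree.mapNode (G := F) e).leafLabel.Bijective,
      Q.push (Equiv.ofBijective _ hb) (T.tree.mapNode (G := F) e).eval = f.hom := by
  obtain ⟨E, hE, E', hv, hN⟩ := T.tree.mapNode_spec (G := F) e
  refine ⟨?_, ?_⟩
  · have : (T.tree.mapNode (G := F) e).nodeLabel = e ∘ T.tree.nodeLabel ∘ E'.symm := by
      funext N
      simpa using hN (E'.symm N)
    rw [this]
    exact e.bijective.comp (T.node_bij.comp E'.symm.bijective)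
  · obtain ⟨hb, h⟩ := Tree.transfer T.leaf_bij E hE hv
    exact ⟨hb, h.trans T.eval_eq⟩

/-- The symmetric action in the slice. -/
def Config.push {ι κ : Type} (e : ι ≃ κ) {F : κ → Q.Arr} {f : Q.Arr}
    (T : Config (fun i => F (e i)) f) : Config F f where
  tree := T.tree.mapNode e
  node_bij := (Config.push_aux e T).1
  leaf_bij := (Config.push_aux e T).2.1
  eval_eq := (Config.push_aux e T).2.2

theorem Config.comp_aux {ι κ : Type} {F : ι → Q.Arr} {G : κ → Q.Arr} {f : Q.Arr}
    (T : Config F f) (S : ∀ i, Tree Q G (F i).src (F i).tgt)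
    (hS : ∀ i, ∃ hb : (S i).leafLabel.Bijective,
      Q.push (Equiv.ofBijective _ hb) (S i).eval = (F i).hom)
    (hN : (fun p : Σ i, (S i).Node => (S p.1).nodeLabel p.2).Bijective) :
    (T.tree.subst S).nodeLabel.Bijective ∧
    ∃ hb : (T.tree.subst S).leafLabel.Bijective,
      Q.push (Equiv.ofBijective _ hb) (T.tree.subst S).eval = f.hom := by
  choose hb hS using hS
  refine ⟨?_, ?_⟩
  · obtain ⟨E, hE⟩ := T.tree.nodes_subst S hb
    have : (T.tree.subst S).nodeLabel =
        (fun p : Σ i, (S i).Node => (S p.1).nodeLabel p.2) ∘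
          (Equiv.sigmaCongrLeft (β := fun i => (S i).Node) (Equiv.ofBijective _ T.node_bij)) ∘
            E.symm := by
      funext N
      exact (congrArg _ (E.apply_symm_apply N)).symm.trans (hE (E.symm N))
    rw [this]
    exact hN.comp ((Equiv.bijective _).comp E.symm.bijective)
  · obtain ⟨E, hE, hv⟩ := T.tree.eval_subst S hb hS
    obtain ⟨hb, h⟩ := Tree.transfer T.leaf_bij E hE hv
    exact ⟨hb, h.trans T.eval_eq⟩

theorem Config.comp_aux' {ι : Type} {κ : ι → Type} {F : ι → Q.Arr} {G : ∀ i, κ i → Q.Arr}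
    (S : ∀ i, Config (G i) (F i)) :
    (∀ i, ∃ hb : ((S i).tree.mapNode (G := fun p : Σ i, κ i => G p.1 p.2)
        (Sigma.mk i)).leafLabel.Bijective,
      Q.push (Equiv.ofBijective _ hb) ((S i).tree.mapNode (G := fun p : Σ i, κ i => G p.1 p.2)
        (Sigma.mk i)).eval = (F i).hom) ∧
    (fun p : Σ i, ((S i).tree.mapNode (G := fun p : Σ i, κ i => G p.1 p.2) (Sigma.mk i)).Node =>
      Tree.nodeLabel _ p.2).Bijective := by
  refine ⟨fun i => ?_, ?_⟩
  · obtain ⟨E, hE, E', hv, hN⟩ := (S i).tree.mapNode_spec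
      (G := fun p : Σ i, κ i => G p.1 p.2) (Sigma.mk i)
    obtain ⟨hb, h⟩ := Tree.transfer (S i).leaf_bij E hE hv
    exact ⟨hb, h.trans (S i).eval_eq⟩
  · choose E hE E' hv hN using fun i => (S i).tree.mapNode_spec
      (G := fun p : Σ i, κ i => G p.1 p.2) (Sigma.mk i)
    have : (fun p : Σ i, ((S i).tree.mapNode (G := fun p : Σ i, κ i => G p.1 p.2)
        (Sigma.mk i)).Node => Tree.nodeLabel _ p.2) =
        Equiv.sigmaCongrRight (fun i => ((E' i).symm.trans
          (Equiv.ofBijective _ (S i).node_bij))) := by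
      funext ⟨i, N⟩
      simpa using hN i ((E' i).symm N)
    rw [this]
    exact Equiv.bijective _

/-- Composition in the slice: each node of `T` is replaced by the corresponding tree. -/
def Config.comp {ι : Type} {κ : ι → Type} {F : ι → Q.Arr} {f : Q.Arr} {G : ∀ i, κ i → Q.Arr}
    (T : Config F f) (S : ∀ i, Config (G i) (F i)) : Config (fun p : Σ i, κ i => G p.1 p.2) f where
  tree := T.tree.subst
    (fun i => (S i).tree.mapNode (G := fun p : Σ i, κ i => G p.1 p.2) (Sigma.mk i))
  node_bij := (T.comp_aux _ (Config.comp_aux' S).1 (Config.comp_aux' S).2).1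
  leaf_bij := (T.comp_aux _ (Config.comp_aux' S).1 (Config.comp_aux' S).2).2.1
  eval_eq := (T.comp_aux _ (Config.comp_aux' S).1 (Config.comp_aux' S).2).2.2

/-- The slice `Q⁺`. -/
def slice (Q : SymMulticat) : SymMulticat where
  Obj := Q.Arr
  Hom F f := Config F f
  iota a := Config.single a
  comp T S := T.comp S
  push e _ _ T := T.push e
  one_comp {ι _ F f} T := by
    apply Config.ext
    have h : ((Config.single (𝟙 f)).comp (fun _ => T)).tree =
        T.tree.mapNode (G := fun p : Σ _ : Unit, ι => F p.2) (Sigma.mk ()) :=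
      (Tree.post_id _).trans (Tree.graft_leaf _)
    exact (congrArg (Tree.mapNode (G := F) (fun p : Σ _ : Unit, ι => p.2)) h).trans
      ((Tree.mapNode_mapNode (H := F) _ _ _).trans (Tree.mapNode_id _))
  comp_one {ι _ F f} T := by
    apply Config.ext
    exact (Tree.mapNode_subst (H := F) (fun p : Σ _ : ι, Unit => p.1) T.tree _).trans
      (Tree.subst_corolla T.tree)
  assoc {ι _ κ _ μ _ F f G H} T S R := by
    apply Config.ext
    refine (congrArg (Tree.mapNode (G := fun q : Σ i, Σ k, μ i k => H q.1 q.2.1 q.2.2)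
      (Equiv.sigmaAssoc μ)) (Tree.subst_subst T.tree _ _)).trans ?_
    refine (Tree.mapNode_subst (H := fun q : Σ i, Σ k, μ i k => H q.1 q.2.1 q.2.2)
      (Equiv.sigmaAssoc μ) T.tree _).trans ?_
    refine congrArg T.tree.subst (funext fun i => ?_)
    refine (congrArg (Tree.mapNode (G := fun q : Σ i, Σ k, μ i k => H q.1 q.2.1 q.2.2)
      (Equiv.sigmaAssoc μ)) (Tree.subst_mapNode _ _ _)).trans ?_
    refine (Tree.mapNode_subst (H := fun q : Σ i, Σ k, μ i k => H q.1 q.2.1 q.2.2)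
      (Equiv.sigmaAssoc μ) (S i).tree _).trans ?_
    refine Eq.trans ?_ (Tree.mapNode_subst (H := fun q : Σ i, Σ k, μ i k => H q.1 q.2.1 q.2.2)
      (Sigma.mk i) (S i).tree _).symm
    refine congrArg (S i).tree.subst (funext fun k => ?_)
    have h := Tree.mapNode_mapNode (H := fun q : Σ i, Σ k, μ i k => H q.1 q.2.1 q.2.2)
      (fun m : μ i k => (⟨k, m⟩ : Σ k, μ i k))
      (fun p : Σ k, μ i k => (⟨i, p⟩ : Σ i, Σ k, μ i k)) (R i k).tree
    exact (Tree.mapNode_mapNode (H := fun q : Σ i, Σ k, μ i k => H q.1 q.2.1 q.2.2) _ _ _).trans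
      h.symm
  push_refl T := Config.ext (Tree.mapNode_id _)
  push_push e e' _ _ T := Config.ext (Tree.mapNode_mapNode _ _ _)
  push_comp {ι κ _ _} e {μ _ F f G} T S := by
    apply Config.ext
    refine (Tree.subst_mapNode _ _ _).trans ?_
    refine Eq.trans ?_ (Tree.mapNode_subst (H := fun p : Σ k, μ k => G p.1 p.2)
      (Equiv.sigmaCongrLeft e) T.tree _).symm
    refine congrArg T.tree.subst (funext fun i => ?_)
    exact (Tree.mapNode_mapNode (H := fun p : Σ k, μ k => G p.1 p.2) (Sigma.mk i)
      (Equiv.sigmaCongrLeft e) (S (e i)).tree).symm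
  comp_push {ι _ κ μ _ _} e {F f G} T S := by
    apply Config.ext
    refine Eq.trans ?_ (Tree.mapNode_subst (H := fun p : Σ k, μ k => G p.1 p.2)
      (Equiv.sigmaCongrRight e) T.tree _).symm
    refine congrArg T.tree.subst (funext fun i => ?_)
    exact (Tree.mapNode_mapNode (H := fun p : Σ k, μ k => G p.1 p.2) _ _ _).trans
      (Tree.mapNode_mapNode (H := fun p : Σ k, μ k => G p.1 p.2) (Sigma.mk i)
        (Equiv.sigmaCongrRight e) (S i).tree).symm
  iota_comp a b := rfl

/-! The monad of a tidy symmetric multicategory. -/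

section tidy

variable (Q)

/-- The symmetric action on `a(Q)`: `f σ` has sources `x_{σ(1)}, …, x_{σ(k)}`. -/
def Arr.act {Q : SymMulticat} (f : Q.Arr) (σ : Equiv.Perm (Fin f.n)) : Q.Arr where
  n := f.n
  src := fun i => f.src (σ i)
  tgt := f.tgt
  hom := reindex σ.symm (fun i => congrArg f.src (σ.apply_symm_apply i)) f.hom

/-- `Q` is tidy: it is freely symmetric, and its object-category is equivalent to a discrete
category. -/
structure Tidy : Prop where
  free : ∀ (f : Q.Arr) (σ : Equiv.Perm (Fin f.n)), f.act σ = f → σ = 1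
  discrete : ∃ S : Type, Nonempty (Q.Obj ≌ Discrete S)

variable {Q}

theorem Tidy.subsingleton (h : Q.Tidy) (x y : Q.Obj) : Subsingleton (x ⟶ y) := by
  obtain ⟨S, ⟨e⟩⟩ := h.discrete
  exact ⟨fun a b => e.functor.map_injective (Subsingleton.elim _ _)⟩

theorem Tidy.isIso (h : Q.Tidy) {x y : Q.Obj} (a : x ⟶ y) : IsIso a := by
  obtain ⟨S, ⟨e⟩⟩ := h.discrete
  have : IsIso (e.functor.map a) := inferInstance
  exact isIso_of_reflects_iso a e.functor

end tidy

section zeta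

/-- The set of isomorphism classes of objects of `Q`. -/
def Cls (Q : SymMulticat) : Type := Quotient (isIsomorphicSetoid Q.Obj)

/-- The isomorphism class of an object. -/
def cls (x : Q.Obj) : Q.Cls := Quotient.mk (isIsomorphicSetoid Q.Obj) x

theorem cls_eq {x y : Q.Obj} (a : x ≅ y) : cls x = cls y := Quotient.sound ⟨a⟩

theorem cls_exact {x y : Q.Obj} (h : cls x = cls y) : Nonempty (x ≅ y) := Quotient.exact h

/-- An arrow of `Q` with compatible labels in `A` at its sources: an object of the pullback of
`elt(Q)` and of the category of lists of elements of `A`. -/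
structure Lab (A : Over Q.Cls) where
  /-- The arrow. -/
  arr : Q.Arr
  /-- The labels. -/
  lab : Fin arr.n → A.left
  compat : ∀ i, A.hom (lab i) = cls (arr.src i)

/-- Morphisms of labelled arrows are the morphisms of arrows that respect the labels. -/
instance (A : Over Q.Cls) : Category.{0} (Lab A) where
  Hom a b := {m : a.arr ⟶ b.arr // ∀ i, b.lab (EltHom.perm m i) = a.lab i}
  id a := ⟨𝟙 a.arr, fun _ => rfl⟩
  comp m m' := ⟨m.1 ≫ m'.1, fun i => (m'.2 _).trans (m.2 i)⟩
  id_comp m := Subtype.ext (Category.id_comp m.1)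
  comp_id m := Subtype.ext (Category.comp_id m.1)
  assoc m m' m'' := Subtype.ext (Category.assoc m.1 m'.1 m''.1)

/-- `T_Q` on objects: the isomorphism classes of labelled arrows, over the isomorphism classes of
their targets. -/
def TObj (A : Over Q.Cls) : Over Q.Cls :=
  Over.mk (TypeCat.ofHom (Quotient.lift (s := isIsomorphicSetoid (Lab A))
    (fun a => cls a.arr.tgt) (by
      rintro a b ⟨m⟩
      exact cls_eq ⟨EltHom.out m.hom.1, EltHom.out m.inv.1,
        congrArg (fun t => EltHom.out (Subtype.val t)) m.hom_inv_id,
        congrArg (fun t => EltHom.out (Subtype.val t)) m.inv_hom_id⟩)))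

/-- The class of a labelled arrow. -/
def Lab.toT {A : Over Q.Cls} (a : Lab A) : (TObj A).left :=
  Quotient.mk (isIsomorphicSetoid (Lab A)) a

theorem over_w {A B : Over Q.Cls} (h : A ⟶ B) (a : A.left) : B.hom (h.left a) = A.hom a :=
  ConcreteCategory.congr_hom (Over.w h) a

/-- Changing the labels. -/
def labFunctor {A B : Over Q.Cls} (h : A ⟶ B) : Lab A ⥤ Lab B where
  obj a := ⟨a.arr, fun i => h.left (a.lab i), fun i => (over_w h _).trans (a.compat i)⟩
  map m := ⟨m.1, fun i => congrArg h.left (m.2 i)⟩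

/-- `T_Q` as a functor. -/
def TFunctor (Q : SymMulticat) : Over Q.Cls ⥤ Over Q.Cls where
  obj A := TObj A
  map {A B} h := Over.homMk (TypeCat.ofHom (Quotient.map' (s₁ := isIsomorphicSetoid (Lab A))
    (s₂ := isIsomorphicSetoid (Lab B)) (labFunctor h).obj
    (fun _ _ ⟨m⟩ => ⟨(labFunctor h).mapIso m⟩))) (by
      ext t
      obtain ⟨a, rfl⟩ := Quotient.exists_rep t
      rfl)
  map_id A := by
    ext t
    obtain ⟨a, rfl⟩ := Quotient.exists_rep t
    rfl
  map_comp h h' := by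
    ext t
    obtain ⟨a, rfl⟩ := Quotient.exists_rep t
    rfl

/-! For a tidy `Q` the morphisms of `elt(Q)` are determined by their bijections of inputs, and are
invertible. -/

section

variable {ι κ μ : Type} [Finite ι] [Finite κ] [Finite μ] {x : ι → Q.Obj} {x' : κ → Q.Obj}
  {y y' y'' : Q.Obj}

theorem Tidy.act_congr (h : Q.Tidy) {p q : ι ≃ κ} (hpq : ∀ k, p k = q k)
    (i : ∀ k, x' (p k) ⟶ x k) (j : ∀ k, x' (q k) ⟶ x k) (o o' : y ⟶ y') (f : Q.Hom x y) :
    Q.push p (pre i (post o f)) = Q.push q (pre j (post o' f)) := by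
  obtain rfl : p = q := Equiv.ext hpq
  have := h.subsingleton
  obtain rfl : i = j := Subsingleton.elim _ _
  obtain rfl : o = o' := Subsingleton.elim _ _
  rfl

theorem Tidy.act_id (h : Q.Tidy) {p : ι ≃ ι} (hp : ∀ k, p k = k)
    (i : ∀ k, x (p k) ⟶ x k) (o : y ⟶ y) (f : Q.Hom x y) :
    Q.push p (pre i (post o f)) = f :=
  (h.act_congr (q := Equiv.refl ι) hp i (fun k => 𝟙 (x k)) o (𝟙 y) f).trans (EltHom.id f).eq

theorem Tidy.eltHom_ext (h : Q.Tidy) {f : Q.Hom x y} {f' : Q.Hom x' y'} {a b : EltHom f f'}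
    (hab : ∀ k, a.perm k = b.perm k) : a = b := by
  obtain ⟨p, i, o, e⟩ := a
  obtain ⟨q, j, o', e'⟩ := b
  obtain rfl : p = q := Equiv.ext hab
  have := h.subsingleton
  obtain rfl : i = j := Subsingleton.elim _ _
  obtain rfl : o = o' := Subsingleton.elim _ _
  rfl

/-- The inverse of a morphism of `elt(Q)`. -/
noncomputable def EltHom.inverse (h : Q.Tidy) {f : Q.Hom x y} {f' : Q.Hom x' y'}
    (a : EltHom f f') : EltHom f' f where
  perm := a.perm.symm
  inp k := have := h.isIso (a.inp (a.perm.symm k))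
    inv (a.inp (a.perm.symm k)) ≫ eqToHom (congrArg x' (a.perm.apply_symm_apply k))
  out := have := h.isIso a.out
    inv a.out
  eq := by
    obtain ⟨p, i, o, rfl⟩ := a
    refine (act_act p p.symm i _ o _ f).trans (h.act_id (fun k => p.symm_apply_apply k) _ _ f)

theorem reindex_eq (p : ι ≃ κ) (hp : ∀ k, x' (p k) = x k) (f : Q.Hom x y) :
    reindex p hp f = Q.push p (pre (fun k => eqToHom (hp k)) (post (𝟙 y) f)) := by
  obtain rfl : x = fun k => x' (p k) := (funext hp).symm
  rw [post_id]
  exact congrArg (Q.push p) (pre_id f).symm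

variable {A : Over Q.Cls}

/-- An arrow of `Q` with an arbitrary finite set of inputs, as an arrow with a list of sources. The
chosen enumeration of the inputs is irrelevant, as isomorphism classes are taken afterwards. -/
noncomputable def Arr.ofHom (f : Q.Hom x y) : Q.Arr where
  n := Nat.card ι
  src k := x ((Finite.equivFin ι).symm k)
  tgt := y
  hom := reindex (Finite.equivFin ι) (fun i => congrArg x ((Finite.equivFin ι).symm_apply_apply i)) f

/-- The canonical morphism to `Arr.ofHom f`. -/
noncomputable def Arr.toOfHom (f : Q.Hom x y) : EltHom f (Arr.ofHom f).hom where
  perm := Finite.equivFin ι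
  inp i := eqToHom (congrArg x ((Finite.equivFin ι).symm_apply_apply i))
  out := 𝟙 y
  eq := (reindex_eq _ _ f).symm

/-- The class of a labelled arrow with an arbitrary finite set of inputs. -/
noncomputable def mkT (f : Q.Hom x y) (l : ι → A.left) (hl : ∀ i, A.hom (l i) = cls (x i)) :
    (TObj A).left :=
  Lab.toT ⟨Arr.ofHom f, fun k => l ((Finite.equivFin ι).symm k), fun _ => hl _⟩

theorem Tidy.toT_eq (h : Q.Tidy) {a b : Lab A} (m : EltHom a.arr.hom b.arr.hom)
    (hm : ∀ i, b.lab (m.perm i) = a.lab i) : a.toT = b.toT := by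
  refine Quotient.sound ⟨⟨⟨m, hm⟩, ⟨m.inverse h, fun k => ?_⟩, ?_, ?_⟩⟩
  · have := hm (m.perm.symm k)
    rw [m.perm.apply_symm_apply] at this
    exact this.symm
  · exact Subtype.ext (h.eltHom_ext fun k => m.perm.symm_apply_apply k)
  · exact Subtype.ext (h.eltHom_ext fun k => m.perm.apply_symm_apply k)

theorem Tidy.mkT_eq (h : Q.Tidy) {f : Q.Hom x y} {f' : Q.Hom x' y'} {l : ι → A.left}
    {l' : κ → A.left} {hl : ∀ i, A.hom (l i) = cls (x i)} {hl' : ∀ i, A.hom (l' i) = cls (x' i)}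
    (m : EltHom f f') (hm : ∀ i, l' (m.perm i) = l i) : mkT f l hl = mkT f' l' hl' := by
  refine h.toT_eq (((Arr.toOfHom f).inverse h).comp (m.comp (Arr.toOfHom f'))) fun i => ?_
  refine (congrArg l' ((Finite.equivFin κ).symm_apply_apply _)).trans (hm _)

theorem Tidy.mkT_hom (h : Q.Tidy) (a : Lab A) : mkT a.arr.hom a.lab a.compat = a.toT :=
  (h.toT_eq (b := ⟨Arr.ofHom a.arr.hom, fun k => a.lab ((Finite.equivFin _).symm k),
    fun _ => a.compat _⟩) (Arr.toOfHom a.arr.hom) fun i =>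
    congrArg a.lab ((Finite.equivFin (Fin a.arr.n)).symm_apply_apply i)).symm

theorem Tidy.mkT_exact (h : Q.Tidy) {f : Q.Hom x y} {l : ι → A.left}
    {hl : ∀ i, A.hom (l i) = cls (x i)} {a : Lab A} (e : a.toT = mkT f l hl) :
    ∃ m : EltHom a.arr.hom f, ∀ i, l (m.perm i) = a.lab i := by
  obtain ⟨m⟩ := Quotient.exact e
  exact ⟨EltHom.comp m.hom.1 ((Arr.toOfHom f).inverse h), fun i => m.hom.2 i⟩

end

/-! The unit and the multiplication of `T_Q`. -/

/-- The unit of `T_Q`: the element `a` is sent to the class of an identity labelled by `a`. -/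
noncomputable def etaFun (A : Over Q.Cls) (a : A.left) : (TObj A).left :=
  mkT (Q.iota (𝟙 (Quotient.out (A.hom a) : Q.Obj))) (fun _ => a)
    (fun _ => (@Quotient.out_eq _ (isIsomorphicSetoid Q.Obj) (A.hom a)).symm)

section

variable {A : Over Q.Cls}

/-- A representative of the `i`-th label of an arrow labelled by classes of labelled arrows. -/
noncomputable def Lab.rep (b : Lab (TObj A)) (i : Fin b.arr.n) : Lab A := Quotient.out (b.lab i)

theorem Lab.rep_toT (b : Lab (TObj A)) (i : Fin b.arr.n) : (b.rep i).toT = b.lab i :=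
  Quotient.out_eq _

/-- The object-isomorphism used to compose an arrow with a label. -/
noncomputable def Lab.repIso (b : Lab (TObj A)) (i : Fin b.arr.n) :
    (b.rep i).arr.tgt ≅ b.arr.src i :=
  Classical.choice (cls_exact ((congrArg (TObj A).hom (b.rep_toT i)).trans (b.compat i)))

/-- The multiplication of `T_Q` on representatives: compose the arrow with its labels, via
object-isomorphisms, and concatenate the labels of the labels. -/
noncomputable def Lab.mu (b : Lab (TObj A)) : (TObj A).left :=
  mkT (Q.comp b.arr.hom (fun i => post (b.repIso i).hom (b.rep i).arr.hom))
    (fun p => (b.rep p.1).lab p.2) (fun p => (b.rep p.1).compat p.2)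

end

section

variable {ι κ : Type} [Finite ι] [Finite κ] {x : ι → Q.Obj} {x' : κ → Q.Obj} {y y' z : Q.Obj}

theorem comp_pre {μ : ι → Type} [∀ i, Finite (μ i)] {x' : ι → Q.Obj} {v : ∀ i, μ i → Q.Obj}
    (a : ∀ i, x' i ⟶ x i) (f : Q.Hom x y) (g : ∀ i, Q.Hom (v i) (x' i)) :
    Q.comp (pre a f) g = Q.comp f (fun i => post (a i) (g i)) := by
  unfold pre post
  rw [Q.push_comp, Q.comp_push (κ := fun i => Σ _ : Unit, μ i) (μ := μ) (fun _ => _) (z := v),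
    ← Q.assoc]
  erw [Q.push_push]
  rfl

theorem comp_pre_right {μ : ι → Type} [∀ i, Finite (μ i)] {v v' : ∀ i, μ i → Q.Obj}
    (a : ∀ i k, v' i k ⟶ v i k) (f : Q.Hom x y) (g : ∀ i, Q.Hom (v i) (x i)) :
    Q.comp f (fun i => pre (a i) (g i)) =
      pre (x := fun p : Σ i, μ i => v p.1 p.2) (fun p => a p.1 p.2) (Q.comp f g) := by
  unfold pre
  rw [Q.comp_push (κ := fun i => Σ _ : μ i, Unit) (μ := μ) (fun _ => _) (z := v'), ← Q.assoc]
  erw [Q.push_push]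
  rfl

/-- Composites of arrows that are pairwise related by morphisms of `elt(Q)` are related. -/
def Tidy.compHom (h : Q.Tidy) {μ : ι → Type} {ν : κ → Type} [∀ i, Finite (μ i)]
    [∀ k, Finite (ν k)] {v : ∀ i, μ i → Q.Obj} {v' : ∀ k, ν k → Q.Obj} {w : ι → Q.Obj}
    {w' : κ → Q.Obj} {f : Q.Hom x y} {f' : Q.Hom x' y'} {g : ∀ i, Q.Hom (v i) (w i)}
    {g' : ∀ k, Q.Hom (v' k) (w' k)} (m : EltHom f f') (n : ∀ i, EltHom (g i) (g' (m.perm i)))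
    (u : ∀ i, w i ⟶ x i) (u' : ∀ k, w' k ⟶ x' k) :
    EltHom (Q.comp f (fun i => post (u i) (g i))) (Q.comp f' (fun k => post (u' k) (g' k))) where
  perm := (Equiv.sigmaCongrRight fun i => (n i).perm).trans
    (Equiv.sigmaCongrLeft (β := ν) m.perm)
  inp p := (n p.1).inp p.2
  out := m.out
  eq := by
    obtain ⟨p, i, o, rfl⟩ := m
    have hs := h.subsingleton
    rw [Q.push_comp, comp_pre]
    have this : ∀ k, post (i k) (post (u' (p k)) (g' (p k))) =
        Q.push (n k).perm (pre (n k).inp (post (u k) (g k))) := by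
      intro k
      refine (congrArg (fun t => post (i k) (post (u' (p k)) t)) (n k).eq.symm).trans ?_
      rw [post_push, post_push, ← pre_post, ← pre_post, post_post, post_post]
      congr 3
      exact Subsingleton.elim _ _
    simp only [this]
    rw [Q.comp_push (fun k => (n k).perm), comp_pre_right, comp_post]
    refine Eq.trans ?_ (Q.push_push _ _ _).symm
    rfl


theorem post_iota {a b c : Q.Obj} (f : a ⟶ b) (g : b ⟶ c) :
    post g (Q.iota f) = Q.iota (f ≫ g) := Q.iota_comp f g

theorem pre_iota {a b c : Q.Obj} (f : a ⟶ b) (g : b ⟶ c) :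
    pre (fun _ => f) (Q.iota g) = Q.iota (f ≫ g) := Q.iota_comp f g

/-- Identities of isomorphic objects are isomorphic. -/
def Tidy.iotaHom (h : Q.Tidy) {a b : Q.Obj} (i : a ≅ b) :
    EltHom (Q.iota (𝟙 a)) (Q.iota (𝟙 b)) where
  perm := Equiv.refl Unit
  inp _ := i.inv
  out := i.hom
  eq := by
    have := h.subsingleton b b
    rw [post_iota]
    refine (Q.push_refl _).trans ((pre_iota _ _).trans ?_)
    exact congrArg Q.iota (Subsingleton.elim _ _)

variable {A B : Over Q.Cls}

theorem Tidy.eta_eq (h : Q.Tidy) (a : A.left) {x : Q.Obj} (hx : A.hom a = cls x) :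
    etaFun A a = mkT (Q.iota (𝟙 x)) (fun _ => a) (fun _ => hx) :=
  have e : Nonempty ((Quotient.out (A.hom a) : Q.Obj) ≅ x) := cls_exact
    ((@Quotient.out_eq _ (isIsomorphicSetoid Q.Obj) (A.hom a)).trans hx)
  h.mkT_eq (h.iotaHom e.some) (fun _ => rfl)

theorem Tidy.mu_eq (h : Q.Tidy) {ν : κ → Type} [∀ k, Finite (ν k)] {v : ∀ k, ν k → Q.Obj}
    {w : κ → Q.Obj} {f : Q.Hom x' y} {g : ∀ k, Q.Hom (v k) (w k)} {l : ∀ k, ν k → A.left}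
    {hl : ∀ k j, A.hom (l k j) = cls (v k j)} (b : Lab (TObj A)) (m : EltHom b.arr.hom f)
    (hm : ∀ i, b.lab i = mkT (g (m.perm i)) (l (m.perm i)) (hl (m.perm i)))
    (u : ∀ k, w k ⟶ x' k) :
    b.mu = mkT (Q.comp f (fun k => post (u k) (g k))) (fun p => l p.1 p.2)
      (fun p => hl p.1 p.2) := by
  choose n hn using fun i => h.mkT_exact ((b.rep_toT i).trans (hm i))
  exact h.mkT_eq (h.compHom m n (fun i => (b.repIso i).hom) u) fun p => hn p.1 p.2

theorem Tidy.mu_congr (h : Q.Tidy) {a b : Lab (TObj A)} (m : a ≅ b) : a.mu = b.mu := by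
  refine h.mu_eq (g := fun k => (b.rep k).arr.hom) (l := fun k => (b.rep k).lab)
    (hl := fun k => (b.rep k).compat) a m.hom.1 (fun i => ?_) (fun k => (b.repIso k).hom)
  refine (m.hom.2 i).symm.trans ?_
  exact (b.rep_toT _).symm.trans (h.mkT_hom _).symm

/-- The multiplication of `T_Q`. -/
noncomputable def Tidy.muHom (h : Q.Tidy) (A : Over Q.Cls) : TObj (TObj A) ⟶ TObj A :=
  Over.homMk (TypeCat.ofHom (Quotient.lift (s := isIsomorphicSetoid (Lab (TObj A)))
    Lab.mu (fun _ _ ⟨m⟩ => h.mu_congr m))) (by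
      ext t
      obtain ⟨b, rfl⟩ := Quotient.exists_rep t
      rfl)

/-- The unit of `T_Q`. -/
noncomputable def etaHom (A : Over Q.Cls) : A ⟶ TObj A :=
  Over.homMk (TypeCat.ofHom (etaFun A)) (by
    ext a
    exact @Quotient.out_eq _ (isIsomorphicSetoid Q.Obj) (A.hom a))

theorem Tidy.mu_mkT (h : Q.Tidy) {ν : κ → Type} [∀ k, Finite (ν k)] {v : ∀ k, ν k → Q.Obj}
    {w : κ → Q.Obj} (f : Q.Hom x' y) (g : ∀ k, Q.Hom (v k) (w k)) (l : ∀ k, ν k → A.left)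
    (hl : ∀ k j, A.hom (l k j) = cls (v k j)) (u : ∀ k, w k ⟶ x' k)
    (hl' : ∀ k, (TObj A).hom (mkT (g k) (l k) (hl k)) = cls (x' k)) :
    (h.muHom A).left (mkT f (fun k => mkT (g k) (l k) (hl k)) hl') =
      mkT (Q.comp f (fun k => post (u k) (g k))) (fun p => l p.1 p.2) (fun p => hl p.1 p.2) :=
  h.mu_eq (hl := hl) ⟨Arr.ofHom f, fun k => mkT (g ((Finite.equivFin κ).symm k)) (l _) (hl _),
    fun _ => hl' _⟩ ((Arr.toOfHom f).inverse h) (fun _ => rfl) u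

theorem exists_mkT (h : Q.Tidy) (t : (TObj A).left) :
    ∃ (a : Lab A), t = mkT a.arr.hom a.lab a.compat := by
  obtain ⟨a, rfl⟩ := Quotient.exists_rep t
  exact ⟨a, (h.mkT_hom a).symm⟩

theorem mkT_congr {f : Q.Hom x y} {l l' : ι → A.left} {hl : ∀ i, A.hom (l i) = cls (x i)}
    {hl' : ∀ i, A.hom (l' i) = cls (x i)} (e : ∀ i, l i = l' i) : mkT f l hl = mkT f l' hl' := by
  obtain rfl := funext e
  rfl

theorem map_mkT (k : A ⟶ B) (f : Q.Hom x y) (l : ι → A.left)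
    (hl : ∀ i, A.hom (l i) = cls (x i)) : ((TFunctor Q).map k).left (mkT f l hl) =
      mkT f (fun i => k.left (l i)) (fun i => (over_w k _).trans (hl i)) := rfl

theorem Tidy.unit_left (h : Q.Tidy) (t : (TObj A).left) :
    (h.muHom A).left ((etaHom (TObj A)).left t) = t := by
  obtain ⟨a, rfl⟩ := exists_mkT h t
  refine (congrArg (h.muHom A).left (h.eta_eq (A := TObj A) _ (x := a.arr.tgt) rfl)).trans ?_
  refine (h.mu_mkT (Q.iota (𝟙 a.arr.tgt)) (fun _ => a.arr.hom) (fun _ => a.lab)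
    (fun _ => a.compat) (fun _ => 𝟙 _) _).trans ?_
  refine h.mkT_eq ⟨⟨fun p => p.2, fun i => ⟨(), i⟩, fun _ => rfl, fun _ => rfl⟩,
    fun _ => 𝟙 _, 𝟙 _, ?_⟩ (fun _ => rfl)
  refine (congrArg (Q.push _) ((pre_id _).trans (post_id _))).trans ?_
  simp only [post_id]
  exact Q.one_comp _

theorem Tidy.unit_right (h : Q.Tidy) (t : (TObj A).left) :
    (h.muHom A).left (((TFunctor Q).map (etaHom A)).left t) = t := by
  obtain ⟨a, rfl⟩ := exists_mkT h t
  have e : ((TFunctor Q).map (etaHom A)).left (mkT a.arr.hom a.lab a.compat) =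
      mkT (A := TObj A) a.arr.hom (fun i => mkT (Q.iota (𝟙 (a.arr.src i))) (fun _ => a.lab i)
        (fun _ => a.compat i)) (fun _ => rfl) :=
    (map_mkT _ _ _ _).trans (mkT_congr fun i => h.eta_eq _ (a.compat i))
  refine (congrArg (h.muHom A).left e).trans ((h.mu_mkT _ _ _ _ (fun _ => 𝟙 _) _).trans ?_)
  refine h.mkT_eq ⟨⟨fun p => p.1, fun i => ⟨i, ()⟩, fun _ => rfl, fun _ => rfl⟩,
    fun _ => 𝟙 _, 𝟙 _, ?_⟩ (fun _ => rfl)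
  refine (congrArg (Q.push _) ((pre_id _).trans (post_id _))).trans ?_
  simp only [post_id]
  exact Q.comp_one _

/-- Associativity, as a morphism of `elt(Q)`. -/
def assocHom {ν : ι → Type} [∀ i, Finite (ν i)] {ρ : ∀ i, ν i → Type} [∀ i k, Finite (ρ i k)]
    {v w' : ∀ i, ν i → Q.Obj} {r : ∀ i k, ρ i k → Q.Obj} {w : ι → Q.Obj} (f : Q.Hom x y)
    (g : ∀ i, Q.Hom (v i) (w i)) (u : ∀ i, w i ⟶ x i) (k : ∀ i j, Q.Hom (r i j) (w' i j))
    (u' : ∀ i j, w' i j ⟶ v i j) :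
    EltHom (Q.comp (Q.comp f (fun i => post (u i) (g i))) (fun p => post (u' p.1 p.2) (k p.1 p.2)))
      (Q.comp f (fun i => post (u i) (Q.comp (g i) (fun j => post (u' i j) (k i j))))) where
  perm := Equiv.sigmaAssoc ρ
  inp _ := 𝟙 _
  out := 𝟙 _
  eq := by
    refine (congrArg (Q.push _) ((pre_id _).trans (post_id _))).trans ?_
    simp only [← comp_post]
    exact Q.assoc f (fun i => post (u i) (g i)) (fun i j => post (u' i j) (k i j))

theorem Tidy.mu_assoc_aux (h : Q.Tidy) {ν : ι → Type} [∀ i, Finite (ν i)] {ρ : ∀ i, ν i → Type}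
    [∀ i k, Finite (ρ i k)]
    {v w' : ∀ i, ν i → Q.Obj} {r : ∀ i k, ρ i k → Q.Obj} {w : ι → Q.Obj} (f : Q.Hom x y)
    (g : ∀ i, Q.Hom (v i) (w i)) (u : ∀ i, w i ⟶ x i) (k : ∀ i j, Q.Hom (r i j) (w' i j))
    (u' : ∀ i j, w' i j ⟶ v i j) (l : ∀ i j, ρ i j → A.left)
    (hl : ∀ i j m, A.hom (l i j m) = cls (r i j m))
    (h₁ : ∀ i j, (TObj A).hom (mkT (k i j) (l i j) (hl i j)) = cls (v i j))
    (h₂ : ∀ i, (TObj (TObj A)).hom (mkT (g i) (fun j => mkT (k i j) (l i j) (hl i j)) (h₁ i)) =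
      cls (x i)) :
    (h.muHom A).left (((TFunctor Q).map (h.muHom A)).left (mkT f (fun i => mkT (g i)
      (fun j => mkT (k i j) (l i j) (hl i j)) (h₁ i)) h₂)) =
    (h.muHom A).left ((h.muHom (TObj A)).left (mkT f (fun i => mkT (g i)
      (fun j => mkT (k i j) (l i j) (hl i j)) (h₁ i)) h₂)) := by
  have e₁ : ∀ i, (h.muHom A).left (mkT (g i) (fun j => mkT (k i j) (l i j) (hl i j)) (h₁ i)) =
      mkT (Q.comp (g i) (fun j => post (u' i j) (k i j)))
        (fun p => l i p.1 p.2) (fun p => hl i p.1 p.2) := fun i => h.mu_mkT _ _ _ _ (u' i) _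
  have h₃ : ∀ i, (TObj A).hom (mkT (Q.comp (g i) (fun j => post (u' i j) (k i j)))
      (fun p => l i p.1 p.2) (fun p => hl i p.1 p.2)) = cls (x i) := h₂
  have e₂ : ((TFunctor Q).map (h.muHom A)).left (mkT f (fun i => mkT (g i)
      (fun j => mkT (k i j) (l i j) (hl i j)) (h₁ i)) h₂) =
      mkT f (fun i => mkT (Q.comp (g i) (fun j => post (u' i j) (k i j)))
        (fun p => l i p.1 p.2) (fun p => hl i p.1 p.2)) h₃ :=
    (map_mkT _ _ _ _).trans (mkT_congr e₁)
  refine (congrArg (h.muHom A).left e₂).trans ((h.mu_mkT f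
    (fun i => Q.comp (g i) (fun j => post (u' i j) (k i j))) (fun i p => l i p.1 p.2)
    (fun i p => hl i p.1 p.2) u h₃).trans ?_)
  refine Eq.symm ((congrArg (h.muHom A).left (h.mu_mkT f g
    (fun i j => mkT (k i j) (l i j) (hl i j)) h₁ u h₂)).trans ?_)
  refine (h.mu_mkT (Q.comp f fun i => post (u i) (g i)) (fun p => k p.1 p.2)
    (fun p m => l p.1 p.2 m) (fun p m => hl p.1 p.2 m) (fun p => u' p.1 p.2)
    (fun p => h₁ p.1 p.2)).trans ?_
  exact h.mkT_eq (assocHom f g u k u') (fun _ => rfl)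

theorem Tidy.mu_assoc (h : Q.Tidy) (t : (TObj (TObj (TObj A))).left) :
    (h.muHom A).left (((TFunctor Q).map (h.muHom A)).left t) =
      (h.muHom A).left ((h.muHom (TObj A)).left t) := by
  obtain ⟨a, rfl⟩ := exists_mkT h t
  obtain ⟨⟨n, x, y, f⟩, l, hl⟩ := a
  choose b hb using fun i => exists_mkT h (l i)
  obtain rfl := funext hb
  choose c hc using fun i k => exists_mkT h ((b i).lab k)
  have u : ∀ i, (b i).arr.tgt ⟶ x i := fun i => (cls_exact (hl i)).some.hom
  have u' : ∀ i k, (c i k).arr.tgt ⟶ (b i).arr.src k := fun i k =>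
    (cls_exact ((congrArg (TObj A).hom (hc i k)).symm.trans ((b i).compat k))).some.hom
  have e : mkT (A := TObj (TObj A)) f
      (fun i => mkT (A := TObj A) (b i).arr.hom (b i).lab (b i).compat) hl =
    mkT f (fun i => mkT (b i).arr.hom (fun k => mkT (c i k).arr.hom (c i k).lab (c i k).compat)
      (fun k => (congrArg (TObj A).hom (hc i k)).symm.trans ((b i).compat k))) hl :=
    mkT_congr fun i => mkT_congr fun k => hc i k
  have := h.mu_assoc_aux f (fun i => (b i).arr.hom) u (fun i k => (c i k).arr.hom) u'
    (fun i k => (c i k).lab) (fun i k => (c i k).compat)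
    (fun i k => (congrArg (TObj A).hom (hc i k)).symm.trans ((b i).compat k)) hl
  rw [← e] at this
  exact this

theorem Tidy.eta_nat (h : Q.Tidy) (k : A ⟶ B) (a : A.left) :
    (etaHom B).left (k.left a) = ((TFunctor Q).map k).left ((etaHom A).left a) :=
  h.eta_eq _ ((over_w k a).trans (@Quotient.out_eq _ (isIsomorphicSetoid Q.Obj) (A.hom a)).symm)

theorem Tidy.mu_nat (h : Q.Tidy) (k : A ⟶ B) (t : (TObj (TObj A)).left) :
    (h.muHom B).left (((TFunctor Q).map ((TFunctor Q).map k)).left t) =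
      ((TFunctor Q).map k).left ((h.muHom A).left t) := by
  obtain ⟨a, rfl⟩ := exists_mkT h t
  obtain ⟨⟨n, x, y, f⟩, l, hl⟩ := a
  choose b hb using fun i => exists_mkT h (l i)
  obtain rfl := funext hb
  have u : ∀ i, (b i).arr.tgt ⟶ x i := fun i => (cls_exact (hl i)).some.hom
  refine Eq.trans ?_ (congrArg ((TFunctor Q).map k).left (h.mu_mkT f (fun i => (b i).arr.hom)
    (fun i => (b i).lab) (fun i => (b i).compat) u hl).symm)
  exact h.mu_mkT f (fun i => (b i).arr.hom) (fun i j => k.left ((b i).lab j))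
    (fun i j => (over_w k _).trans ((b i).compat j)) u hl

/-- The monad `T_Q` on `Set / S_Q` of a tidy symmetric multicategory `Q`. -/
noncomputable def zetaMonad (Q : SymMulticat) (h : Q.Tidy) : Monad (Over Q.Cls) where
  toFunctor := TFunctor Q
  η :=
    { app := etaHom
      naturality := fun _ _ k => by
        ext a
        exact h.eta_nat k a }
  μ :=
    { app := h.muHom
      naturality := fun _ _ k => by
        ext t
        exact h.mu_nat k t }
  assoc A := by
    ext t
    exact h.mu_assoc t
  left_unit A := by
    ext t
    exact h.unit_left t
  right_unit A := by
    ext t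
    exact h.unit_right t

end

end zeta

/-! Opetopes. -/

/-- The symmetric multicategory `I` with one object, one object-morphism and one arrow, the
identity: `I(x₁, …, xₖ; y)` has one element if `k = 1` and is empty otherwise. -/
def trivial : SymMulticat where
  Obj := Discrete Unit
  Hom {ι} _ _ _ := PLift (Nat.card ι = 1)
  iota _ := ⟨Nat.card_unique⟩
  comp {ι _ κ _ _ _ _} f g := ⟨by
    cases nonempty_fintype ι
    rw [Nat.card_sigma, Finset.sum_congr rfl fun i _ => (g i).down, Finset.sum_const,
      Finset.card_univ, ← Nat.card_eq_fintype_card, f.down]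
    rfl⟩
  push e _ _ f := ⟨(Nat.card_congr e).symm.trans f.down⟩
  one_comp := by intros; rfl
  comp_one := by intros; rfl
  assoc := by intros; rfl
  push_refl := by intros; rfl
  push_push := by intros; rfl
  push_comp := by intros; rfl
  comp_push := by intros; rfl
  iota_comp := by intros; rfl

/-- The iterated slice `Q^{k+}`. -/
def iterSlice (Q : SymMulticat) : ℕ → SymMulticat
  | 0 => Q
  | k + 1 => (Q.iterSlice k).slice

end SymMulticat

/-! Cartesian monads. -/

/-- A category with finite limits together with a monad on it. -/
structure MonadPair where
  /-- The category. -/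
  C : Type 1
  [cat : Category.{0} C]
  [lim : HasFiniteLimits C]
  /-- The monad. -/
  T : Monad C

attribute [instance] MonadPair.cat MonadPair.lim

/-- The monad is cartesian: its functor part preserves pullbacks, and the naturality squares of its
unit and of its multiplication are pullbacks. -/
structure MonadPair.IsCartesian (M : MonadPair) : Prop where
  preserves : PreservesLimitsOfShape WalkingCospan M.T.toFunctor
  unit : NatTrans.Equifibered M.T.η
  mult : NatTrans.Equifibered M.T.μ

/-- A cartesian monad `(ℰ, T)`. -/
structure CartMonad extends MonadPair where
  isCartesian : toMonadPair.IsCartesian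

/-- A cartesian monad opfunctor `(U, φ) : (ℰ₁, T₁) ⟶ (ℰ₂, T₂)`. -/
@[ext]
structure CartOpfunctor (M N : MonadPair) where
  /-- The functor `U`. -/
  U : M.C ⥤ N.C
  /-- The natural transformation `φ : U T₁ ⟶ T₂ U`. -/
  φ : M.T.toFunctor ⋙ U ⟶ U ⋙ N.T.toFunctor
  preserves : PreservesLimitsOfShape WalkingCospan U
  cart : NatTrans.Equifibered φ
  unit : ∀ X, U.map (M.T.η.app X) ≫ φ.app X = N.T.η.app (U.obj X)
  mult : ∀ X, U.map (M.T.μ.app X) ≫ φ.app X =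
    φ.app (M.T.obj X) ≫ N.T.map (φ.app X) ≫ N.T.μ.app (U.obj X)

/-- The category of cartesian monads and cartesian monad opfunctors. -/
instance cartMonadCategory : Category.{1} CartMonad where
  Hom M N := CartOpfunctor M.toMonadPair N.toMonadPair
  id M :=
    { U := 𝟭 _
      φ := 𝟙 M.T.toFunctor
      preserves := inferInstance
      cart := MorphismProperty.id_mem _ _
      unit := fun X => by simp
      mult := fun X => by simp }
  comp {M N P} F G :=
    { U := F.U ⋙ G.U
      φ := Functor.whiskerRight F.φ G.U ≫ Functor.whiskerLeft F.U G.φ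
      preserves := by
        have := F.preserves
        have := G.preserves
        infer_instance
      cart := by
        have := G.preserves
        exact (F.cart.whiskerRight G.U).comp (G.cart.whiskerLeft F.U)
      unit := fun X => by
        have h := congrArg (fun t => G.U.map t ≫ G.φ.app (F.U.obj X)) (F.unit X)
        simp only [Functor.map_comp, Category.assoc] at h
        exact h.trans (G.unit (F.U.obj X))
      mult := fun X => by
        have h := congrArg (fun t => G.U.map t ≫ G.φ.app (F.U.obj X)) (F.mult X)
        simp only [Functor.map_comp, Category.assoc] at h
        have h₁ := G.φ.naturality (F.φ.app X)
        have h₂ := G.mult (F.U.obj X)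
        have h₃ : G.U.map (N.T.map (F.φ.app X)) ≫ G.φ.app (N.T.obj (F.U.obj X)) =
          G.φ.app (F.U.obj (M.T.obj X)) ≫ P.T.map (G.U.map (F.φ.app X)) := h₁
        refine h.trans ?_
        refine (congrArg (fun t => G.U.map (F.φ.app (M.T.obj X)) ≫
          G.U.map (N.T.map (F.φ.app X)) ≫ t) h₂).trans ?_
        change _ = (G.U.map (F.φ.app (M.T.obj X)) ≫ G.φ.app (F.U.obj (M.T.obj X))) ≫
          P.T.map (G.U.map (F.φ.app X) ≫ G.φ.app (F.U.obj X)) ≫ _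
        rw [Functor.map_comp]
        simp only [Category.assoc]
        congr 1
        rw [← Category.assoc, h₃]
        simp only [Category.assoc]
        rfl }
  id_comp F := by
    apply CartOpfunctor.ext
    · rfl
    · apply heq_of_eq; ext X; simp
  comp_id F := by
    apply CartOpfunctor.ext
    · rfl
    · apply heq_of_eq; ext X; simp
  assoc F G H := by
    apply CartOpfunctor.ext
    · rfl
    · apply heq_of_eq; ext X; simp

/-! The free-operad monad. -/

section operads

variable {C : Type 1} [Category.{0} C] [HasFiniteLimits C] (T : Monad C)

/-- The composite `A ∘ B` of graphs `T1 ⟵ A ⟶ 1` and `T1 ⟵ B ⟶ 1`, seen as objects of `ℰ/T1`: the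
pullback of `A ⟶ T1` and `T! : T B ⟶ T1`. -/
noncomputable abbrev compObj (A B : Over (T.obj (⊤_ C))) : C :=
  pullback A.hom (T.map (terminal.from B.left))

/-- The map `A ∘ B ⟶ T1` of the composite graph. -/
noncomputable abbrev compDom (A B : Over (T.obj (⊤_ C))) : compObj T A B ⟶ T.obj (⊤_ C) :=
  pullback.snd A.hom (T.map (terminal.from B.left)) ≫ T.map B.hom ≫ T.μ.app (⊤_ C)

/-- The map into `A ∘ B` with components `a` and `b`. -/
noncomputable def compLift {T : Monad C} {A B : Over (T.obj (⊤_ C))} {X : C} (a : X ⟶ A.left)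
    (b : X ⟶ T.obj B.left) (h : a ≫ A.hom = b ≫ T.map (terminal.from B.left)) :
    X ⟶ compObj T A B := pullback.lift a b h

section

variable {T : Monad C} {A B A' B' : Over (T.obj (⊤_ C))} {X : C} (a : X ⟶ A.left)
  (b : X ⟶ T.obj B.left) (h : a ≫ A.hom = b ≫ T.map (terminal.from B.left))

theorem compLift_fst :
    compLift a b h ≫ pullback.fst A.hom (T.map (terminal.from B.left)) = a :=
  pullback.lift_fst a b h

theorem compLift_snd :
    compLift a b h ≫ pullback.snd A.hom (T.map (terminal.from B.left)) = b :=
  pullback.lift_snd a b h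

theorem compLift_comp (u : A.left ⟶ A'.left) (v : T.obj B.left ⟶ T.obj B'.left)
    (h' : (pullback.fst A.hom (T.map (terminal.from B.left)) ≫ u) ≫ A'.hom =
      (pullback.snd A.hom (T.map (terminal.from B.left)) ≫ v) ≫ T.map (terminal.from B'.left))
    (h'' : (a ≫ u) ≫ A'.hom = (b ≫ v) ≫ T.map (terminal.from B'.left)) :
    compLift a b h ≫ compLift (pullback.fst A.hom (T.map (terminal.from B.left)) ≫ u)
      (pullback.snd A.hom (T.map (terminal.from B.left)) ≫ v) h' =
    compLift (a ≫ u) (b ≫ v) h'' := by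
  refine pullback.hom_ext (Eq.trans ?_ (compLift_fst _ _ _).symm)
    (Eq.trans ?_ (compLift_snd _ _ _).symm)
  · rw [Category.assoc, compLift_fst, ← Category.assoc, compLift_fst]
  · rw [Category.assoc, compLift_snd, ← Category.assoc, compLift_snd]

end

/-- An `(ℰ, T)`-operad, that is, an `(ℰ, T)`-multicategory whose object of objects is terminal: a
monoid for the composition of graphs `T1 ⟵ A ⟶ 1`. -/
structure Operad where
  /-- The underlying graph. -/
  A : Over (T.obj (⊤_ C))
  /-- The identities. -/
  ids : ⊤_ C ⟶ A.left
  /-- The composition. -/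
  comp : compObj T A A ⟶ A.left
  ids_dom : ids ≫ A.hom = T.η.app (⊤_ C)
  comp_dom : comp ≫ A.hom = compDom T A A
  id_left : compLift (B := A) (terminal.from A.left ≫ ids) (T.η.app A.left)
    (by simp [ids_dom, T.unit_naturality]) ≫ comp = 𝟙 A.left
  id_right : compLift (B := A) (𝟙 A.left) (A.hom ≫ T.map ids) (by
    rw [Category.assoc, ← Functor.map_comp, terminal.hom_ext (ids ≫ terminal.from A.left) (𝟙 _)]
    simp) ≫ comp = 𝟙 A.left
  assoc :
    compLift (B := A) (pullback.fst A.hom (T.map (terminal.from (compObj T A A))))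
      (pullback.snd A.hom (T.map (terminal.from (compObj T A A))) ≫ T.map comp) (by
        rw [Category.assoc, ← Functor.map_comp, terminal.comp_from]
        exact pullback.condition) ≫ comp =
    compLift (B := A)
      (compLift (B := A) (pullback.fst A.hom (T.map (terminal.from (compObj T A A))))
        (pullback.snd A.hom (T.map (terminal.from (compObj T A A))) ≫
          T.map (pullback.fst A.hom (T.map (terminal.from A.left)))) (by
        rw [Category.assoc, ← Functor.map_comp, terminal.comp_from]
        exact pullback.condition) ≫ comp)
      (pullback.snd A.hom (T.map (terminal.from (compObj T A A))) ≫
        T.map (pullback.snd A.hom (T.map (terminal.from A.left))) ≫ T.μ.app A.left) (by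
        rw [Category.assoc, comp_dom]
        have h := T.μ.naturality (terminal.from A.left)
        dsimp at h
        rw [← Category.assoc, compLift_snd, Category.assoc, ← Functor.map_comp_assoc,
          pullback.condition]
        simp only [Functor.map_comp, Category.assoc, h]) ≫ comp

variable {T}

/-- A morphism of operads: a map of graphs that respects identities and composition. -/
@[ext]
structure OperadHom (P R : Operad T) where
  /-- The map of graphs. -/
  map : P.A ⟶ R.A
  ids : P.ids ≫ map.left = R.ids
  comp : P.comp ≫ map.left = compLift (B := R.A) (pullback.fst _ _ ≫ map.left)
    (pullback.snd _ _ ≫ T.map map.left) (by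
      rw [Category.assoc, Category.assoc, Over.w, ← Functor.map_comp, terminal.comp_from]
      exact pullback.condition) ≫ R.comp

noncomputable instance operadCategory : Category.{0} (Operad T) where
  Hom P R := OperadHom P R
  id P := ⟨𝟙 P.A, by simp, by
    have h : ∀ p, compLift (T := T) (A := P.A) (B := P.A) (pullback.fst _ _ ≫ 𝟙 _)
        (pullback.snd _ _ ≫ T.map (𝟙 _)) p = 𝟙 _ := fun p => by
      refine pullback.hom_ext (Eq.trans (compLift_fst _ _ _) ?_)
        (Eq.trans (compLift_snd _ _ _) ?_)
      · simp
      · simp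
    exact (Category.comp_id _).trans ((congrArg (fun t => t ≫ P.comp) (h _)).trans
      (Category.id_comp _)).symm⟩
  comp F G := ⟨F.map ≫ G.map, by
    rw [Over.comp_left, ← Category.assoc, F.ids, G.ids], by
    refine (Category.assoc _ _ _).symm.trans ?_
    refine (congrArg (fun t => t ≫ G.map.left) F.comp).trans ?_
    rw [Category.assoc, G.comp, ← Category.assoc]
    congr 1
    rw [compLift_comp _ _ _ _ _ _ (by
      simp only [Category.assoc, Over.w, ← Functor.map_comp, terminal.comp_from]
      exact pullback.condition)]
    congr 1
    · exact Category.assoc _ _ _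
    · rw [Category.assoc, ← Functor.map_comp]
      rfl⟩
  id_comp F := OperadHom.ext (Category.id_comp _)
  comp_id F := OperadHom.ext (Category.comp_id _)
  assoc F G H := OperadHom.ext (Category.assoc _ _ _)

variable (T)

/-- The underlying-graph functor from operads to `ℰ/T1`. -/
noncomputable def operadForget : Operad T ⥤ Over (T.obj (⊤_ C)) where
  obj P := P.A
  map F := OperadHom.map F

end operads

/-- Free `(ℰ, T)`-operads exist: the underlying-graph functor has a left adjoint. -/
def MonadPair.HasFreeOperads (M : MonadPair) : Prop := (operadForget M.T).IsRightAdjoint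

open Classical in
/-- The monad `(ℰ, T)'` on `ℰ/T1` induced by the adjunction between graphs and operads. (The
identity monad is a placeholder, for the case in which free operads do not exist.) -/
noncomputable def MonadPair.prime (M : MonadPair) : MonadPair where
  C := Over (M.T.obj (⊤_ M.C))
  T := if h : M.HasFreeOperads then
    have : (operadForget M.T).IsRightAdjoint := h
    (Adjunction.ofIsRightAdjoint (operadForget M.T)).toMonad
  else Monad.id _

/-- The iterates `(ℰ, T)^{k'}`. -/
noncomputable def MonadPair.iterPrime (M : MonadPair) : ℕ → MonadPair
  | 0 => M
  | k + 1 => (M.iterPrime k).prime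

/-- The identity monad on the category of sets. -/
def setMonad : MonadPair where
  C := Type
  T := Monad.id Type

/-- The pair `ζ(Q) = (Set / S_Q, T_Q)`, for a tidy symmetric multicategory `Q`. -/
noncomputable def SymMulticat.zeta (Q : SymMulticat) (h : Q.Tidy) : MonadPair where
  C := Over Q.Cls
  T := Q.zetaMonad h

/-! The core is an induction on `k`. Its step says that if `Q` is tidy and `M` is isomorphic to
`ζ(Q)`, then `M` admits free operads and `M.prime` is isomorphic to `ζ(Q⁺)`. Isomorphisms are kept
strict (`IsoData`: bijective on objects and fully faithful), because an isomorphism in the category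
of cartesian monads needs a functor that is invertible on the nose.

Tidiness is rigidity. Hom-sets between objects of `Q` have at most one element, and an automorphism
of an arrow fixes its inputs (`Tidy.perm_self`), so `elt(Q)` is a thin groupoid. This gives half of
the tidiness of `Q⁺`; the other half holds because the planar order of the nodes of a tree detects
every permutation of the node labels (`Tidy.slice`). Rigidity also makes `T_Q` cartesian: over a
fixed arrow, an element of `T_Q A` is just a function from the inputs to `A` (`Tidy.mkT_inj`), and
pullbacks can be checked label by label.

For the step, elements of `T1` are isomorphism classes of arrows of `Q`, that is, of objects of
`Q⁺`. Hence graphs are sets over `S_{Q⁺}` (`isIso_sliceU`), and an operad is a set of elements with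
a composition indexed by arrows of `Q` (`OperadData`). The free operad on `A` consists of planar
trees with nodes labelled in `A` and leaves in `S_Q`; edge labels can be forgotten because they are
unique when they exist (`Tree.sk_injective`). The degree of a tree is its value in `Q`. To compose
at an arrow `f`, a tree of degree `f` is represented with the inputs of `f` as its leaves, in a
unique way (`Tree.exists_lift`, `Tree.lift_unique`), and the other trees are grafted onto it.
Evaluation of trees in an arbitrary operad (`ev`) gives the universal property (`frEquiv`).

An element of `T_{Q⁺} A` is a class of configurations whose nodes carry labels in `A`; writing these
labels at the nodes yields an element of the free operad. This is a bijection (`nf_injective`,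
`nf_surjective`), since a tree is recovered from its version labelled by its own nodes and leaves.
It respects the monad structures because composition in `Q⁺` is substitution of trees, which
evaluation turns into iterated evaluation (`ev_config_comp`).

The induction starts with `I`, for which the unit of the monad is invertible. The sets `S_k` come
from transporting the monads along bijections with the classes of objects of `I^{k+}`, chosen so
that `S_{k+1}` is literally the set `T_k(id)`. -/

/-! ### Isomorphisms of categories with monads. -/

/-- An isomorphism of categories with monads: a functor that is bijective on objects and fully
faithful, with a natural isomorphism that is compatible with units and multiplications. -/
structure MonadPair.IsoData (M N : MonadPair) where
  /-- The functor. -/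
  U : M.C ⥤ N.C
  isIso : U.IsIso
  /-- The natural isomorphism. -/
  φ : M.T.toFunctor ⋙ U ≅ U ⋙ N.T.toFunctor
  unit : ∀ X, U.map (M.T.η.app X) ≫ φ.hom.app X = N.T.η.app (U.obj X)
  mult : ∀ X, U.map (M.T.μ.app X) ≫ φ.hom.app X =
    φ.hom.app (M.T.obj X) ≫ N.T.map (φ.hom.app X) ≫ N.T.μ.app (U.obj X)

namespace MonadPair.IsoData

attribute [instance] MonadPair.IsoData.isIso

variable {M N P : MonadPair}

/-- The underlying cartesian monad opfunctor. -/
def toCart (F : IsoData M N) : CartOpfunctor M N where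
  U := F.U
  φ := F.φ.hom
  preserves := inferInstance
  cart := .of_isIso _
  unit := F.unit
  mult := F.mult

theorem strictInv_obj (F : IsoData M N) (Y : N.C) : F.U.obj (F.U.strictInv.obj Y) = Y :=
  Functor.congr_obj F.U.asIsomorphism.counit_eq Y

theorem map_strictInv (F : IsoData M N) {X Y : N.C} (f : X ⟶ Y) :
    F.U.map (F.U.strictInv.map f) =
      eqToHom (F.strictInv_obj X) ≫ f ≫ eqToHom (F.strictInv_obj Y).symm :=
  Functor.congr_hom F.U.asIsomorphism.counit_eq f

theorem eqToHom_map_comm (H : N.C ⥤ N.C) {X Y : N.C} (e : X = Y) :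
    H.map (eqToHom e) = eqToHom (congrArg H.obj e) := eqToHom_map H e

/-- The component of the inverse transformation. -/
noncomputable def symmApp (F : IsoData M N) (Y : N.C) :
    F.U.strictInv.obj (N.T.obj Y) ≅ M.T.obj (F.U.strictInv.obj Y) :=
  F.U.preimageIso (eqToIso ((F.strictInv_obj _).trans
    (congrArg N.T.obj (F.strictInv_obj Y).symm)) ≪≫ (F.φ.app (F.U.strictInv.obj Y)).symm)

theorem map_symmApp (F : IsoData M N) (Y : N.C) :
    F.U.map (F.symmApp Y).hom = eqToHom ((F.strictInv_obj _).trans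
      (congrArg N.T.obj (F.strictInv_obj Y).symm)) ≫ F.φ.inv.app (F.U.strictInv.obj Y) := by
  simp [symmApp]

/-- Moves a component of the unit or multiplication from `F.U.obj (F.U.strictInv.obj X)` to `X`;
these objects are equal, but not by definition. -/
theorem nat_eqToHom {C D : Type*} [Category C] [Category D] {G H : C ⥤ D} (α : G ⟶ H) {X Y : C}
    (e : X = Y) : α.app X = eqToHom (by rw [e]) ≫ α.app Y ≫ eqToHom (by rw [e]) := by
  subst e; simp

/-- The inverse of an isomorphism of categories with monads. -/
noncomputable def symm (F : IsoData M N) : IsoData N M where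
  U := F.U.strictInv
  isIso := inferInstance
  φ := NatIso.ofComponents F.symmApp fun {X Y} f => F.U.map_injective (by
    simp only [Functor.comp_map, Functor.map_comp, map_symmApp, map_strictInv]
    have h := F.φ.inv.naturality (F.U.strictInv.map f)
    simp only [Functor.comp_map, map_strictInv, Functor.map_comp, eqToHom_map_comm] at h
    simp only [Category.assoc] at h ⊢
    rw [← h]
    simp)
  unit X := F.U.map_injective (by
    simp only [Functor.map_comp, NatIso.ofComponents_hom_app, map_symmApp, map_strictInv]
    have h := F.unit (F.U.strictInv.obj X)
    rw [nat_eqToHom N.T.η (F.strictInv_obj X)] at h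
    rw [← cancel_mono (F.φ.hom.app (F.U.strictInv.obj X)), h]
    simp)
  mult X := F.U.map_injective (by
    simp only [Functor.map_comp, NatIso.ofComponents_hom_app, map_symmApp, map_strictInv]
    have h := F.mult (F.U.strictInv.obj X)
    rw [nat_eqToHom N.T.μ (F.strictInv_obj X)] at h
    rw [← cancel_mono (F.φ.hom.app (F.U.strictInv.obj X))]
    simp only [Category.assoc, h]
    have h' := F.φ.hom.naturality (F.symmApp X).hom
    simp only [Functor.comp_map, map_symmApp, Functor.map_comp, eqToHom_map_comm] at h'
    rw [reassoc_of% h', ← Functor.map_comp_assoc]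
    simp)

theorem symm_comp (F : IsoData M N) (hM : M.IsCartesian) (hN : N.IsCartesian) :
    (show CartMonad.mk N hN ⟶ CartMonad.mk M hM from F.symm.toCart) ≫
      (show CartMonad.mk M hM ⟶ CartMonad.mk N hN from F.toCart) = 𝟙 (CartMonad.mk N hN) := by
  have hU : F.U.strictInv ⋙ F.U = 𝟭 N.C := F.U.asIsomorphism.counit_eq
  apply CartOpfunctor.ext
  · exact hU
  -- The two functors are only propositionally equal, so the transformations are compared
  -- heterogeneously: the composite is an `eqToHom`, which becomes an identity once the functors are
  -- identified.
  · have key : Functor.whiskerRight F.symm.φ.hom F.U ≫ Functor.whiskerLeft F.U.strictInv F.φ.hom =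
        eqToHom (show N.T.toFunctor ⋙ (F.U.strictInv ⋙ F.U) =
          (F.U.strictInv ⋙ F.U) ⋙ N.T.toFunctor by rw [hU]; rfl) := by
      ext X
      change F.U.map (F.symmApp X).hom ≫ F.φ.hom.app (F.U.strictInv.obj X) = _
      rw [map_symmApp, eqToHom_app]
      simp
    refine (heq_of_eq key).trans ((eqToHom_heq_id_dom _ _ _).trans ?_)
    change _ ≍ 𝟙 (N.T.toFunctor ⋙ 𝟭 _)
    rw [hU]

/-- An isomorphism of categories with monads is an isomorphism of cartesian monads. -/
noncomputable def toIso (F : IsoData M N) (hM : M.IsCartesian) (hN : N.IsCartesian) :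
    CartMonad.mk M hM ≅ CartMonad.mk N hN where
  hom := F.toCart
  inv := F.symm.toCart
  hom_inv_id := by
    have h₁ := F.symm_comp hM hN
    have h₂ := F.symm.symm_comp hN hM
    -- `F.symm.toCart` has the left inverse `F.symm.symm.toCart` and the right inverse `F.toCart`;
    -- these must agree.
    have h₃ : F.symm.symm.toCart = F.toCart := by
      have := congrArg (fun t => (show CartMonad.mk M hM ⟶ CartMonad.mk N hN from
        F.symm.symm.toCart) ≫ t) h₁
      simp only at this
      rw [← Category.assoc, h₂, Category.id_comp, Category.comp_id] at this
      exact this.symm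
    rw [h₃] at h₂
    exact h₂
  inv_hom_id := F.symm_comp hM hN

/-- Being cartesian is invariant under isomorphism. -/
theorem isCartesian (F : IsoData M N) (hN : N.IsCartesian) : M.IsCartesian where
  preserves := by
    have := hN.preserves
    have : PreservesLimitsOfShape WalkingCospan (M.T.toFunctor ⋙ F.U) :=
      preservesLimitsOfShape_of_natIso F.φ.symm
    exact preservesLimitsOfShape_of_reflects_of_preserves M.T.toFunctor F.U
  unit := fun X Y f => by
    -- `F.U` reflects pullbacks, and `φ` identifies the image of this square with the naturality
    -- square of the unit of `N` at `F.U.map f`.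
    refine IsPullback.of_map_of_faithful F.U ?_
    have h := hN.unit (F.U.map f)
    refine IsPullback.of_iso h (Iso.refl _) (Iso.refl _) (F.φ.app X).symm (F.φ.app Y).symm
      ?_ ?_ ?_ ?_
    · simp
    · simp [← F.unit]
    · simp [← F.unit]
    · simpa using F.φ.inv.naturality f
  mult := fun X Y f => by
    refine IsPullback.of_map_of_faithful F.U ?_
    have h := hN.mult (F.U.map f)
    refine IsPullback.of_iso h (N.T.mapIso (F.φ.app X).symm ≪≫ (F.φ.app (M.T.obj X)).symm)
      (N.T.mapIso (F.φ.app Y).symm ≪≫ (F.φ.app (M.T.obj Y)).symm) (F.φ.app X).symm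
      (F.φ.app Y).symm ?_ ?_ ?_ ?_
    · have h₁ := F.φ.inv.naturality (M.T.map f)
      have h₂ := congrArg N.T.map (F.φ.inv.naturality f)
      simp only [Functor.comp_map, Functor.map_comp] at h₁ h₂
      simp [h₁, reassoc_of% h₂]
    · have h₁ := F.mult X
      simp [← cancel_mono (F.φ.hom.app X), h₁, ← Functor.map_comp_assoc]
    · have h₁ := F.mult Y
      simp [← cancel_mono (F.φ.hom.app Y), h₁, ← Functor.map_comp_assoc]
    · simpa using F.φ.inv.naturality f

end MonadPair.IsoData

/-- Two left adjoints of the same functor induce isomorphic monads. -/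
theorem CategoryTheory.Adjunction.exists_toMonad_iso {C D : Type*} [Category C] [Category D]
    {L L' : C ⥤ D} {G : D ⥤ C} (adj : L ⊣ G) (adj' : L' ⊣ G) :
    ∃ e : adj.toMonad.toFunctor ≅ adj'.toMonad.toFunctor,
      (∀ X, adj.toMonad.η.app X ≫ e.hom.app X = adj'.toMonad.η.app X) ∧
      ∀ X, adj.toMonad.μ.app X ≫ e.hom.app X =
        e.hom.app (adj.toMonad.obj X) ≫ adj'.toMonad.map (e.hom.app X) ≫ adj'.toMonad.μ.app X := by
  refine ⟨Functor.isoWhiskerRight (adj.leftAdjointUniq adj') G, fun X => ?_, fun X => ?_⟩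
  · exact Adjunction.unit_leftAdjointUniq_hom_app adj adj' X
  · change G.map (adj.counit.app (L.obj X)) ≫ G.map ((adj.leftAdjointUniq adj').hom.app X) =
      G.map ((adj.leftAdjointUniq adj').hom.app (G.obj (L.obj X))) ≫
        G.map (L'.map (G.map ((adj.leftAdjointUniq adj').hom.app X))) ≫
          G.map (adj'.counit.app (L'.obj X))
    simp only [← Functor.map_comp]
    congr 1
    simp

/-! ### Rigidity of arrows and tidiness of the slice. -/

namespace SymMulticat

variable {Q : SymMulticat}

/-- The axiom `free` concerns equality of arrows with equal sources, whereas an automorphism may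
also move the sources along isomorphisms. Replacing each source by the chosen representative of its
class makes isomorphic sources equal, and then the automorphism is a mere permutation fixing the
arrow. -/
theorem Tidy.perm_eq_of_arr (h : Q.Tidy) (f : Q.Arr) (m : EltHom f.hom f.hom) :
    m.perm = Equiv.refl _ := by
  have hs := h.subsingleton
  let x' : Fin f.n → Q.Obj := fun i => Quotient.out (cls (f.src i))
  have hx : ∀ i, Nonempty (x' i ≅ f.src i) := fun i =>
    cls_exact (@Quotient.out_eq _ (isIsomorphicSetoid Q.Obj) (cls (f.src i)))
  let c : ∀ i, x' i ≅ f.src i := fun i => (hx i).some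
  let f' : Q.Hom x' f.tgt := pre (fun i => (c i).hom) f.hom
  let C : EltHom f.hom f' := ⟨Equiv.refl _, fun i => (c i).hom, 𝟙 _, by
    rw [post_id]; exact Q.push_refl _⟩
  let m' : EltHom f' f' := (C.inverse h).comp (m.comp C)
  have hm' : m'.perm = m.perm := Equiv.ext fun _ => rfl
  have hp : ∀ i, x' (m.perm i) = x' i := fun i => by
    have : IsIso (m.inp i) := h.isIso _
    have e : cls (f.src (m.perm i)) = cls (f.src i) := cls_eq (asIso (m.inp i))
    exact congrArg Quotient.out e
  have hr : reindex (x' := x') m.perm hp f' = f' := by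
    rw [reindex_eq]
    refine Eq.trans ?_ m'.eq
    exact h.act_congr (fun i => by rw [hm']) _ _ _ _ _
  have := h.free ⟨f.n, x', f.tgt, f'⟩ m.perm.symm (by
    -- The source family is generalized so that its equality with `x'` can be eliminated; only then
    -- does the equality of arrows follow from `hr`.
    have key : ∀ (x'' : Fin f.n → Q.Obj) (hx : x'' = x') (hp' : ∀ i, x'' (m.perm i) = x' i),
        (⟨f.n, x'', f.tgt, reindex m.perm hp' f'⟩ : Q.Arr) = ⟨f.n, x', f.tgt, f'⟩ := by
      rintro _ rfl hp'
      rw [hr]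
    exact key _ (funext fun i => by
      have := hp (m.perm.symm i)
      rw [Equiv.apply_symm_apply] at this
      exact this.symm) _)
  exact Equiv.ext fun i => by
    have := congrArg (fun e : Equiv.Perm (Fin f.n) => e (m.perm i)) this
    simpa using this.symm

/-- In a tidy symmetric multicategory an automorphism of an arrow fixes the inputs. -/
theorem Tidy.perm_self (h : Q.Tidy) {ι : Type} [Finite ι] {x : ι → Q.Obj} {y : Q.Obj}
    {f : Q.Hom x y} (m : EltHom f f) (i : ι) : m.perm i = i := by
  have := h.perm_eq_of_arr (Arr.ofHom f)
    (((Arr.toOfHom f).inverse h).comp (m.comp (Arr.toOfHom f)))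
  have := congrArg (fun e : Equiv.Perm _ => e (Finite.equivFin ι i)) this
  exact (Finite.equivFin ι).injective ((congrArg (fun k => Finite.equivFin ι (m.perm k))
    ((Finite.equivFin ι).symm_apply_apply i)).symm.trans this)

/-- One morphism followed by the inverse of the other is an automorphism. With `Tidy.eltHom_ext`
this shows that `elt(Q)` is thin. -/
theorem Tidy.perm_eq (h : Q.Tidy) {ι κ : Type} [Finite ι] [Finite κ] {x : ι → Q.Obj}
    {x' : κ → Q.Obj} {y y' : Q.Obj} {f : Q.Hom x y} {f' : Q.Hom x' y'} (a b : EltHom f f')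
    (i : ι) : a.perm i = b.perm i := by
  have := h.perm_self (a.comp (b.inverse h)) i
  have := congrArg b.perm this
  simpa [EltHom.comp, EltHom.inverse] using this

/-- Sending an object to its isomorphism class is faithful because `C` is thin, and full because
equal classes provide an isomorphism. -/
theorem exists_equivalence_discrete {C : Type} [Category.{0} C]
    (hs : ∀ x y : C, Subsingleton (x ⟶ y)) (hi : ∀ {x y : C} (f : x ⟶ y), IsIso f) :
    ∃ S : Type, Nonempty (C ≌ Discrete S) := by
  let S := Quotient (isIsomorphicSetoid C)
  let G : C ⥤ Discrete S :=
    { obj := fun x => ⟨Quotient.mk _ x⟩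
      map := fun {x y} f => Discrete.eqToHom (have := hi f; Quotient.sound ⟨asIso f⟩) }
  have : G.Faithful := ⟨fun _ => Subsingleton.elim _ _⟩
  have : G.Full := ⟨fun {x y} f => by
    obtain ⟨e⟩ : Nonempty (x ≅ y) := Quotient.exact (Discrete.eq_of_hom f)
    exact ⟨e.hom, Subsingleton.elim _ _⟩⟩
  have : G.EssSurj := ⟨fun ⟨s⟩ => by
    obtain ⟨x, rfl⟩ := Quotient.exists_rep s
    exact ⟨x, ⟨Iso.refl _⟩⟩⟩
  have : G.IsEquivalence := {}
  exact ⟨S, ⟨G.asEquivalence⟩⟩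

/-- The labels of the nodes, in planar order. -/
def Tree.labels {ι L : Type} {F : ι → Q.Arr} {X : L → Q.Obj} {y : Q.Obj} :
    Tree Q F X y → List ι
  | leaf _ _ => []
  | node i _ s => i :: (List.ofFn fun j => (s j).labels).flatten

theorem Tree.labels_mapNode {ι κ L : Type} {G : κ → Q.Arr} {X : L → Q.Obj} {y : Q.Obj}
    (h : ι → κ) (T : Tree Q (fun i => G (h i)) X y) : (T.mapNode h).labels = T.labels.map h := by
  induction T with
  | leaf l a => rfl
  | node i a s ih => simp [mapNode, labels, ih, List.map_flatten, List.map_ofFn, Function.comp_def]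

theorem Tree.mem_labels {ι L : Type} {F : ι → Q.Arr} {X : L → Q.Obj} {y : Q.Obj}
    (T : Tree Q F X y) (N : T.Node) : T.nodeLabel N ∈ T.labels := by
  induction T with
  | leaf l a => exact Empty.elim N
  | node i a s ih =>
    rcases N with _ | ⟨j, N⟩
    · exact List.mem_cons_self
    · refine List.mem_cons_of_mem _ (List.mem_flatten.2 ⟨(s j).labels, ?_, ih j N⟩)
      exact List.mem_ofFn.2 ⟨j, rfl⟩

/-- The planar list of node labels is the invariant that detects the symmetric action on the slice.
-/
theorem labels_reindex {ι κ : Type} [Finite ι] [Finite κ] {F : ι → Q.Arr} {G : κ → Q.Arr}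
    {f : Q.Arr} (e : ι ≃ κ) (h : ∀ i, G (e i) = F i) (T : Config F f) :
    (show Config G f from reindex (Q := Q.slice) e h T).tree.labels = T.tree.labels.map e := by
  obtain rfl : F = fun i => G (e i) := (funext h).symm
  exact Tree.labels_mapNode e T.tree

/-- The slice of a tidy symmetric multicategory is tidy. -/
theorem Tidy.slice (h : Q.Tidy) : Q.slice.Tidy where
  free := by
    rintro ⟨n, F, f, T⟩ σ hσ
    have key : ∀ (F' : Fin n → Q.Arr) (hp : ∀ i, F' (σ.symm i) = F i),
        (⟨n, F', f, reindex (Q := Q.slice) σ.symm hp T⟩ : Q.slice.Arr) = ⟨n, F, f, T⟩ →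
          σ = 1 := by
      intro F' hp he
      obtain rfl : F' = F := by
        injection he with _ h₂
      have he' : reindex (Q := Q.slice) σ.symm hp T = T := by
        injection he
      -- The tree is fixed, so its list of node labels is fixed entry by entry by `σ⁻¹`; every index
      -- occurs in the list because each source labels a node.
      have hl := labels_reindex σ.symm hp T
      refine Equiv.ext fun i => ?_
      obtain ⟨N, rfl⟩ := T.node_bij.2 i
      have hm := T.tree.mem_labels N
      have hl' : T.tree.labels.map σ.symm = T.tree.labels.map id := by
        rw [List.map_id]
        exact hl.symm.trans (congrArg (fun t : Config F' f => t.tree.labels) he')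
      have := List.map_inj_left.1 hl' _ hm
      exact ((Equiv.symm_apply_eq σ).1 this).symm
    exact key _ _ hσ
  discrete := exists_equivalence_discrete (C := Q.Arr)
    (fun f g => ⟨fun a b => h.eltHom_ext fun k => h.perm_eq a b k⟩)
    (fun {f g} a => ⟨⟨EltHom.inverse h a, h.eltHom_ext fun k => a.perm.symm_apply_apply k,
      h.eltHom_ext fun k => a.perm.apply_symm_apply k⟩⟩)

theorem tidy_trivial : trivial.Tidy where
  free := by
    rintro ⟨n, x, y, f⟩ σ _
    have : n = 1 := by simpa using f.down
    subst this
    exact Subsingleton.elim _ _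
  discrete := ⟨Unit, ⟨CategoryTheory.Equivalence.refl⟩⟩

theorem tidy_iterSlice (k : ℕ) : (trivial.iterSlice k).Tidy := by
  induction k with
  | zero => exact tidy_trivial
  | succ k ih => exact ih.slice

end SymMulticat

/-! ### Pullbacks of sets over a set, elementwise. -/

theorem isPullback_over {S : Type} {P X Y Z : Over S} {f : P ⟶ X} {g : P ⟶ Y} {h : X ⟶ Z}
    {k : Y ⟶ Z} (w : ∀ p, h.left (f.left p) = k.left (g.left p))
    (inj : ∀ p p', f.left p = f.left p' → g.left p = g.left p' → p = p')
    (surj : ∀ x y, h.left x = k.left y → ∃ p, f.left p = x ∧ g.left p = y) :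
    IsPullback f g h k := by
  refine IsPullback.of_map (Over.forget S) (by ext p; exact w p) ?_
  rw [Types.isPullback_iff]
  exact ⟨by ext p; exact w p, fun p p' hp => inj p p' hp.1 hp.2, surj⟩

theorem isPullback_over_inj {S : Type} {P X Y Z : Over S} {f : P ⟶ X} {g : P ⟶ Y} {h : X ⟶ Z}
    {k : Y ⟶ Z} (H : IsPullback f g h k) {p p' : P.left} (h₁ : f.left p = f.left p')
    (h₂ : g.left p = g.left p') : p = p' :=
  Types.ext_of_isPullback (H.map (Over.forget S)) h₁ h₂

theorem isPullback_over_surj {S : Type} {P X Y Z : Over S} {f : P ⟶ X} {g : P ⟶ Y} {h : X ⟶ Z}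
    {k : Y ⟶ Z} (H : IsPullback f g h k) {x : X.left} {y : Y.left} (e : h.left x = k.left y) :
    ∃ p, f.left p = x ∧ g.left p = y :=
  Types.exists_of_isPullback (H.map (Over.forget S)) x y e

theorem preservesPullbacks_of_isPullback {C D : Type*} [Category C] [Category D] [HasPullbacks C]
    (F : C ⥤ D) (h : ∀ {X Y Z : C} (f : X ⟶ Z) (g : Y ⟶ Z),
      IsPullback (F.map (pullback.fst f g)) (F.map (pullback.snd f g)) (F.map f) (F.map g)) :
    PreservesLimitsOfShape WalkingCospan F where
  preservesLimit {K} := by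
    have : PreservesLimit (cospan (K.map WalkingCospan.Hom.inl) (K.map WalkingCospan.Hom.inr)) F :=
      preservesLimit_of_preserves_limit_cone
        (pullbackIsPullback _ _) ((isLimitMapConePullbackConeEquiv F pullback.condition).symm
          (h _ _).isLimit)
    exact preservesLimit_of_iso_diagram F (diagramIsoCospan K).symm

/-! ### The monad of a tidy symmetric multicategory is cartesian. -/

namespace SymMulticat

variable {Q : SymMulticat} {A B : Over Q.Cls} {ι κ : Type} [Finite ι] [Finite κ] {x : ι → Q.Obj}
  {x' : κ → Q.Obj} {y y' : Q.Obj}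

theorem Tidy.exists_eltHom (h : Q.Tidy) {f : Q.Hom x y} {f' : Q.Hom x' y'} {l : ι → A.left}
    {l' : κ → A.left} {hl : ∀ i, A.hom (l i) = cls (x i)} {hl' : ∀ i, A.hom (l' i) = cls (x' i)}
    (e : mkT f l hl = mkT f' l' hl') : ∃ m : EltHom f f', ∀ i, l' (m.perm i) = l i := by
  obtain ⟨m, hm⟩ := h.mkT_exact (a := ⟨Arr.ofHom f, fun k => l ((Finite.equivFin ι).symm k),
    fun _ => hl _⟩) e
  exact ⟨(Arr.toOfHom f).comp m, fun i => (hm _).trans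
    (congrArg l ((Finite.equivFin ι).symm_apply_apply i))⟩

/-- Equality of the classes gives an automorphism of `f` matching the labels, and automorphisms fix
inputs. So the labels can be read off from a class once the underlying arrow is fixed. -/
theorem Tidy.mkT_inj (h : Q.Tidy) {f : Q.Hom x y} {l l' : ι → A.left}
    {hl : ∀ i, A.hom (l i) = cls (x i)} {hl' : ∀ i, A.hom (l' i) = cls (x i)}
    (e : mkT f l hl = mkT f l' hl') (i : ι) : l i = l' i := by
  obtain ⟨m, hm⟩ := h.exists_eltHom e
  rw [← hm i, h.perm_self m i]

/-- A change of labels leaves the arrow alone, so `t` has an underlying arrow isomorphic to `f`; its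
labels are carried to the inputs of `f` along the isomorphism. -/
theorem Tidy.exists_mkT_of_map (h : Q.Tidy) (k : A ⟶ B) {t : (TObj A).left} {f : Q.Hom x y}
    {l : ι → B.left} {hl : ∀ i, B.hom (l i) = cls (x i)}
    (e : ((TFunctor Q).map k).left t = mkT f l hl) :
    ∃ (l' : ι → A.left) (hl' : ∀ i, A.hom (l' i) = cls (x i)),
      t = mkT f l' hl' ∧ ∀ i, k.left (l' i) = l i := by
  obtain ⟨a, rfl⟩ := exists_mkT h t
  obtain ⟨m, hm⟩ := h.exists_eltHom ((map_mkT k _ _ _).symm.trans e)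
  have hk : ∀ i, k.left (a.lab (m.perm.symm i)) = l i := fun i => by
    rw [← hm, Equiv.apply_symm_apply]
  refine ⟨fun i => a.lab (m.perm.symm i), fun i => ?_, ?_, hk⟩
  · rw [← over_w k, hk, hl]
  · exact h.mkT_eq m fun i => by rw [Equiv.symm_apply_apply]

theorem Tidy.map_isPullback (h : Q.Tidy) {P X Y Z : Over Q.Cls} {f : P ⟶ X} {g : P ⟶ Y}
    {u : X ⟶ Z} {v : Y ⟶ Z} (H : IsPullback f g u v) :
    IsPullback ((TFunctor Q).map f) ((TFunctor Q).map g) ((TFunctor Q).map u)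
      ((TFunctor Q).map v) := by
  refine isPullback_over (fun p => ?_) (fun p p' h₁ h₂ => ?_) (fun s t e => ?_)
  · have := congrArg (TFunctor Q).map H.w
    simp only [Functor.map_comp] at this
    exact ConcreteCategory.congr_hom (congrArg CommaMorphism.left this) p
  · obtain ⟨a, rfl⟩ := exists_mkT h p
    -- Both elements are now labellings of one arrow, so their equality can be tested at each input,
    -- where the given pullback applies.
    obtain ⟨l, hl, rfl, e⟩ := h.exists_mkT_of_map f (h₁.symm.trans (map_mkT f _ _ _))
    refine mkT_congr fun i => isPullback_over_inj H (e i).symm ?_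
    exact h.mkT_inj ((map_mkT g _ _ _).symm.trans (h₂.trans (map_mkT g _ _ _))) i
  · obtain ⟨a, rfl⟩ := exists_mkT h s
    obtain ⟨l, hl, rfl, e'⟩ := h.exists_mkT_of_map v (e.symm.trans (map_mkT u _ _ _))
    choose p hp hp' using fun i => isPullback_over_surj H (e' i).symm
    refine ⟨mkT a.arr.hom p fun i => ?_, ?_, ?_⟩
    · rw [← over_w f, hp, a.compat]
    · exact (map_mkT f _ _ _).trans (mkT_congr hp)
    · exact (map_mkT g _ _ _).trans (mkT_congr hp')

/-- A normal form for doubly labelled arrows, including the object-morphisms that `Tidy.mu_mkT`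
needs in order to compose them. -/
theorem Tidy.exists_mkT_mkT (h : Q.Tidy) (t : (TObj (TObj A)).left) :
    ∃ (n : ℕ) (x : Fin n → Q.Obj) (y : Q.Obj) (f : Q.Hom x y) (g : Fin n → Q.Arr)
      (_ : ∀ i, (g i).tgt ⟶ x i) (l : ∀ i, Fin (g i).n → A.left)
      (hl : ∀ i j, A.hom (l i j) = cls ((g i).src j)) (hg : ∀ i, cls (g i).tgt = cls (x i)),
      t = mkT (A := TObj A) f (fun i => mkT (g i).hom (l i) (hl i)) hg := by
  obtain ⟨a, rfl⟩ := exists_mkT h t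
  obtain ⟨⟨n, x, y, f⟩, l, hl⟩ := a
  choose b hb using fun i => exists_mkT h (l i)
  obtain rfl := funext hb
  exact ⟨n, x, y, f, fun i => (b i).arr, fun i => (cls_exact (hl i)).some.hom,
    fun i => (b i).lab, fun i => (b i).compat, hl, rfl⟩

/-- The monad of a tidy symmetric multicategory is cartesian. -/
theorem Tidy.isCartesian (h : Q.Tidy) : (Q.zeta h).IsCartesian where
  preserves := preservesPullbacks_of_isPullback (C := Over Q.Cls) (TFunctor Q)
    fun f g => h.map_isPullback (IsPullback.of_hasPullback f g)
  unit := fun A B k => by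
    refine isPullback_over (f := k) (g := etaHom A) (h := etaHom B) (k := (TFunctor Q).map k)
      (fun p => h.eta_nat k p) (fun p p' _ h₂ => ?_) (fun b t e => ?_)
    · have h₃ : etaFun A p = etaFun A p' := h₂
      -- The units at `p` and `p'` are a priori identities of different representatives; equal sorts
      -- allow a common one.
      have hp : A.hom p = A.hom p' := by
        have := congrArg (TObj A).hom h₃
        exact (over_w (etaHom A) p).symm.trans (this.trans (over_w (etaHom A) p'))
      let x : Q.Obj := Quotient.out (A.hom p)
      have hx : A.hom p = cls x := (@Quotient.out_eq _ (isIsomorphicSetoid Q.Obj) (A.hom p)).symm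
      rw [h.eta_eq p hx, h.eta_eq p' (hp.symm.trans hx)] at h₃
      exact h.mkT_inj h₃ ()
    · let x : Q.Obj := Quotient.out (B.hom b)
      have hx : B.hom b = cls x := (@Quotient.out_eq _ (isIsomorphicSetoid Q.Obj) (B.hom b)).symm
      obtain ⟨l, hl, rfl, e'⟩ := h.exists_mkT_of_map k (e.symm.trans (h.eta_eq b hx))
      exact ⟨l (), e' (), h.eta_eq _ (hl ())⟩
  mult := fun A B k => by
    refine isPullback_over (f := (TFunctor Q).map ((TFunctor Q).map k)) (g := h.muHom A)
      (h := h.muHom B) (k := (TFunctor Q).map k) (fun p => h.mu_nat k p) (fun p p' h₁ h₂ => ?_)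
      (fun b t e => ?_)
    · obtain ⟨n, x, y, f, g, u, l, hl, hg, rfl⟩ := h.exists_mkT_mkT p
      obtain ⟨t, ht, rfl, e⟩ := h.exists_mkT_of_map _ (h₁.symm.trans (map_mkT _ _ _ _))
      choose l' hl' e₁ e₂ using fun i => h.exists_mkT_of_map _ ((e i).trans (map_mkT k _ _ _))
      obtain rfl := funext e₁
      refine mkT_congr fun i => mkT_congr fun j => ?_
      have := (h.mu_mkT f (fun i => (g i).hom) l hl u hg).symm.trans
        (h₂.trans (h.mu_mkT f (fun i => (g i).hom) l' hl' u ht))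
      exact h.mkT_inj this ⟨i, j⟩
    · obtain ⟨n, x, y, f, g, u, l, hl, hg, rfl⟩ := h.exists_mkT_mkT b
      obtain ⟨l', hl', rfl, e'⟩ := h.exists_mkT_of_map _
        (e.symm.trans (h.mu_mkT f (fun i => (g i).hom) l hl u hg))
      -- A labelling of the inputs of a composite is curried into labellings of the inner arrows.
      refine ⟨mkT (A := TObj A) f (fun i => mkT (g i).hom (fun j => l' ⟨i, j⟩)
        (fun j => hl' ⟨i, j⟩)) hg, ?_, ?_⟩
      · refine (map_mkT _ _ _ _).trans (mkT_congr fun i => ?_)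
        exact (map_mkT _ _ _ _).trans (mkT_congr fun j => e' ⟨i, j⟩)
      · exact h.mu_mkT f (fun i => (g i).hom) _ _ u hg

end SymMulticat

/-! ### Elements of the objects of a category isomorphic to `Set / S_Q`. -/

namespace MonadPair.IsoData

open SymMulticat

variable {M : MonadPair} {Q : SymMulticat} {h : Q.Tidy} (F : M.IsoData (Q.zeta h))

/-- The object over the set of classes of objects that corresponds to an object. -/
def ovr (X : M.C) : Over Q.Cls := F.U.obj X

/-- The elements of an object. -/
def El (X : M.C) : Type := (F.ovr X).left

variable {F} {X Y Z : M.C}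

/-- The sort of an element. -/
def sort (e : F.El X) : Q.Cls := (F.ovr X).hom e

variable (F) in
/-- The morphism between objects over the set of classes. -/
def overMap (f : X ⟶ Y) : F.ovr X ⟶ F.ovr Y := F.U.map f

/-- The action of a morphism on elements. -/
def app (f : X ⟶ Y) (e : F.El X) : F.El Y := (F.overMap f).left e

theorem sort_app (f : X ⟶ Y) (e : F.El X) : sort (app f e) = sort e :=
  over_w (F.overMap f) e

@[simp] theorem app_id (e : F.El X) : app (𝟙 X) e = e := by
  have : F.overMap (𝟙 X) = 𝟙 (F.ovr X) := F.U.map_id X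
  rw [app, this]; rfl

theorem app_comp (f : X ⟶ Y) (g : Y ⟶ Z) (e : F.El X) : app (f ≫ g) e = app g (app f e) := by
  have : F.overMap (f ≫ g) = F.overMap f ≫ F.overMap g := F.U.map_comp f g
  rw [app, this]; rfl

theorem hom_ext {f g : X ⟶ Y} (e : ∀ a : F.El X, app f a = app g a) : f = g := by
  refine F.U.map_injective ?_
  change F.overMap f = F.overMap g
  ext a
  exact e a

theorem app_congr {f g : X ⟶ Y} (e : f = g) (a : F.El X) : app f a = app g a := by rw [e]

/-- The morphism with a given action on elements. -/
noncomputable def homMk (g : F.El X → F.El Y) (hg : ∀ e, sort (g e) = sort e) : X ⟶ Y :=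
  F.U.preimage (Over.homMk (U := F.ovr X) (V := F.ovr Y) (TypeCat.ofHom g)
    (by ext e; exact hg e) : F.ovr X ⟶ F.ovr Y)

@[simp] theorem app_homMk (g : F.El X → F.El Y) (hg : ∀ e, sort (g e) = sort e) (e : F.El X) :
    app (homMk g hg) e = g e := by
  have : F.overMap (homMk g hg) = (Over.homMk (U := F.ovr X) (V := F.ovr Y) (TypeCat.ofHom g)
    (by ext e; exact hg e) : F.ovr X ⟶ F.ovr Y) := F.U.map_preimage _
  rw [app, this]; rfl

variable (F) in
/-- The object with a given set of elements. -/
noncomputable def objMk {E : Type} (s : E → Q.Cls) : M.C :=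
  F.U.strictInv.obj (Over.mk (TypeCat.ofHom s) : Over Q.Cls)

theorem over_objMk {E : Type} (s : E → Q.Cls) :
    F.ovr (F.objMk s) = Over.mk (TypeCat.ofHom s) := F.strictInv_obj _

/-- The elements of `objMk s`. -/
noncomputable def elEquiv {E : Type} (s : E → Q.Cls) : F.El (F.objMk s) ≃ E :=
  ((Over.forget _).mapIso (eqToIso (over_objMk (F := F) s))).toEquiv

theorem sort_elEquiv_symm {E : Type} (s : E → Q.Cls) (e : E) :
    sort ((elEquiv (F := F) s).symm e) = s e :=
  over_w (eqToIso (over_objMk (F := F) s)).inv e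

theorem sort_eq {E : Type} (s : E → Q.Cls) (u : F.El (F.objMk s)) :
    sort u = s (elEquiv s u) := by
  rw [← sort_elEquiv_symm s (elEquiv s u), Equiv.symm_apply_apply]

/-- An element of sort `s` is a morphism from the one-element object of sort `s`, and there is
exactly one such morphism to the terminal object. -/
theorem sort_terminal_bijective :
    Function.Bijective (sort : F.El (⊤_ M.C) → Q.Cls) := by
  constructor
  · intro e e' he
    let g : ∀ a : F.El (⊤_ M.C), sort a = sort e → (F.objMk (fun _ : Unit => sort e) ⟶ ⊤_ M.C) :=
      fun a ha => homMk (fun _ => a) fun u => ha.trans (sort_eq _ u).symm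
    have := app_congr (F := F) (terminal.hom_ext (g e rfl) (g e' he.symm)) ((elEquiv _).symm ())
    simpa [g] using this
  · intro s
    exact ⟨app (terminal.from _) ((elEquiv (F := F) (fun _ : Unit => s)).symm ()), by
      rw [sort_app, sort_elEquiv_symm]⟩

variable (F) in
/-- The element of the terminal object of a given sort. -/
noncomputable def star (s : Q.Cls) : F.El (⊤_ M.C) :=
  (Equiv.ofBijective _ (sort_terminal_bijective (F := F))).symm s

@[simp] theorem sort_star (s : Q.Cls) : sort (F.star s) = s :=
  (Equiv.ofBijective _ (sort_terminal_bijective (F := F))).apply_symm_apply s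

theorem eq_star (e : F.El (⊤_ M.C)) {s : Q.Cls} (hs : sort e = s) : e = F.star s :=
  sort_terminal_bijective.1 (by rw [hs, sort_star])

theorem app_terminal (f : X ⟶ ⊤_ M.C) (e : F.El X) {s : Q.Cls} (hs : sort e = s) :
    app f e = F.star s := eq_star _ (by rw [sort_app, hs])

/-! Elements of `T X`. -/

section

variable {ι κ : Type} [Finite ι] [Finite κ] {x : ι → Q.Obj} {x' : κ → Q.Obj} {y y' : Q.Obj}

/-- An element of `T X` as the class of a labelled arrow. -/
noncomputable def toT (t : F.El (M.T.obj X)) : (TObj (F.ovr X)).left :=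
  ((F.φ.hom.app X : F.ovr (M.T.obj X) ⟶ TObj (F.ovr X))).left t

/-- The element of `T X` that corresponds to the class of a labelled arrow. -/
noncomputable def ofT (t : (TObj (F.ovr X)).left) : F.El (M.T.obj X) :=
  ((F.φ.inv.app X : TObj (F.ovr X) ⟶ F.ovr (M.T.obj X))).left t

@[simp] theorem toT_ofT (t : (TObj (F.ovr X)).left) : toT (ofT t) = t :=
  ConcreteCategory.congr_hom (congrArg CommaMorphism.left
    (F.φ.inv_hom_id_app X : _ = 𝟙 (TObj (F.ovr X)))) t

@[simp] theorem ofT_toT (t : F.El (M.T.obj X)) : ofT (toT t) = t :=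
  ConcreteCategory.congr_hom (congrArg CommaMorphism.left
    (F.φ.hom_inv_id_app X : _ = 𝟙 (F.ovr (M.T.obj X)))) t

theorem toT_app (k : X ⟶ Y) (t : F.El (M.T.obj X)) :
    toT (app (M.T.map k) t) = ((TFunctor Q).map (F.overMap k)).left (toT t) :=
  ConcreteCategory.congr_hom (congrArg (CommaMorphism.left (L := 𝟭 Type)
    (R := Functor.fromPUnit Q.Cls)) (F.φ.hom.naturality k)) t

theorem toT_eta (e : F.El X) : toT (app (M.T.η.app X) e) = etaFun (F.ovr X) e :=
  ConcreteCategory.congr_hom (congrArg (CommaMorphism.left (L := 𝟭 Type)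
    (R := Functor.fromPUnit Q.Cls)) (F.unit X)) e

/-- Here `toT` translates only the outer application of the monad, so the labels still have to be
translated by `φ`. -/
theorem toT_mu (t : F.El (M.T.obj (M.T.obj X))) : toT (app (M.T.μ.app X) t) =
    (h.muHom (F.ovr X)).left (((TFunctor Q).map
      (F.φ.hom.app X : F.ovr (M.T.obj X) ⟶ TObj (F.ovr X))).left (toT t)) :=
  ConcreteCategory.congr_hom (congrArg (CommaMorphism.left (L := 𝟭 Type)
    (R := Functor.fromPUnit Q.Cls)) (F.mult X)) t

theorem sort_toT (t : F.El (M.T.obj X)) : (TObj (F.ovr X)).hom (toT t) = sort t :=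
  over_w (F.φ.hom.app X : F.ovr (M.T.obj X) ⟶ TObj (F.ovr X)) t

/-- The element of `T X` determined by a labelled arrow. -/
noncomputable def tm (f : Q.Hom x y) (l : ι → F.El X) (hl : ∀ i, sort (l i) = cls (x i)) :
    F.El (M.T.obj X) := ofT (mkT f l hl)

theorem toT_tm (f : Q.Hom x y) (l : ι → F.El X) (hl : ∀ i, sort (l i) = cls (x i)) :
    toT (tm f l hl) = mkT f l hl := toT_ofT _

theorem toT_injective : Function.Injective (toT : F.El (M.T.obj X) → _) :=
  Function.LeftInverse.injective ofT_toT

@[simp] theorem sort_tm (f : Q.Hom x y) (l : ι → F.El X) (hl : ∀ i, sort (l i) = cls (x i)) :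
    sort (tm f l hl) = cls y := by
  rw [← sort_toT, toT_tm]; rfl

theorem tm_congr {f : Q.Hom x y} {l l' : ι → F.El X} {hl : ∀ i, sort (l i) = cls (x i)}
    {hl' : ∀ i, sort (l' i) = cls (x i)} (e : ∀ i, l i = l' i) : tm f l hl = tm f l' hl' := by
  obtain rfl := funext e
  rfl

theorem tm_eq {f : Q.Hom x y} {f' : Q.Hom x' y'} {l : ι → F.El X} {l' : κ → F.El X}
    {hl : ∀ i, sort (l i) = cls (x i)} {hl' : ∀ i, sort (l' i) = cls (x' i)} (m : EltHom f f')
    (hm : ∀ i, l' (m.perm i) = l i) : tm f l hl = tm f' l' hl' :=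
  congrArg ofT (h.mkT_eq m hm)

theorem exists_eltHom {f : Q.Hom x y} {f' : Q.Hom x' y'} {l : ι → F.El X} {l' : κ → F.El X}
    {hl : ∀ i, sort (l i) = cls (x i)} {hl' : ∀ i, sort (l' i) = cls (x' i)}
    (e : tm f l hl = tm f' l' hl') : ∃ m : EltHom f f', ∀ i, l' (m.perm i) = l i :=
  h.exists_eltHom ((toT_tm f l hl).symm.trans ((congrArg toT e).trans (toT_tm f' l' hl')))

theorem exists_tm (t : F.El (M.T.obj X)) :
    ∃ (a : Q.Arr) (l : Fin a.n → F.El X) (hl : ∀ i, sort (l i) = cls (a.src i)),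
      t = tm a.hom l hl := by
  obtain ⟨a, ha⟩ := SymMulticat.exists_mkT h (toT t)
  exact ⟨a.arr, a.lab, a.compat, toT_injective (ha.trans (toT_tm _ _ _).symm)⟩

theorem app_tm (k : X ⟶ Y) (f : Q.Hom x y) (l : ι → F.El X) (hl : ∀ i, sort (l i) = cls (x i)) :
    app (M.T.map k) (tm f l hl) =
      tm f (fun i => app k (l i)) (fun i => (sort_app k _).trans (hl i)) := by
  apply toT_injective
  rw [toT_app, toT_tm, toT_tm]
  rfl

theorem app_eta (e : F.El X) {a : Q.Obj} (ha : sort e = cls a) :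
    app (M.T.η.app X) e = tm (Q.iota (𝟙 a)) (fun _ => e) (fun _ => ha) := by
  apply toT_injective
  rw [toT_eta, toT_tm]
  exact h.eta_eq _ ha

theorem app_mu {ν : κ → Type} [∀ k, Finite (ν k)] {v : ∀ k, ν k → Q.Obj} {w : κ → Q.Obj}
    (f : Q.Hom x' y) (g : ∀ k, Q.Hom (v k) (w k)) (l : ∀ k, ν k → F.El X)
    (hl : ∀ k j, sort (l k j) = cls (v k j)) (u : ∀ k, w k ⟶ x' k)
    (hl' : ∀ k, sort (tm (g k) (l k) (hl k)) = cls (x' k)) :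
    app (M.T.μ.app X) (tm f (fun k => tm (g k) (l k) (hl k)) hl') =
      tm (Q.comp f (fun k => SymMulticat.post (u k) (g k))) (fun p => l p.1 p.2)
        (fun p => hl p.1 p.2) := by
  apply toT_injective
  rw [toT_mu, toT_tm, toT_tm]
  have hl'' : ∀ k, (TObj (F.ovr X)).hom (mkT (g k) (l k) (hl k)) = cls (x' k) := fun k => by
    rw [← hl' k, ← sort_toT, toT_tm]
  refine Eq.trans (congrArg (h.muHom (F.ovr X)).left ?_) (h.mu_mkT f g l hl u hl'')
  refine (map_mkT _ _ _ _).trans (mkT_congr fun k => ?_)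
  exact toT_ofT _

end

/-! Elements of pullbacks. -/

theorem exists_isPullback {P : M.C} {f : P ⟶ X} {g : P ⟶ Y} {u : X ⟶ Z} {v : Y ⟶ Z}
    (H : IsPullback f g u v) {a : F.El X} {b : F.El Y} (e : app u a = app v b) :
    ∃ p, app f p = a ∧ app g p = b :=
  isPullback_over_surj (S := Q.Cls) (H.map F.U) e

theorem ext_isPullback {P : M.C} {f : P ⟶ X} {g : P ⟶ Y} {u : X ⟶ Z} {v : Y ⟶ Z}
    (H : IsPullback f g u v) {p p' : F.El P} (e : app f p = app f p') (e' : app g p = app g p') :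
    p = p' :=
  isPullback_over_inj (S := Q.Cls) (H.map F.U) e e'

end MonadPair.IsoData

/-! ### Elements of `T1`, of composite graphs, and operads on them. -/

namespace MonadPair.IsoData

open SymMulticat

variable {M : MonadPair} {Q : SymMulticat} {h : Q.Tidy} {F : M.IsoData (Q.zeta h)} {X Y Z : M.C}
variable {ι κ : Type} [Finite ι] [Finite κ] {x : ι → Q.Obj} {x' : κ → Q.Obj} {y y' : Q.Obj}

variable (F) in
/-- The class of an arrow, as an element of `T 1`. -/
noncomputable def arr (f : Q.Hom x y) : F.El (M.T.obj (⊤_ M.C)) :=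
  tm f (fun i => F.star (cls (x i))) (fun _ => sort_star _)

@[simp] theorem sort_arr (f : Q.Hom x y) : sort (F.arr f) = cls y := sort_tm _ _ _

/-- Labels in the terminal object carry only their sorts, which are determined by the sources.
Together with `exists_eltHom_of_arr` and `exists_arr` this identifies the elements of `T1` with the
isomorphism classes of arrows of `Q`. -/
theorem arr_eq {f : Q.Hom x y} {f' : Q.Hom x' y'} (m : EltHom f f') : F.arr f = F.arr f' :=
  tm_eq m fun i => congrArg F.star
    (cls_eq (have := h.isIso (m.inp i); asIso (m.inp i)))

theorem exists_eltHom_of_arr {f : Q.Hom x y} {f' : Q.Hom x' y'} (e : F.arr f = F.arr f') :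
    Nonempty (EltHom f f') := ⟨(exists_eltHom e).choose⟩

theorem exists_arr (b : F.El (M.T.obj (⊤_ M.C))) : ∃ a : Q.Arr, b = F.arr a.hom := by
  obtain ⟨a, l, hl, rfl⟩ := exists_tm b
  exact ⟨a, tm_congr fun i => eq_star _ (hl i)⟩

theorem app_map_terminal (k : X ⟶ ⊤_ M.C) (f : Q.Hom x y) (l : ι → F.El X)
    (hl : ∀ i, sort (l i) = cls (x i)) : app (M.T.map k) (tm f l hl) = F.arr f :=
  (app_tm _ _ _ _).trans (tm_congr fun i => app_terminal _ _ (hl i))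

theorem app_mu_arr {κ : ι → Type} [∀ i, Finite (κ i)] {z : ∀ i, κ i → Q.Obj} {w : ι → Q.Obj}
    (f : Q.Hom x y) (g : ∀ i, Q.Hom (z i) (w i)) (u : ∀ i, w i ⟶ x i)
    (hl : ∀ i, sort (F.arr (g i)) = cls (x i)) :
    app (M.T.μ.app _) (tm f (fun i => F.arr (g i)) hl) =
      F.arr (Q.comp f (fun i => SymMulticat.post (u i) (g i))) :=
  app_mu f g (fun i k => F.star (cls (z i k))) (fun _ _ => sort_star _) u hl

theorem sort_eq_of_deg {A : Over (M.T.obj (⊤_ M.C))} {p : F.El A.left} {f : Q.Hom x y}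
    (e : app A.hom p = F.arr f) : sort p = cls y := by
  rw [← sort_app A.hom, e, sort_arr]

/-! Elements of the composite of graphs. -/

section

variable {A B : Over (M.T.obj (⊤_ M.C))}

theorem exists_comp (a : F.El A.left) (f : Q.Hom x y) (l : ι → F.El B.left)
    (hl : ∀ i, sort (l i) = cls (x i)) (e : app A.hom a = F.arr f) :
    ∃ z : F.El (compObj M.T A B), app (pullback.fst _ _) z = a ∧
      app (pullback.snd _ _) z = tm f l hl :=
  exists_isPullback (IsPullback.of_hasPullback _ _) (e.trans (app_map_terminal _ _ _ _).symm)

theorem comp_ext {z z' : F.El (compObj M.T A B)}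
    (e : app (pullback.fst _ _) z = app (pullback.fst _ _) z')
    (e' : app (pullback.snd _ _) z = app (pullback.snd _ _) z') : z = z' :=
  ext_isPullback (IsPullback.of_hasPullback _ _) e e'

theorem exists_of_comp (z : F.El (compObj M.T A B)) :
    ∃ (f : Q.Arr) (l : Fin f.n → F.El B.left) (hl : ∀ i, sort (l i) = cls (f.src i)),
      app (pullback.snd _ _) z = tm f.hom l hl ∧
      app A.hom (app (pullback.fst _ _) z) = F.arr f.hom := by
  obtain ⟨f, l, hl, e⟩ := exists_tm (app (pullback.snd _ _) z)
  refine ⟨f, l, hl, e, ?_⟩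
  rw [← app_comp, app_congr pullback.condition, app_comp, e, app_map_terminal]

theorem app_compDom {κ : ι → Type} [∀ i, Finite (κ i)] {x' : ∀ i, κ i → Q.Obj} {w : ι → Q.Obj}
    {z : F.El (compObj M.T A B)} {f : Q.Hom x y}
    {l : ι → F.El B.left} {hl : ∀ i, sort (l i) = cls (x i)}
    (e : app (pullback.snd _ _) z = tm f l hl) (g : ∀ i, Q.Hom (x' i) (w i))
    (hg : ∀ i, app B.hom (l i) = F.arr (g i)) (u : ∀ i, w i ⟶ x i) :
    app (compDom M.T A B) z = F.arr (Q.comp f (fun i => SymMulticat.post (u i) (g i))) := by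
  rw [app_comp, app_comp, e, app_tm]
  have hl' : ∀ i, sort (F.arr (g i)) = cls (x i) := fun i => by rw [← hg, sort_app, hl]
  rw [tm_congr (hl' := hl') hg]
  exact app_mu_arr f g u hl'

variable (F) in
/-- The data of an operad, in terms of elements. The value `cmp p f q` is meaningful if `p` is
over `f` and the sorts of the `q i` are the sources of `f`. -/
structure OperadData (A : Over (M.T.obj (⊤_ M.C))) where
  /-- The identities. -/
  one : Q.Cls → F.El A.left
  /-- The composition. -/
  cmp : ∀ {ι : Type} [Finite ι] {x : ι → Q.Obj} {y : Q.Obj},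
    F.El A.left → Q.Hom x y → (ι → F.El A.left) → F.El A.left
  deg_one : ∀ a : Q.Obj, app A.hom (one (cls a)) = F.arr (Q.iota (𝟙 a))
  deg_cmp : ∀ {ι : Type} [Finite ι] {κ : ι → Type} [∀ i, Finite (κ i)] {x : ι → Q.Obj} {y : Q.Obj}
    {z : ∀ i, κ i → Q.Obj} {w : ι → Q.Obj} (f : Q.Hom x y) (g : ∀ i, Q.Hom (z i) (w i))
    (u : ∀ i, w i ⟶ x i) (p : F.El A.left) (q : ι → F.El A.left),
    app A.hom p = F.arr f → (∀ i, app A.hom (q i) = F.arr (g i)) →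
    app A.hom (cmp p f q) = F.arr (Q.comp f (fun i => SymMulticat.post (u i) (g i)))
  -- The degree of `p` is only an isomorphism class, while `cmp` takes an actual arrow in that
  -- class; this law makes the choice immaterial.
  cmp_eq : ∀ {ι κ : Type} [Finite ι] [Finite κ] {x : ι → Q.Obj} {y : Q.Obj} {x' : κ → Q.Obj}
    {y' : Q.Obj} {f : Q.Hom x y} {f' : Q.Hom x' y'} (p : F.El A.left) (q : ι → F.El A.left)
    (q' : κ → F.El A.left), app A.hom p = F.arr f → (∀ i, sort (q i) = cls (x i)) →
    (∀ i, sort (q' i) = cls (x' i)) → ∀ m : EltHom f f', (∀ i, q' (m.perm i) = q i) →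
    cmp p f q = cmp p f' q'
  one_cmp : ∀ (a : Q.Obj) (p : F.El A.left), sort p = cls a →
    cmp (one (cls a)) (Q.iota (𝟙 a)) (fun _ : Unit => p) = p
  cmp_one : ∀ {ι : Type} [Finite ι] {x : ι → Q.Obj} {y : Q.Obj} (f : Q.Hom x y) (p : F.El A.left),
    app A.hom p = F.arr f → cmp p f (fun i => one (cls (x i))) = p
  assoc : ∀ {ι : Type} [Finite ι] {κ : ι → Type} [∀ i, Finite (κ i)] {x : ι → Q.Obj} {y : Q.Obj}
    {z : ∀ i, κ i → Q.Obj} {w : ι → Q.Obj} (f : Q.Hom x y) (g : ∀ i, Q.Hom (z i) (w i))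
    (u : ∀ i, w i ⟶ x i) (p : F.El A.left) (q : ι → F.El A.left) (r : ∀ i, κ i → F.El A.left),
    app A.hom p = F.arr f → (∀ i, app A.hom (q i) = F.arr (g i)) →
    (∀ i k, sort (r i k) = cls (z i k)) →
    cmp p f (fun i => cmp (q i) (g i) (r i)) =
      cmp (cmp p f q) (Q.comp f (fun i => SymMulticat.post (u i) (g i))) (fun k => r k.1 k.2)

end

end MonadPair.IsoData

/-! ### Translation between operads and their data on elements. -/

namespace MonadPair.IsoData.OperadData

open SymMulticat

variable {M : MonadPair} {Q : SymMulticat} {h : Q.Tidy} {F : M.IsoData (Q.zeta h)}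
variable {A : Over (M.T.obj (⊤_ M.C))}

section

variable {ι : Type} [Finite ι] {x : ι → Q.Obj} {y : Q.Obj}

theorem exists_cls (s : Q.Cls) : ∃ a, s = cls a :=
  ⟨_, (Quotient.out_eq (s := isIsomorphicSetoid _) _).symm⟩

theorem sort_one (D : F.OperadData A) (s : Q.Cls) : sort (D.one s) = s := by
  obtain ⟨a, rfl⟩ := exists_cls s
  exact sort_eq_of_deg (D.deg_one a)

theorem exists_deg (p : F.El A.left) : ∃ a : Q.Arr, app A.hom p = F.arr a.hom ∧
    sort p = cls a.tgt := by
  obtain ⟨a, ha⟩ := exists_arr (app A.hom p)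
  exact ⟨a, ha, sort_eq_of_deg ha⟩

theorem sort_cmp (D : F.OperadData A) (f : Q.Hom x y) (p : F.El A.left) (q : ι → F.El A.left)
    (hp : app A.hom p = F.arr f) (hq : ∀ i, sort (q i) = cls (x i)) :
    sort (D.cmp p f q) = cls y := by
  choose a ha using fun i => exists_deg (q i)
  exact sort_eq_of_deg (D.deg_cmp f (fun i => (a i).hom)
    (fun i => (cls_exact ((ha i).2.symm.trans (hq i))).some.hom) p q hp (fun i => (ha i).1))

/-- The composition as a function on the elements of the composite graph. -/
noncomputable def compFun (D : F.OperadData A) (z : F.El (compObj M.T A A)) : F.El A.left :=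
  D.cmp (app (pullback.fst _ _) z) (exists_of_comp z).choose.hom (exists_of_comp z).choose_spec.choose

/-- An element of the composite graph determines its labelled arrow up to a morphism of `elt(Q)`,
and `cmp_eq` absorbs the difference from the chosen one. -/
theorem compFun_eq (D : F.OperadData A) {z : F.El (compObj M.T A A)} {p : F.El A.left}
    {f : Q.Hom x y} {q : ι → F.El A.left} {hq : ∀ i, sort (q i) = cls (x i)}
    (e : app (pullback.fst _ _) z = p) (e' : app (pullback.snd _ _) z = tm f q hq) :
    D.compFun z = D.cmp p f q := by
  obtain ⟨hq', e₁, e₂⟩ := (exists_of_comp z).choose_spec.choose_spec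
  obtain ⟨m, hm⟩ := exists_eltHom (e₁.symm.trans e')
  rw [← e]
  exact D.cmp_eq _ _ _ e₂ hq' hq m hm

theorem sort_compFun (D : F.OperadData A) (z : F.El (compObj M.T A A)) :
    sort (D.compFun z) = sort z := by
  obtain ⟨f, q, hq, e₁, e₂⟩ := exists_of_comp z
  rw [D.compFun_eq rfl e₁, D.sort_cmp _ _ _ e₂ hq, ← sort_app (pullback.snd _ _) z, e₁, sort_tm]

theorem app_compLift_fst {X : M.C} {B : Over (M.T.obj (⊤_ M.C))} (a : X ⟶ A.left)
    (b : X ⟶ M.T.obj B.left) (e : a ≫ A.hom = b ≫ M.T.map (terminal.from B.left)) (z : F.El X) :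
    app (pullback.fst _ _) (app (compLift a b e) z) = app a z := by
  rw [← app_comp, compLift_fst]

theorem app_compLift_snd {X : M.C} {B : Over (M.T.obj (⊤_ M.C))} (a : X ⟶ A.left)
    (b : X ⟶ M.T.obj B.left) (e : a ≫ A.hom = b ≫ M.T.map (terminal.from B.left)) (z : F.El X) :
    app (pullback.snd _ _) (app (compLift a b e) z) = app b z := by
  rw [← app_comp, compLift_snd]

/-- The operad with given data. -/
noncomputable def toOperad (D : F.OperadData A) : Operad M.T where
  A := A
  ids := homMk (F := F) (fun e => D.one (sort e)) fun e => D.sort_one _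
  comp := homMk (F := F) D.compFun D.sort_compFun
  ids_dom := hom_ext (F := F) fun e => by
    obtain ⟨a, ha⟩ : ∃ a, sort e = cls a := exists_cls _
    rw [app_comp, app_homMk, ha, D.deg_one, app_eta e ha]
    exact tm_congr fun _ => (eq_star _ ha).symm
  comp_dom := hom_ext (F := F) fun z => by
    obtain ⟨f, q, hq, e₁, e₂⟩ := exists_of_comp z
    choose a ha using fun i => exists_deg (q i)
    rw [app_comp, app_homMk, D.compFun_eq rfl e₁]
    have u : ∀ i, (a i).tgt ⟶ f.src i := fun i => (cls_exact ((ha i).2.symm.trans (hq i))).some.hom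
    rw [D.deg_cmp f.hom (fun i => (a i).hom) u _ _ e₂ (fun i => (ha i).1),
      app_compDom e₁ (fun i => (a i).hom) (fun i => (ha i).1) u]
  id_left := hom_ext (F := F) fun p => by
    obtain ⟨a, ha⟩ : ∃ a, sort p = cls a := exists_cls _
    rw [app_comp, app_homMk, app_id, D.compFun_eq (app_compLift_fst _ _ _ _)
      ((app_compLift_snd _ _ _ _).trans (app_eta p ha)), app_comp, app_homMk, sort_app, ha,
      D.one_cmp _ _ ha]
  id_right := hom_ext (F := F) fun p => by
    obtain ⟨a, ha, _⟩ := exists_deg p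
    rw [app_comp, app_homMk, app_id, D.compFun_eq (app_compLift_fst _ _ _ _)
      ((app_compLift_snd _ _ _ _).trans ((app_comp _ _ _).trans
        ((congrArg _ ha).trans (app_tm _ _ _ _)))), app_id]
    simp only [app_homMk, sort_star]
    exact D.cmp_one a.hom p ha
  assoc := hom_ext (F := F) fun z => by
    obtain ⟨f, ω, hω, e⟩ := exists_tm (app (pullback.snd _ _) z)
    have hp : app A.hom (app (pullback.fst _ _) z) = F.arr f.hom := by
      rw [← app_comp, app_congr pullback.condition, app_comp, e, app_map_terminal]
    -- An element of the threefold composite is `p` over `f` with labels `ω i`, and each `ω i` is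
    -- itself an element over `g i` with labels `r i`. The two sides of associativity are read off
    -- from these data.
    choose g r hr e₁ e₂ using fun i => exists_of_comp (ω i)
    have hq : ∀ i, sort (app (pullback.fst _ _) (ω i)) = cls (f.src i) := fun i =>
      (sort_app _ _).trans (hω i)
    have u : ∀ i, (g i).tgt ⟶ f.src i := fun i =>
      (cls_exact ((sort_eq_of_deg (e₂ i)).symm.trans (hq i))).some.hom
    have ht : ∀ i, sort (tm (g i).hom (r i) (hr i)) = cls (f.src i) := fun i => by
      rw [← e₁, sort_app, hω]
    rw [app_comp, app_comp, app_homMk, app_homMk]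
    refine (D.compFun_eq (f := f.hom) (q := fun i => D.compFun (ω i))
      (hq := fun i => (D.sort_compFun _).trans (hω i)) (app_compLift_fst _ _ _ _) ?_).trans
      (Eq.trans ?_ (D.compFun_eq (p := D.cmp (app (pullback.fst _ _) z) f.hom
        (fun i => app (pullback.fst _ _) (ω i)))
        (f := Q.comp f.hom (fun i => SymMulticat.post (u i) (g i).hom))
        (q := fun k => r k.1 k.2) (hq := fun k => hr k.1 k.2)
        ((app_compLift_fst _ _ _ _).trans ?_) ((app_compLift_snd _ _ _ _).trans ?_)).symm)
    · rw [app_compLift_snd, app_comp, e, app_tm]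
      exact tm_congr fun i => app_homMk _ _ _
    · refine Eq.trans ?_ (D.assoc f.hom (fun i => (g i).hom) u _ _ r hp e₂ hr)
      congr 1
      exact funext fun i => D.compFun_eq rfl (e₁ i)
    · rw [app_comp, app_homMk]
      refine D.compFun_eq (hq := hq) (app_compLift_fst _ _ _ _) ?_
      rw [app_compLift_snd, app_comp, e, app_tm]
    · rw [app_comp, app_comp, e, app_tm, tm_congr (hl' := ht) e₁]
      exact app_mu _ _ _ _ _ _

theorem app_ids (D : F.OperadData A) (e : F.El (⊤_ M.C)) :
    app D.toOperad.ids e = D.one (sort e) :=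
  app_homMk (fun e => D.one (sort e)) (fun _ => D.sort_one _) e

theorem app_comp_toOperad (D : F.OperadData A) (z : F.El (compObj M.T A A)) :
    app D.toOperad.comp z = D.compFun z :=
  app_homMk D.compFun D.sort_compFun z

variable (F) in
open Classical in
/-- The composition of an operad, in terms of elements. -/
noncomputable def opCmp (P : Operad M.T) {ι : Type} [Finite ι] {x : ι → Q.Obj} {y : Q.Obj}
    (p : F.El P.A.left) (f : Q.Hom x y) (q : ι → F.El P.A.left) : F.El P.A.left :=
  -- The default value `p` never matters: the operad laws use the composition only when the degree
  -- of `p` is `f` and the sorts of the `q i` are its sources.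
  if e : (app P.A.hom p = F.arr f) ∧ ∀ i, sort (q i) = cls (x i) then
    app P.comp (exists_comp p f q e.2 e.1).choose else p

/-- An element of a pullback is determined by its two components, so the element chosen in `opCmp`
is `z`. -/
theorem app_operad_comp (P : Operad M.T) {z : F.El (compObj M.T P.A P.A)} {p : F.El P.A.left}
    {f : Q.Hom x y} {q : ι → F.El P.A.left} {hq : ∀ i, sort (q i) = cls (x i)}
    (e : app (pullback.fst _ _) z = p) (e' : app (pullback.snd _ _) z = tm f q hq) :
    app P.comp z = opCmp F P p f q := by
  have hp : app P.A.hom p = F.arr f := by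
    rw [← e, ← app_comp, app_congr pullback.condition, app_comp, e', app_map_terminal]
  have H := (exists_comp p f q hq hp).choose_spec
  rw [opCmp, dif_pos ⟨hp, hq⟩]
  congr 1
  exact comp_ext (e.trans H.1.symm) (e'.trans H.2.symm)

variable (F) in
/-- The data of an operad. -/
noncomputable def ofOperad (P : Operad M.T) : F.OperadData P.A where
  one s := app P.ids (F.star s)
  cmp := opCmp F P
  deg_one a := by
    rw [← app_comp, app_congr P.ids_dom, app_eta _ (sort_star _)]
    rfl
  deg_cmp f g u p q hp hq := by
    have hq' : ∀ i, sort (q i) = cls _ := fun i => (sort_eq_of_deg (hq i)).trans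
      (cls_eq (have := h.isIso (u i); asIso (u i)))
    obtain ⟨z, e₁, e₂⟩ := exists_comp p f q hq' hp
    rw [← app_operad_comp P e₁ e₂, ← app_comp, app_congr P.comp_dom, app_compDom e₂ g hq u]
  cmp_eq p q q' hp hq hq' m hm := by
    obtain ⟨z, e₁, e₂⟩ := exists_comp p _ q hq hp
    obtain ⟨z', e₁', e₂'⟩ := exists_comp p _ q' hq' (hp.trans (arr_eq m))
    rw [← app_operad_comp P e₁ e₂, ← app_operad_comp P e₁' e₂']
    congr 1
    refine comp_ext (e₁.trans e₁'.symm) (e₂.trans (Eq.trans ?_ e₂'.symm))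
    exact tm_eq m hm
  one_cmp a p hp := by
    have H := app_congr (F := F) P.id_left p
    rw [app_comp, app_id, app_operad_comp P (app_compLift_fst _ _ _ _)
      ((app_compLift_snd _ _ _ _).trans (app_eta p hp)), app_comp, app_terminal _ _ hp] at H
    exact H
  cmp_one f p hp := by
    have H := app_congr (F := F) P.id_right p
    rw [app_comp, app_id, app_operad_comp P (app_compLift_fst _ _ _ _)
      ((app_compLift_snd _ _ _ _).trans ((app_comp _ _ _).trans
        ((congrArg _ hp).trans (app_tm _ _ _ _)))), app_id] at H
    exact H
  assoc f g u p q r hp hq hr := by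
    have hq' : ∀ i, sort (q i) = cls _ := fun i => (sort_eq_of_deg (hq i)).trans
      (cls_eq (have := h.isIso (u i); asIso (u i)))
    choose ω e₁ e₂ using fun i => exists_comp (q i) (g i) (r i) (hr i) (hq i)
    have hω : ∀ i, sort (ω i) = cls _ := fun i => by
      rw [← hq' i, ← e₁ i, sort_app]
    -- The data `p`, `q`, `r` are assembled into one element of the threefold composite, at which
    -- the associativity of `P` is evaluated.
    obtain ⟨z, hz₁, hz₂⟩ : ∃ z : F.El (pullback P.A.hom
        (M.T.map (terminal.from (compObj M.T P.A P.A)))),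
        app (pullback.fst _ _) z = p ∧ app (pullback.snd _ _) z = tm f ω hω :=
      exists_isPullback (IsPullback.of_hasPullback _ _) (hp.trans (app_map_terminal _ _ _ _).symm)
    have hs : ∀ i, sort (tm (g i) (r i) (hr i)) = cls _ := fun i => by
      rw [← e₂, sort_app, hω]
    have H := app_congr (F := F) P.assoc z
    rw [app_comp, app_comp] at H
    have hc : ∀ i, app P.comp (ω i) = opCmp F P (q i) (g i) (r i) := fun i =>
      app_operad_comp P (e₁ i) (e₂ i)
    refine Eq.trans ?_ (H.trans ?_)
    · refine (app_operad_comp P (hq := fun i => (hc i).symm ▸ (sort_app _ _).trans (hω i))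
        ((app_compLift_fst _ _ _ _).trans hz₁) ?_).symm
      rw [app_compLift_snd, app_comp, hz₂, app_tm]
      exact tm_congr hc
    · refine app_operad_comp P (hq := fun k => hr k.1 k.2) ((app_compLift_fst _ _ _ _).trans ?_)
        ((app_compLift_snd _ _ _ _).trans ?_)
      · rw [app_comp]
        refine app_operad_comp P (hq := hq') ((app_compLift_fst _ _ _ _).trans hz₁) ?_
        rw [app_compLift_snd, app_comp, hz₂, app_tm]
        exact tm_congr e₁
      · rw [app_comp, app_comp, hz₂, app_tm, tm_congr (hl' := hs) e₂]
        exact app_mu _ _ _ _ _ _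

/-- A morphism of operads from a function on elements. -/
noncomputable def homOfFun (D : F.OperadData A) (P : Operad M.T) (k : F.El A.left → F.El P.A.left)
    (hd : ∀ p, app P.A.hom (k p) = app A.hom p)
    (h₁ : ∀ s, k (D.one s) = (ofOperad F P).one s)
    (h₂ : ∀ {ι : Type} [Finite ι] {x : ι → Q.Obj} {y : Q.Obj} (f : Q.Hom x y) (p : F.El A.left)
      (q : ι → F.El A.left), app A.hom p = F.arr f → (∀ i, sort (q i) = cls (x i)) →
      k (D.cmp p f q) = (ofOperad F P).cmp (k p) f (fun i => k (q i))) :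
    D.toOperad ⟶ P :=
  have hs : ∀ p, sort (k p) = sort p := fun p => by
    rw [← sort_app P.A.hom, hd, sort_app]
  { map := Over.homMk (U := A) (V := P.A) (homMk k hs) (hom_ext (F := F) fun e => by
      rw [app_comp, app_homMk, hd])
    ids := hom_ext (F := F) fun e => by
      refine (app_comp (F := F) D.toOperad.ids (homMk k hs) e).trans
        ((app_homMk k hs _).trans ((congrArg k (D.app_ids e)).trans ((h₁ _).trans ?_)))
      exact congrArg (app P.ids) (eq_star e rfl).symm
    comp := hom_ext (F := F) fun z => by
      obtain ⟨f, q, hq, e₁, e₂⟩ := exists_of_comp (A := A) (B := A) z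
      refine (app_comp (F := F) D.toOperad.comp (homMk k hs) z).trans ((app_homMk k hs _).trans
        ((congrArg k ((D.app_comp_toOperad z).trans (D.compFun_eq rfl e₁))).trans
          ((h₂ f.hom _ q e₂ hq).trans (Eq.trans ?_ (app_comp _ _ _).symm))))
      refine (app_operad_comp P (hq := fun i => (hs _).trans (hq i))
        ((app_compLift_fst _ _ _ _).trans ((app_comp _ _ _).trans (app_homMk k hs _)))
        ((app_compLift_snd _ _ _ _).trans ?_)).symm
      refine (app_comp _ _ _).trans ((congrArg _ e₁).trans ((app_tm _ _ _ _).trans ?_))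
      exact tm_congr fun i => app_homMk k hs _ }

theorem app_homOfFun (D : F.OperadData A) (P : Operad M.T) (k : F.El A.left → F.El P.A.left)
    (hd) (h₁) (h₂) (p : F.El A.left) :
    app (CommaMorphism.left (OperadHom.map (D.homOfFun P k hd h₁ h₂))) p = k p :=
  app_homMk k (fun p => by rw [← sort_app P.A.hom, hd, sort_app]) p

theorem app_hom_one (D : F.OperadData A) (P : Operad M.T) (k : D.toOperad ⟶ P) (s : Q.Cls) :
    app (CommaMorphism.left (OperadHom.map k)) (D.one s) = (ofOperad F P).one s := by
  have := app_congr (F := F) (OperadHom.ids k) (F.star s)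
  rw [app_comp, app_ids, sort_star] at this
  exact this

theorem app_hom_cmp (D : F.OperadData A) (P : Operad M.T) (k : D.toOperad ⟶ P) (f : Q.Hom x y)
    (p : F.El A.left) (q : ι → F.El A.left) (hp : app A.hom p = F.arr f)
    (hq : ∀ i, sort (q i) = cls (x i)) :
    app (CommaMorphism.left (OperadHom.map k)) (D.cmp p f q) = (ofOperad F P).cmp
      (app (CommaMorphism.left (OperadHom.map k)) p) f
      (fun i => app (CommaMorphism.left (OperadHom.map k)) (q i)) := by
  obtain ⟨z, e₁, e₂⟩ := exists_comp p f q hq hp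
  have := app_congr (F := F) (OperadHom.comp k) z
  refine Eq.trans (congrArg (app _) ((D.app_comp_toOperad z).trans
    (D.compFun_eq e₁ e₂)).symm) (((app_comp (F := F) D.toOperad.comp _ z).symm.trans
      (this.trans (app_comp _ _ _))).trans ?_)
  refine (app_operad_comp P (hq := fun i => (sort_app _ _).trans (hq i))
    ((app_compLift_fst _ _ _ _).trans ?_) ((app_compLift_snd _ _ _ _).trans ?_))
  · exact (app_comp _ _ _).trans (congrArg _ e₁)
  · exact (app_comp _ _ _).trans ((congrArg _ e₂).trans (app_tm _ _ _ _))

end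

end MonadPair.IsoData.OperadData

/-! ### Labelled arrows up to isomorphism, and the values of trees. -/

namespace SymMulticat

variable {Q : SymMulticat}

section sim

variable {ι κ μ N N' : Type} [Finite ι] [Finite κ] [Finite μ] {x : ι → Q.Obj} {x' : κ → Q.Obj}
  {x'' : μ → Q.Obj} {y y' y'' : Q.Obj} {f : Q.Hom x y} {f' : Q.Hom x' y'} {f'' : Q.Hom x'' y''}
  {k : ι → N} {k' : κ → N} {k'' : μ → N}

/-- Two arrows with labelled inputs are related by a morphism of `elt(Q)` that respects labels. -/
def Sim (f : Q.Hom x y) (k : ι → N) (f' : Q.Hom x' y') (k' : κ → N) : Prop :=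
  ∃ m : EltHom f f', ∀ i, k' (m.perm i) = k i

theorem Sim.refl (f : Q.Hom x y) (k : ι → N) : Sim f k f k := ⟨EltHom.id f, fun _ => rfl⟩

theorem Sim.symm (h : Q.Tidy) (e : Sim f k f' k') : Sim f' k' f k := by
  obtain ⟨m, hm⟩ := e
  exact ⟨m.inverse h, fun i => ((hm (m.perm.symm i)).symm.trans
    (congrArg k' (m.perm.apply_symm_apply i)))⟩

theorem Sim.trans (e : Sim f k f' k') (e' : Sim f' k' f'' k'') : Sim f k f'' k'' := by
  obtain ⟨m, hm⟩ := e
  obtain ⟨m', hm'⟩ := e'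
  exact ⟨m.comp m', fun i => (hm' _).trans (hm i)⟩

theorem Sim.map (e : Sim f k f' k') (g : N → N') :
    Sim f (fun i => g (k i)) f' (fun i => g (k' i)) := by
  obtain ⟨m, hm⟩ := e
  exact ⟨m, fun i => congrArg g (hm i)⟩

/-- This is rigidity again: the relation comes from an automorphism of `f`. -/
theorem Sim.eq (h : Q.Tidy) {k₁ : ι → N} (e : Sim f k f k₁) : k = k₁ := by
  obtain ⟨m, hm⟩ := e
  exact funext fun i => by rw [← hm, h.perm_self]

theorem sim_post (b : y ⟶ y') (f : Q.Hom x y) (k : ι → N) : Sim f k (post b f) k :=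
  ⟨⟨Equiv.refl _, fun i => 𝟙 (x i), b, (Q.push_refl _).trans (pre_id _)⟩, fun _ => rfl⟩

theorem sim_push (e : ι ≃ κ) {x : κ → Q.Obj} (f : Q.Hom (fun i => x (e i)) y) (k : κ → N) :
    Sim f (fun i => k (e i)) (Q.push e f) k :=
  ⟨⟨e, fun i => 𝟙 (x (e i)), 𝟙 y, congrArg (Q.push e) ((pre_id _).trans (post_id _))⟩,
    fun _ => rfl⟩

theorem sim_reindex (e : ι ≃ κ) (hx : ∀ i, x' (e i) = x i) (f : Q.Hom x y) (k : κ → N) :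
    Sim f (fun i => k (e i)) (reindex e hx f) k := by
  obtain rfl : x = fun i => x' (e i) := (funext hx).symm
  exact sim_push e f k

theorem sim_iota (h : Q.Tidy) {a b a' b' : Q.Obj} (u : a ⟶ b) (u' : a' ⟶ b') (v : a ⟶ a')
    (k k' : Unit → N) (e : k () = k' ()) : Sim (Q.iota u) k (Q.iota u') k' := by
  have := h.isIso v
  have := h.isIso u
  have := h.subsingleton
  refine ⟨⟨Equiv.refl _, fun _ => inv v, inv u ≫ v ≫ u', ?_⟩, fun _ => e.symm⟩
  rw [post_iota]
  refine (Q.push_refl _).trans ((pre_iota _ _).trans (congrArg Q.iota (Subsingleton.elim _ _)))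

/-- The bijection behind `e` is known only to preserve labels, hence `H` is asked for all pairs of
inputs with equal labels. -/
theorem Sim.comp (h : Q.Tidy) {α : ι → Type} {β : κ → Type} [∀ i, Finite (α i)]
    [∀ i, Finite (β i)] {v : ∀ i, α i → Q.Obj} {v' : ∀ k, β k → Q.Obj} {w : ι → Q.Obj}
    {w' : κ → Q.Obj} {g : ∀ i, Q.Hom (v i) (w i)} {g' : ∀ k, Q.Hom (v' k) (w' k)}
    (u : ∀ i, w i ⟶ x i) (u' : ∀ k, w' k ⟶ x' k) {l : ∀ i, α i → N'} {l' : ∀ i, β i → N'}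
    (e : Sim f k f' k') (H : ∀ i i', k i = k' i' → Sim (g i) (l i) (g' i') (l' i')) :
    Sim (Q.comp f (fun i => post (u i) (g i))) (fun p => l p.1 p.2)
      (Q.comp f' (fun i => post (u' i) (g' i))) (fun p => l' p.1 p.2) := by
  obtain ⟨m, hm⟩ := e
  choose n hn using fun i => H i (m.perm i) (hm i).symm
  exact ⟨h.compHom m n u u', fun p => hn p.1 p.2⟩

theorem Sim.comp' (h : Q.Tidy) {α : ι → Type} {β : κ → Type} [∀ i, Finite (α i)]
    [∀ i, Finite (β i)] {v : ∀ i, α i → Q.Obj} {v' : ∀ k, β k → Q.Obj} {w' : κ → Q.Obj}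
    {g : ∀ i, Q.Hom (v i) (x i)} {g' : ∀ k, Q.Hom (v' k) (w' k)}
    (u' : ∀ k, w' k ⟶ x' k) {l : ∀ i, α i → N'} {l' : ∀ i, β i → N'}
    (e : Sim f k f' k') (H : ∀ i i', k i = k' i' → Sim (g i) (l i) (g' i') (l' i')) :
    Sim (Q.comp f g) (fun p => l p.1 p.2)
      (Q.comp f' (fun i => post (u' i) (g' i))) (fun p => l' p.1 p.2) := by
  have := Sim.comp h (fun i => 𝟙 (x i)) u' e H
  simp only [post_id] at this
  exact this

theorem sim_pre {x' : ι → Q.Obj} (a : ∀ i, x' i ⟶ x i) (f : Q.Hom x y) (k : ι → N) :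
    Sim f k (pre a f) k :=
  ⟨⟨Equiv.refl _, a, 𝟙 y, (Q.push_refl _).trans (congrArg (pre a) (post_id f))⟩, fun _ => rfl⟩

end sim

section trees

variable {ι κ L K : Type} {F : ι → Q.Arr} {G : κ → Q.Arr} {X : L → Q.Obj} {Y : K → Q.Obj} {y z : Q.Obj}

theorem Tree.sim_post (T : Tree Q F X y) (b : y ⟶ z) :
    Sim T.eval T.leafLabel (T.post b).eval (T.post b).leafLabel := by
  obtain ⟨E, hE, hv⟩ := T.eval_post b
  rw [hv]
  refine (SymMulticat.sim_post b T.eval T.leafLabel).trans ?_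
  have := sim_reindex (x' := fun l => X ((T.post b).leafLabel l)) E (fun l => congrArg X (hE l))
    (SymMulticat.post b T.eval) (T.post b).leafLabel
  simpa only [hE] using this

theorem Tree.sim_graft (T : Tree Q F X y) (U : ∀ l, Tree Q F Y (X l)) :
    Sim (Q.comp T.eval (fun l => (U (T.leafLabel l)).eval))
      (fun p => (U (T.leafLabel p.1)).leafLabel p.2) (T.graft U).eval (T.graft U).leafLabel := by
  obtain ⟨E, hE, hv⟩ := T.eval_graft U
  rw [hv]
  have := sim_reindex (x' := fun l => Y ((T.graft U).leafLabel l)) E (fun l => congrArg Y (hE l))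
    (Q.comp T.eval (fun l => (U (T.leafLabel l)).eval)) (T.graft U).leafLabel
  simpa only [hE] using this

theorem Tree.sim_mapNode (h : ι → κ) (T : Tree Q (fun i => G (h i)) X y) :
    Sim T.eval T.leafLabel (T.mapNode h).eval (T.mapNode h).leafLabel := by
  obtain ⟨E, hE, _, hv, _⟩ := T.mapNode_spec h
  rw [hv]
  have := sim_reindex (x' := fun l => X ((T.mapNode h).leafLabel l)) E
    (fun l => congrArg X (hE l)) T.eval (T.mapNode h).leafLabel
  simpa only [hE] using this

/-- Lets the value of a grafted tree be computed from arrows that are merely isomorphic to the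
values of its pieces. -/
theorem Sim.graft (h : Q.Tidy) {N : Type} [Finite N] {x : N → Q.Obj} {y' : Q.Obj} {f : Q.Hom x y'}
    {k : N → L} {T : Tree Q F X y} (e : Sim T.eval T.leafLabel f k) (U : ∀ l, Tree Q F Y (X l))
    {α : N → Type} [∀ i, Finite (α i)] {v : ∀ i, α i → Q.Obj} {w : N → Q.Obj}
    {g : ∀ i, Q.Hom (v i) (w i)} (u : ∀ i, w i ⟶ x i) {l : ∀ i, α i → K}
    (H : ∀ i, Sim (U (k i)).eval (U (k i)).leafLabel (g i) (l i)) :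
    Sim (T.graft U).eval (T.graft U).leafLabel (Q.comp f (fun i => post (u i) (g i)))
      (fun p => l p.1 p.2) :=
  ((T.sim_graft U).symm h).trans (Sim.comp' h (l := fun i => (U (T.leafLabel i)).leafLabel) u e
    fun i i' hi => by rw [hi]; exact H i')

/-- Relabelling the leaves. -/
def Tree.relabel (T : Tree Q F X y) (k : L → K) (a : ∀ l, Y (k l) ⟶ X l) : Tree Q F Y y :=
  T.graft fun l => leaf (k l) (a l)

/-- Relabelling grafts a bare edge onto each leaf, which composes the value with object-morphisms at
its inputs. -/
theorem Tree.sim_relabel (h : Q.Tidy) (T : Tree Q F X y) (k : L → K) (a : ∀ l, Y (k l) ⟶ X l) :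
    Sim T.eval (fun l => k (T.leafLabel l)) (T.relabel k a).eval (T.relabel k a).leafLabel := by
  refine Sim.trans ?_ (T.sim_graft fun l => leaf (k l) (a l))
  refine Sim.trans (sim_pre (fun l => a (T.leafLabel l)) T.eval _) ?_
  exact Sim.symm h (sim_push (Q := Q) (⟨fun p : Σ _ : T.Leaf, Unit => p.1, fun i => ⟨i, ()⟩,
    fun _ => rfl, fun _ => rfl⟩ : (Σ _ : T.Leaf, Unit) ≃ T.Leaf)
    (x := fun l => Y (k (T.leafLabel l)))
    (Q.comp T.eval (fun l => Q.iota (a (T.leafLabel l)))) (fun l => k (T.leafLabel l)))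

end trees

/-! Trees without edge labels. -/

/-- Planar trees with labelled nodes and leaves. -/
inductive Sk (ι L : Type) : Type
  | leaf (l : L) : Sk ι L
  | node (i : ι) (n : ℕ) (s : Fin n → Sk ι L) : Sk ι L

namespace Sk

variable {ι κ L K ι' L' : Type}

/-- Changing the labels. -/
def map (p : ι → κ) (q : L → K) : Sk ι L → Sk κ K
  | leaf l => leaf (q l)
  | node i n s => node (p i) n fun j => (s j).map p q

/-- Grafting. -/
def bind (q : L → Sk ι K) : Sk ι L → Sk ι K
  | leaf l => q l
  | node i n s => node i n fun j => (s j).bind q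

/-- The labels of the nodes. -/
def labels : Sk ι L → List ι
  | leaf _ => []
  | node i _ s => i :: (List.ofFn fun j => (s j).labels).flatten

/-- The labels of the leaves. -/
def leaves : Sk ι L → List L
  | leaf l => [l]
  | node _ _ s => (List.ofFn fun j => (s j).leaves).flatten

theorem map_map (p : ι → κ) (q : L → K) (p' : κ → ι') (q' : K → L') (s : Sk ι L) :
    (s.map p q).map p' q' = s.map (fun i => p' (p i)) (fun l => q' (q l)) := by
  induction s <;> simp_all [map]

theorem map_id (s : Sk ι L) : s.map (fun i => i) (fun l => l) = s := by
  induction s <;> simp_all [map]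

theorem bind_bind (q : L → Sk ι K) (q' : K → Sk ι L') (s : Sk ι L) :
    (s.bind q).bind q' = s.bind fun l => (q l).bind q' := by
  induction s <;> simp_all [bind]

theorem map_eq_bind (q : L → K) (s : Sk ι L) : s.map (fun i => i) q = s.bind fun l => leaf (q l) := by
  induction s <;> simp_all [bind, map]

theorem map_bind (p : ι → κ) (r : K → L') (q : L → Sk ι K) (s : Sk ι L) :
    (s.bind q).map p r = (s.map p fun l => l).bind fun l => (q l).map p r := by
  induction s <;> simp_all [bind, map]

theorem labels_map (p : ι → κ) (q : L → K) (s : Sk ι L) : (s.map p q).labels = s.labels.map p := by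
  induction s with
  | leaf l => rfl
  | node i n s ih => simp [map, labels, ih, List.map_flatten, List.map_ofFn, Function.comp_def]

theorem leaves_map (p : ι → κ) (q : L → K) (s : Sk ι L) : (s.map p q).leaves = s.leaves.map q := by
  induction s with
  | leaf l => rfl
  | node i n s ih => simp [map, leaves, ih, List.map_flatten, List.map_ofFn, Function.comp_def]

theorem flatten_ofFn_inj {α : Type} {n : ℕ} {f g : Fin n → List α}
    (hl : ∀ j, (f j).length = (g j).length) (e : (List.ofFn f).flatten = (List.ofFn g).flatten) :
    f = g := by
  refine List.ofFn_injective ((List.eq_iff_flatten_eq).2 ⟨e, ?_⟩)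
  simp only [List.map_ofFn]
  congr 1
  exact funext hl

/-- A planar tree is determined by its shape and its planar lists of labels. The hypothesis `e`
provides equal shapes, hence equal list lengths branch by branch, so the concatenated lists split in
the same way on both sides. -/
theorem ext_lists {s s' : Sk ι L} (p : ι → κ) (q : L → K) (e : s.map p q = s'.map p q)
    (h₁ : s.labels = s'.labels) (h₂ : s.leaves = s'.leaves) : s = s' := by
  induction s generalizing s' with
  | leaf l =>
    cases s' with
    | leaf l' => simpa [leaves] using h₂
    | node i n s => simp [map] at e
  | node i n s ih =>
    cases s' with
    | leaf l' => simp [map] at e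
    | node i' n' s' =>
      simp only [map, node.injEq] at e
      obtain ⟨_, rfl, e⟩ := e
      have e' := fun j => congrFun (eq_of_heq e) j
      simp only [labels, List.cons.injEq] at h₁
      obtain ⟨rfl, h₁⟩ := h₁
      have h₁' := flatten_ofFn_inj (fun j => by
        have := congrArg (fun t => t.labels.length) (e' j)
        simpa only [labels_map, List.length_map] using this) h₁
      have h₂' := flatten_ofFn_inj (fun j => by
        have := congrArg (fun t => t.leaves.length) (e' j)
        simpa only [leaves_map, List.length_map] using this) h₂
      congr 1
      exact funext fun j => ih j (e' j) (congrFun h₁' j) (congrFun h₂' j)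

end Sk

/-- The bijection matches the entries of the two lists by position. -/
theorem exists_equiv_of_nodup {ι κ A : Type} {l : List ι} {l' : List κ} (h : l.Nodup)
    (h' : l'.Nodup) (c : ∀ i, i ∈ l) (c' : ∀ i, i ∈ l') {a : ι → A} {a' : κ → A}
    (e : l.map a = l'.map a') : ∃ p : ι ≃ κ, l.map p = l' ∧ ∀ i, a' (p i) = a i := by
  classical
  have hl : l.length = l'.length := by simpa using congrArg List.length e
  let p : ι ≃ κ := (h.getEquivOfForallMemList l c).symm.trans
    ((finCongr hl).trans (h'.getEquivOfForallMemList l' c'))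
  have hp : ∀ (n : ℕ) (hn : n < l.length), p l[n] = l'[n]'(hl ▸ hn) := fun n hn => by
    have : (h.getEquivOfForallMemList l c).symm l[n] = ⟨n, hn⟩ := by
      rw [Equiv.symm_apply_eq]; rfl
    simp only [p, Equiv.trans_apply, this]
    rfl
  refine ⟨p, List.ext_getElem (by simpa using hl) fun n h₁ h₂ => ?_, fun i => ?_⟩
  · rw [List.getElem_map]
    exact hp n _
  · obtain ⟨n, hn, rfl⟩ := List.getElem_of_mem (c i)
    rw [hp n hn]
    have := List.getElem_of_eq e (i := n) (by simpa using hn)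
    simpa using this.symm

/-- Bijectively labelled trees that agree after relabelling differ by bijections of the labels. -/
theorem Sk.exists_equiv {ι κ L K A B : Type} {s : Sk ι L} {s' : Sk κ K} (h₁ : s.labels.Nodup)
    (h₁' : s'.labels.Nodup) (c₁ : ∀ i, i ∈ s.labels) (c₁' : ∀ i, i ∈ s'.labels)
    (h₂ : s.leaves.Nodup) (h₂' : s'.leaves.Nodup) (c₂ : ∀ i, i ∈ s.leaves)
    (c₂' : ∀ i, i ∈ s'.leaves) {a : ι → A} {a' : κ → A} {b : L → B} {b' : K → B}
    (e : s.map a b = s'.map a' b') :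
    ∃ (p : ι ≃ κ) (q : L ≃ K), s.map p q = s' ∧ (∀ i, a' (p i) = a i) ∧ ∀ l, b' (q l) = b l := by
  obtain ⟨p, hp, hp'⟩ := exists_equiv_of_nodup h₁ h₁' c₁ c₁' (a := a) (a' := a') (by
    rw [← labels_map (q := b), ← labels_map (q := b'), e])
  obtain ⟨q, hq, hq'⟩ := exists_equiv_of_nodup h₂ h₂' c₂ c₂' (a := b) (a' := b') (by
    rw [← leaves_map (p := a), ← leaves_map (p := a'), e])
  refine ⟨p, q, ?_, hp', hq'⟩
  refine ext_lists a' b' ?_ ((labels_map _ _ _).trans hp) ((leaves_map _ _ _).trans hq)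
  rw [map_map, ← e]
  simp only [hp', hq']

end SymMulticat

/-! ### Skeletons of trees, and lifting trees along isomorphisms of their values. -/

namespace SymMulticat

variable {Q : SymMulticat}

section sim

variable {ι κ N N' : Type} [Finite ι] [Finite κ] {x : ι → Q.Obj} {x' : κ → Q.Obj}
  {y y' z z' : Q.Obj} {f : Q.Hom x y} {f' : Q.Hom x' y'} {k : ι → N} {k' : κ → N}

theorem Sim.post (h : Q.Tidy) (e : Sim f k f' k') (b : y ⟶ z) (b' : y' ⟶ z') :
    Sim (post b f) k (post b' f') k' :=
  ((sim_post b f k).symm h).trans (e.trans (sim_post b' f' k'))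

theorem Sim.comp_congr (h : Q.Tidy) {α β : ι → Type} [∀ i, Finite (α i)] [∀ i, Finite (β i)]
    {v : ∀ i, α i → Q.Obj} {v' : ∀ i, β i → Q.Obj} {g : ∀ i, Q.Hom (v i) (x i)}
    {g' : ∀ i, Q.Hom (v' i) (x i)} {l : ∀ i, α i → N'} {l' : ∀ i, β i → N'}
    (H : ∀ i, Sim (g i) (l i) (g' i) (l' i)) :
    Sim (Q.comp f g) (fun p => l p.1 p.2) (Q.comp f g') (fun p => l' p.1 p.2) := by
  have := Sim.comp' h (l := l) (l' := l') (fun i => 𝟙 (x i)) (Sim.refl f id)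
    (fun i i' (e : i = i') => by subst e; exact H i)
  simp only [post_id] at this
  exact this

/-- The labels force the bijection of the relation to be `e`, and the object-morphisms are
irrelevant because hom-sets have at most one element. -/
theorem Sim.push_eq (h : Q.Tidy) {x : κ → Q.Obj} {e : ι ≃ κ} {f : Q.Hom (fun i => x (e i)) y}
    {g : Q.Hom x y} (s : Sim f e g id) : Q.push e f = g := by
  obtain ⟨m, hm⟩ := s
  refine Eq.trans ?_ m.eq
  refine Eq.trans ?_ (h.act_congr (p := e) (fun i => (hm i).symm) (fun i => 𝟙 _) _ (𝟙 y) _ f)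
  rw [post_id, pre_id (x := fun i => x (e i))]

theorem Sim.bijective {k : ι → κ} (s : Sim f k f' id) : k.Bijective := by
  obtain ⟨m, hm⟩ := s
  obtain rfl : m.perm = k := funext hm
  exact m.perm.bijective

end sim

theorem Config.sim {ι : Type} {F : ι → Q.Arr} {f : Q.Arr} (T : Config F f) :
    Sim T.tree.eval T.tree.leafLabel f.hom id := by
  have := sim_push (Equiv.ofBijective _ T.leaf_bij) T.tree.eval id
  rw [T.eval_eq] at this
  exact this

namespace Tree

variable {ι κ L K : Type} {F : ι → Q.Arr} {G : κ → Q.Arr} {X : L → Q.Obj} {Y : K → Q.Obj}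
  {y z : Q.Obj}

/-- The underlying tree without edge labels. -/
def sk {y : Q.Obj} : Tree Q F X y → Sk ι L
  | leaf l _ => .leaf l
  | node i _ s => .node i _ fun j => (s j).sk

theorem sk_post (T : Tree Q F X y) (b : y ⟶ z) : (T.post b).sk = T.sk := by
  cases T <;> rfl

theorem sk_graft (T : Tree Q F X y) (U : ∀ l, Tree Q F Y (X l)) :
    (T.graft U).sk = T.sk.bind fun l => (U l).sk := by
  induction T with
  | leaf l a => exact sk_post _ _
  | node i a s ih => simp [graft, sk, Sk.bind, ih]

theorem sk_mapNode (h : ι → κ) (T : Tree Q (fun i => G (h i)) X y) :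
    (T.mapNode h).sk = T.sk.map h fun l => l := by
  induction T with
  | leaf l a => rfl
  | node i a s ih => simp [mapNode, sk, Sk.map, ih]

theorem sk_relabel (T : Tree Q F X y) (k : L → K) (a : ∀ l, Y (k l) ⟶ X l) :
    (T.relabel k a).sk = T.sk.map (fun i => i) k :=
  (sk_graft _ _).trans (Sk.map_eq_bind _ _).symm

/-- Edge labels live in hom-sets with at most one element, so equality of trees can be tested after
forgetting them. All later identifications of trees go through this. -/
theorem sk_injective (h : Q.Tidy) : Function.Injective (sk : Tree Q F X y → Sk ι L) := by
  intro T T' e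
  have hs := h.subsingleton
  induction T with
  | leaf l a =>
    cases T' with
    | leaf l' a' =>
      obtain rfl : l = l' := by simpa [sk] using e
      rw [Subsingleton.elim a a']
    | node i a s => simp [sk] at e
  | node i a s ih =>
    cases T' with
    | leaf l' a' => simp [sk] at e
    | node i' a' s' =>
      simp only [sk, Sk.node.injEq] at e
      obtain ⟨rfl, _, e⟩ := e
      rw [Subsingleton.elim a a']
      congr 1
      exact funext fun j => ih j (congrFun (eq_of_heq e) j)

/-- The root node. -/
def rootNode (i : ι) (a : (F i).tgt ⟶ y) (s : ∀ j, Tree Q F X ((F i).src j)) : (node i a s).Node :=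
  Sum.inl ()

/-- A node of a branch. -/
def branchNode (i : ι) (a : (F i).tgt ⟶ y) (s : ∀ j, Tree Q F X ((F i).src j)) (j : Fin (F i).n)
    (n : (s j).Node) : (node i a s).Node := Sum.inr ⟨j, n⟩

/-- A leaf of a branch. -/
def branchLeaf (i : ι) (a : (F i).tgt ⟶ y) (s : ∀ j, Tree Q F X ((F i).src j)) (j : Fin (F i).n)
    (l : (s j).Leaf) : (node i a s).Leaf := (⟨j, l⟩ : Σ j, (s j).Leaf)

/-- The list of nodes, in planar order. -/
def nodes {y : Q.Obj} : (T : Tree Q F X y) → List T.Node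
  | leaf _ _ => []
  | node i a s => rootNode i a s :: (List.ofFn fun j => (nodes (s j)).map (branchNode i a s j)).flatten

/-- The list of leaves, in planar order. -/
def leafList {y : Q.Obj} : (T : Tree Q F X y) → List T.Leaf
  | leaf _ _ => [()]
  | node i a s => (List.ofFn fun j => (leafList (s j)).map (branchLeaf i a s j)).flatten

theorem ofFn_flatten_sigma {n : ℕ} {A : Fin n → Type} (l : ∀ j, List (A j)) :
    (List.ofFn fun j => (l j).map (Sigma.mk j)).flatten = (List.finRange n).sigma l := by
  rw [List.ofFn_eq_map]; rfl

theorem branchNodes_eq (i : ι) (a : (F i).tgt ⟶ y) (s : ∀ j, Tree Q F X ((F i).src j)) :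
    (List.ofFn fun j => (nodes (s j)).map (branchNode i a s j)).flatten =
      ((List.finRange _).sigma fun j => (s j).nodes).map (Sum.inr : _ → Unit ⊕ Σ j, (s j).Node) := by
  rw [← ofFn_flatten_sigma, List.map_flatten, List.map_ofFn]
  congr 2
  funext j
  exact List.map_map.symm

theorem nodup_nodes (T : Tree Q F X y) : T.nodes.Nodup ∧ ∀ N, N ∈ T.nodes := by
  induction T with
  | leaf l a => exact ⟨List.nodup_nil, fun N => Empty.elim N⟩
  | node i a s ih =>
    unfold nodes
    rw [branchNodes_eq]
    constructor
    · refine List.nodup_cons.2 ⟨fun e => ?_, List.Nodup.map Sum.inr_injective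
        ((List.nodup_finRange _).sigma fun j => (ih j).1)⟩
      obtain ⟨_, _, e⟩ := List.mem_map.1 e
      exact Sum.inr_ne_inl e
    · rintro (_ | ⟨j, N⟩)
      · exact List.mem_cons_self
      · exact List.mem_cons_of_mem _ (List.mem_map_of_mem
          (List.mem_sigma.2 ⟨List.mem_finRange _, (ih j).2 N⟩))

theorem nodup_leafList (T : Tree Q F X y) : T.leafList.Nodup ∧ ∀ l, l ∈ T.leafList := by
  induction T with
  | leaf l a => exact ⟨List.nodup_singleton _, fun l => List.mem_singleton.2 rfl⟩
  | node i a s ih =>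
    have e : leafList (node i a s) = (List.finRange _).sigma fun j => (s j).leafList :=
      ofFn_flatten_sigma _
    rw [e]
    exact ⟨(List.nodup_finRange _).sigma fun j => (ih j).1,
      fun ⟨j, l⟩ => List.mem_sigma.2 ⟨List.mem_finRange _, (ih j).2 l⟩⟩

theorem labels_sk (T : Tree Q F X y) : T.sk.labels = T.nodes.map T.nodeLabel := by
  induction T with
  | leaf l a => rfl
  | node i a s ih =>
    simp only [sk, Sk.labels, nodes, List.map_cons, List.map_flatten, List.map_ofFn, ih]
    congr 3
    exact funext fun j => (List.map_map (g := (node i a s).nodeLabel) (f := branchNode i a s j) (l := (s j).nodes)).symm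

theorem leaves_sk (T : Tree Q F X y) : T.sk.leaves = T.leafList.map T.leafLabel := by
  induction T with
  | leaf l a => rfl
  | node i a s ih =>
    simp only [sk, Sk.leaves, leafList, List.map_flatten, List.map_ofFn, ih]
    congr 2
    exact funext fun j => (List.map_map (g := (node i a s).leafLabel) (f := branchLeaf i a s j) (l := (s j).leafList)).symm

theorem _root_.List.Nodup.bijective_iff {A B : Type*} {l : List A} (hl : l.Nodup)
    (hc : ∀ a, a ∈ l) (g : A → B) :
    g.Bijective ↔ (l.map g).Nodup ∧ ∀ b, b ∈ l.map g := by
  constructor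
  · intro hg
    refine ⟨hl.map hg.1, fun b => ?_⟩
    obtain ⟨a, rfl⟩ := hg.2 b
    exact List.mem_map_of_mem (hc a)
  · rintro ⟨h₁, h₂⟩
    refine ⟨fun a b e => List.inj_on_of_nodup_map h₁ (hc a) (hc b) e, fun b => ?_⟩
    obtain ⟨a, -, rfl⟩ := List.mem_map.1 (h₂ b)
    exact ⟨a, rfl⟩

/-- Expresses a condition in the definition of a configuration through the skeleton, where the
effect of relabelling is easy to compute. -/
theorem nodeLabel_bijective_iff (T : Tree Q F X y) :
    T.nodeLabel.Bijective ↔ T.sk.labels.Nodup ∧ ∀ i, i ∈ T.sk.labels := by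
  rw [labels_sk]
  exact T.nodup_nodes.1.bijective_iff T.nodup_nodes.2 _

theorem leafLabel_bijective_iff (T : Tree Q F X y) :
    T.leafLabel.Bijective ↔ T.sk.leaves.Nodup ∧ ∀ i, i ∈ T.sk.leaves := by
  rw [leaves_sk]
  exact T.nodup_leafList.1.bijective_iff T.nodup_leafList.2 _

/-- Every tree is obtained by relabelling from a tree whose nodes and leaves are labelled by
themselves. -/
theorem exists_can (h : Q.Tidy) (T : Tree Q F X y) :
    ∃ C : Tree Q (fun n : T.Node => F (T.nodeLabel n)) (fun l : T.Leaf => X (T.leafLabel l)) y,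
      C.sk.labels = T.nodes ∧ C.sk.leaves = T.leafList ∧ Sim C.eval C.leafLabel T.eval id ∧
      C.sk.map T.nodeLabel T.leafLabel = T.sk := by
  induction T with
  | leaf l a => exact ⟨leaf () a, rfl, rfl, Sim.refl _ _, rfl⟩
  | node i a s ih =>
    choose C h₁ h₂ h₃ h₄ using ih
    let F' := fun n : (node i a s).Node => F ((node i a s).nodeLabel n)
    let X' := fun l : (node i a s).Leaf => X ((node i a s).leafLabel l)
    -- The same trees as `C`, typed so that their labels factor through the inclusions of the nodes
    -- and leaves of a branch into those of the whole tree.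
    let C' : ∀ j, Tree Q (fun n => F' (branchNode i a s j n)) (fun l => X' (branchLeaf i a s j l))
      ((F i).src j) := C
    have h₃ : ∀ j, Sim (C' j).eval (C' j).leafLabel (s j).eval id := h₃
    let D : ∀ j, Tree Q F' X' ((F i).src j) := fun j =>
      (mapNode (G := F') (branchNode i a s j) (C' j)).relabel (branchLeaf i a s j)
        (fun l => 𝟙 (X ((s j).leafLabel l)))
    have hD : ∀ j, (D j).sk = (C j).sk.map (branchNode i a s j) (branchLeaf i a s j) := fun j =>
      (sk_relabel _ _ _).trans ((congrArg _ (sk_mapNode (G := F') _ _)).trans (Sk.map_map _ _ _ _ _))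
    have hs : ∀ j, Sim (D j).eval (D j).leafLabel (s j).eval (branchLeaf i a s j) := fun j =>
      ((sim_relabel h _ _ _).symm h).trans ((((sim_mapNode (G := F') (branchNode i a s j)
        (C' j)).symm h).trans (h₃ j)).map (branchLeaf i a s j))
    have l₁ : ∀ j, (D j).sk.labels = (s j).nodes.map (branchNode i a s j) := fun j => by
      rw [hD, Sk.labels_map, h₁]
    have l₂ : ∀ j, (D j).sk.leaves = (s j).leafList.map (branchLeaf i a s j) := fun j => by
      rw [hD, Sk.leaves_map, h₂]
    have l₃ : ∀ j, (D j).sk.map (node i a s).nodeLabel (node i a s).leafLabel = (s j).sk :=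
      fun j => (congrArg _ (hD j)).trans ((Sk.map_map _ _ _ _ _).trans (h₄ j))
    refine ⟨node (F := F') (rootNode i a s) a D, ?_, ?_, ?_, ?_⟩
    · exact congrArg (fun t => rootNode i a s :: (List.ofFn t).flatten) (funext l₁)
    · exact congrArg (fun t => (List.ofFn t).flatten) (funext l₂)
    · exact Sim.post h (Sim.comp_congr h (l := fun j => (D j).leafLabel)
        (l' := fun j => branchLeaf i a s j) hs) a a
    · exact congrArg (Sk.node i _) (funext l₃)

/-- A tree whose value is related to `f` can be relabelled so that its leaves are the inputs of
`f`. -/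
theorem exists_lift (h : Q.Tidy) {N : Type} [Finite N] {x : N → Q.Obj} {f : Q.Hom x z}
    (T : Tree Q F X y) (m : EltHom T.eval f) :
    ∃ P : Tree Q F x z, Sim P.eval P.leafLabel f id ∧
      ∀ {B : Type} (g : N → B) (g' : L → B), (∀ l, g (m.perm l) = g' (T.leafLabel l)) →
        P.sk.map (fun i => i) g = T.sk.map (fun i => i) g' := by
  -- Leaf labels of `T` may repeat, so they cannot be replaced directly by inputs of `f`. In the
  -- canonical tree each leaf is its own label, and `m.perm` relabels it.
  obtain ⟨C, -, -, hC, hk⟩ := T.exists_can h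
  refine ⟨((C.mapNode (G := F) T.nodeLabel).relabel m.perm m.inp).post m.out, ?_, ?_⟩
  · refine ((Tree.sim_post _ _).symm h).trans (((sim_relabel h _ _ _).symm h).trans ?_)
    refine ((((sim_mapNode (G := F) T.nodeLabel C).symm h).trans hC).map m.perm).trans ?_
    exact ⟨m, fun _ => rfl⟩
  · intro B g g' e
    rw [sk_post, sk_relabel, sk_mapNode, Sk.map_map, Sk.map_map, ← hk, Sk.map_map]
    simp only [e]

/-- Trees that agree up to edge labels and isomorphic leaf labels have related values. -/
theorem exists_sim (h : Q.Tidy) {T : Tree Q F X y} {T' : Tree Q F Y z} (a : y ⟶ z)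
    (e : T.sk.map (fun i => i) (fun l => cls (X l)) = T'.sk.map (fun i => i) (fun l => cls (Y l))) :
    ∃ q : T.Leaf ≃ T'.Leaf, Sim T.eval q T'.eval id ∧
      ∀ {B : Type} (g : L → B) (g' : K → B), (∀ l, g' (T'.leafLabel (q l)) = g (T.leafLabel l)) →
        T.sk.map (fun i => i) g = T'.sk.map (fun i => i) g' := by
  obtain ⟨C, h₁, h₂, hC, hk⟩ := T.exists_can h
  obtain ⟨C', h₁', h₂', hC', hk'⟩ := T'.exists_can h
  rw [← hk, ← hk', Sk.map_map, Sk.map_map] at e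
  have n := T.nodup_nodes
  have n' := T'.nodup_nodes
  have m := T.nodup_leafList
  have m' := T'.nodup_leafList
  rw [← h₁] at n
  rw [← h₁'] at n'
  rw [← h₂] at m
  rw [← h₂'] at m'
  obtain ⟨p, q, hpq, hp, hq⟩ := Sk.exists_equiv n.1 n'.1 n.2 n'.2 m.1 m'.1 m.2 m'.2 e
  refine ⟨q, ?_, ?_⟩
  · have hF : (fun n : T.Node => F (T.nodeLabel n)) = fun n => F (T'.nodeLabel (p n)) :=
      funext fun n => congrArg F (hp n).symm
    -- The families of arrows on the nodes of the two trees agree along `p` only propositionally;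
    -- generalizing one of them allows the equality to be eliminated.
    have key : ∀ (F' : T.Node → Q.Arr) (hF : F' = fun n => F (T'.nodeLabel (p n)))
        (D : Tree Q F' (fun l : T.Leaf => X (T.leafLabel l)) y) (hD : D.sk.map p q = C'.sk),
        Sim D.eval (fun l => q (D.leafLabel l)) C'.eval C'.leafLabel := by
      rintro _ rfl D hD
      let D' := ((D.mapNode (G := fun n => F (T'.nodeLabel n)) p).relabel
        (Y := fun l => Y (T'.leafLabel l)) q fun l => (cls_exact (hq l)).some.hom).post a
      -- Relabelling the first canonical tree along `p` and `q` gives the skeleton of the second,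
      -- hence the second tree itself.
      obtain rfl : D' = C' := sk_injective h (by
        rw [sk_post, sk_relabel, sk_mapNode, Sk.map_map]; exact hD)
      exact ((sim_mapNode (G := fun n => F (T'.nodeLabel n)) p D).map q).trans
        ((sim_relabel h _ _ _).trans (Tree.sim_post _ _))
    exact ((hC.map q).symm h).trans ((key _ hF C hpq).trans hC')
  · intro B g g' e
    rw [← hk, ← hk', ← hpq, Sk.map_map, Sk.map_map, Sk.map_map]
    simp only [hp, e]

/-- The two trees have a matching of leaves compatible with their values. Since both have `f` as
value with its inputs as leaves, a mismatch of leaf labels would give a nontrivial automorphism.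
This makes the composition of the free operad well defined. -/
theorem lift_unique (h : Q.Tidy) {N : Type} [Finite N] {x : N → Q.Obj} {f : Q.Hom x y}
    {P P' : Tree Q F x y} (s : Sim P.eval P.leafLabel f id) (s' : Sim P'.eval P'.leafLabel f id)
    (e : P.sk.map (fun i => i) (fun l => cls (x l)) = P'.sk.map (fun i => i) (fun l => cls (x l))) :
    P = P' := by
  obtain ⟨q, hq, hk⟩ := exists_sim h (𝟙 y) e
  refine sk_injective h ?_
  have := hk (fun l => l) (fun l => l) fun l => congrFun (Sim.eq h (f := P.eval)
    (k := fun l => P'.leafLabel (q l))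
    ((hq.map P'.leafLabel).trans (s'.trans (s.symm h)))) l
  rwa [Sk.map_id, Sk.map_id] at this

end Tree

end SymMulticat

/-! ### Values of trees and configurations in an operad. -/

namespace MonadPair.IsoData

open SymMulticat

variable {M : MonadPair} {Q : SymMulticat} {h : Q.Tidy} {F : M.IsoData (Q.zeta h)}

theorem arr_eq_of_sim {ι κ N : Type} [Finite ι] [Finite κ] {x : ι → Q.Obj} {x' : κ → Q.Obj}
    {y y' : Q.Obj} {f : Q.Hom x y} {f' : Q.Hom x' y'} {k : ι → N} {k' : κ → N}
    (s : Sim f k f' k') : F.arr f = F.arr f' := by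
  obtain ⟨m, _⟩ := s
  exact arr_eq m

end MonadPair.IsoData

namespace MonadPair.IsoData.OperadData

open SymMulticat

variable {M : MonadPair} {Q : SymMulticat} {h : Q.Tidy} {F : M.IsoData (Q.zeta h)}
variable {A B : Over (M.T.obj (⊤_ M.C))} (D : F.OperadData A) (E : F.OperadData B)

theorem cmp_sim {ι κ N : Type} [Finite ι] [Finite κ] {x : ι → Q.Obj} {x' : κ → Q.Obj}
    {y y' : Q.Obj} {f : Q.Hom x y} {f' : Q.Hom x' y'} {k : ι → N} {k' : κ → N}
    (s : Sim f k f' k') {p : F.El A.left} (hp : app A.hom p = F.arr f) (q : N → F.El A.left)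
    (hq : ∀ i, sort (q (k i)) = cls (x i)) :
    D.cmp p f (fun i => q (k i)) = D.cmp p f' (fun i => q (k' i)) := by
  obtain ⟨m, hm⟩ := s
  refine D.cmp_eq p _ _ hp hq (fun i => ?_) m fun i => congrArg q (hm i)
  obtain ⟨i, rfl⟩ := m.perm.surjective i
  rw [hm, hq]
  exact (cls_eq (have := h.isIso (m.inp i); asIso (m.inp i))).symm

variable {ι κ L K : Type} {G : ι → Q.Arr} {H : κ → Q.Arr} {X : L → Q.Obj} {Y : K → Q.Obj}
  {y z : Q.Obj} {p : ι → F.El A.left} {r : κ → F.El A.left}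

/-- The value of a tree whose nodes are labelled by elements of an operad. -/
def ev (p : ι → F.El A.left) {y : Q.Obj} : Tree Q G X y → F.El A.left
  | .leaf l _ => D.one (cls (X l))
  | .node i _ s => D.cmp (p i) (G i).hom fun j => ev p (s j)

theorem ev_post (T : Tree Q G X y) (b : y ⟶ z) : D.ev p (T.post b) = D.ev p T := by
  cases T <;> rfl

/-- Evaluation ignores edge labels and sees the leaf objects only through their classes. -/
theorem ev_congr (T : Tree Q G X y) (T' : Tree Q G Y z)
    (e : T.sk.map (fun i => i) (fun l => cls (X l)) = T'.sk.map (fun i => i) (fun l => cls (Y l))) :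
    D.ev p T = D.ev p T' := by
  induction T generalizing z with
  | leaf l a =>
    cases T' with
    | leaf l' a' =>
      simp only [Tree.sk, Sk.map, Sk.leaf.injEq] at e
      simp only [ev, e]
    | node i a s => simp [Tree.sk, Sk.map] at e
  | node i a s ih =>
    cases T' with
    | leaf l' a' => simp [Tree.sk, Sk.map] at e
    | node i' a' s' =>
      simp only [Tree.sk, Sk.map, Sk.node.injEq] at e
      obtain ⟨rfl, _, e⟩ := e
      exact congrArg (D.cmp (p i) (G i).hom)
        (funext fun j => ih j (s' j) (congrFun (eq_of_heq e) j))

theorem ev_mapNode (k : ι → κ) (T : Tree Q (fun i => H (k i)) X y) :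
    D.ev r (T.mapNode k) = D.ev (fun i => r (k i)) T := by
  induction T with
  | leaf l a => rfl
  | node i a s ih => exact congrArg (D.cmp (r (k i)) (H (k i)).hom) (funext ih)

section

variable (hp : ∀ i, app A.hom (p i) = F.arr (G i).hom) (hr : ∀ i, app A.hom (r i) = F.arr (H i).hom)

include hp

theorem deg_ev (T : Tree Q G X y) : app A.hom (D.ev p T) = F.arr T.eval := by
  induction T with
  | leaf l a => exact (D.deg_one _).trans (arr_eq_of_sim (sim_iota h _ a (𝟙 _) id id rfl))
  | node i a s ih =>
    refine (D.deg_cmp (G i).hom (fun j => (s j).eval) (fun j => 𝟙 _) _ _ (hp i) ih).trans ?_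
    simp only [post_id]
    exact arr_eq_of_sim (sim_post a _ id)

theorem sort_ev (T : Tree Q G X y) : sort (D.ev p T) = cls y := sort_eq_of_deg (D.deg_ev hp T)

/-- By induction on the tree: a leaf is the left unit law of the operad and a node is its
associativity. -/
theorem ev_graft (T : Tree Q G X y) (U : ∀ l, Tree Q G Y (X l)) :
    D.ev p (T.graft U) = D.cmp (D.ev p T) T.eval (fun l => D.ev p (U (T.leafLabel l))) := by
  induction T with
  | leaf l a =>
    refine (D.ev_post (U l) a).trans ((D.one_cmp _ _ (D.sort_ev hp (U l))).symm.trans ?_)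
    exact D.cmp_sim (sim_iota h (𝟙 (X l)) a (𝟙 _) id id rfl) (D.deg_one _)
      (fun _ => D.ev p (U l)) fun _ => D.sort_ev hp (U l)
  | node i a s ih =>
    refine (congrArg (D.cmp (p i) (G i).hom) (funext ih)).trans ((D.assoc (G i).hom
      (fun j => (s j).eval) (fun j => 𝟙 _) (p i) _ (fun j l => D.ev p (U ((s j).leafLabel l)))
      (hp i) (fun j => D.deg_ev hp (s j)) (fun j l => D.sort_ev hp _)).trans ?_)
    have := D.deg_cmp (G i).hom (fun j => (s j).eval) (fun j => 𝟙 _) _ _ (hp i)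
      (fun j => D.deg_ev hp (s j))
    simp only [post_id] at this ⊢
    exact D.cmp_sim (sim_post a _ id) this
      (fun l : Σ j, (s j).Leaf => D.ev p (U ((s l.1).leafLabel l.2))) (fun l => D.sort_ev hp _)

theorem ev_graft_of_sim {N : Type} [Finite N] {x : N → Q.Obj} {f : Q.Hom x z} (T : Tree Q G x y)
    (s : Sim T.eval T.leafLabel f id) (U : ∀ l, Tree Q G Y (x l)) :
    D.ev p (T.graft U) = D.cmp (D.ev p T) f (fun l => D.ev p (U l)) :=
  (D.ev_graft hp T U).trans (D.cmp_sim s (D.deg_ev hp T) (fun l => D.ev p (U l))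
    fun _ => D.sort_ev hp _)

omit hp in
include hr in
-- At a node, substitution grafts the substituted branches onto `S i`, whose value is the arrow of
-- the node. Hence `ev_graft_of_sim` gives a composition at that same arrow.
theorem ev_subst (T : Tree Q G X y) (S : ∀ i, Tree Q H (G i).src (G i).tgt)
    (hS : ∀ i, Sim (S i).eval (S i).leafLabel (G i).hom id) :
    D.ev r (T.subst S) = D.ev (fun i => D.ev r (S i)) T := by
  induction T with
  | leaf l a => rfl
  | node i a s ih =>
    refine (D.ev_post _ a).trans ((D.ev_graft_of_sim hr (S i) (hS i) _).trans ?_)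
    exact congrArg (D.cmp _ (G i).hom) (funext ih)

/-- Evaluation uses only identities and composition, so every map preserving these preserves it.
Uniqueness in the universal property rests on this. -/
theorem map_ev (k : F.El A.left → F.El B.left) (h₁ : ∀ s, k (D.one s) = E.one s)
    (h₂ : ∀ {ι : Type} [Finite ι] {x : ι → Q.Obj} {y : Q.Obj} (f : Q.Hom x y) (p : F.El A.left)
      (q : ι → F.El A.left), app A.hom p = F.arr f → (∀ i, sort (q i) = cls (x i)) →
      k (D.cmp p f q) = E.cmp (k p) f (fun i => k (q i))) (T : Tree Q G X y) :
    k (D.ev p T) = E.ev (fun i => k (p i)) T := by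
  induction T with
  | leaf l a => exact h₁ _
  | node i a s ih =>
    exact (h₂ _ _ _ (hp i) fun j => D.sort_ev hp (s j)).trans
      (congrArg (E.cmp (k (p i)) (G i).hom) (funext ih))

end

/-! The value of a configuration. -/

theorem ev_config_single {g g' : Q.Arr} (a : g ⟶ g') (p : F.El A.left)
    (hp : app A.hom p = F.arr g.hom) : D.ev (fun _ => p) (Config.single a).tree = p := by
  refine (congrArg (D.cmp p g.hom) (funext fun j => ?_)).trans (D.cmp_one g.hom p hp)
  exact congrArg D.one (cls_eq (have := h.isIso (EltHom.inp a j); asIso (EltHom.inp a j)))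

/-- Composition in the slice is substitution of trees, so configurations act on the elements of any
operad. This will become the compatibility with multiplications. -/
theorem ev_config_comp {κ : ι → Type} {f : Q.Arr} {H : ∀ i, κ i → Q.Arr} (T : Config G f)
    (S : ∀ i, Config (H i) (G i)) (r : ∀ i, κ i → F.El A.left)
    (hr : ∀ i k, app A.hom (r i k) = F.arr (H i k).hom) :
    D.ev (fun q => r q.1 q.2) (T.comp S).tree = D.ev (fun i => D.ev (r i) (S i).tree) T.tree := by
  refine (D.ev_subst (H := fun q : Σ i, κ i => H q.1 q.2) (fun q => hr q.1 q.2) T.tree _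
    fun i => ?_).trans ?_
  · exact ((Tree.sim_mapNode (G := fun q : Σ i, κ i => H q.1 q.2) (Sigma.mk i)
      (S i).tree).symm h).trans (S i).sim
  · congr 1
    funext i
    exact D.ev_mapNode (H := fun q : Σ i, κ i => H q.1 q.2) (Sigma.mk i) (S i).tree

theorem ev_config_push {k : ι ≃ κ} {f : Q.Arr} (T : Config (fun i => H (k i)) f) :
    D.ev r (T.push k).tree = D.ev (fun i => r (k i)) T.tree :=
  D.ev_mapNode k T.tree

theorem deg_ev_config (hp : ∀ i, app A.hom (p i) = F.arr (G i).hom) {f : Q.Arr} (T : Config G f) :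
    app A.hom (D.ev p T.tree) = F.arr f.hom :=
  (D.deg_ev hp T.tree).trans (arr_eq_of_sim T.sim)

end MonadPair.IsoData.OperadData

/-! ### Invariance of values under isomorphism, and the free operad on a graph. -/

namespace MonadPair.IsoData

open SymMulticat

variable {M : MonadPair} {Q : SymMulticat} {h : Q.Tidy} {F : M.IsoData (Q.zeta h)}

namespace OperadData

variable {A : Over (M.T.obj (⊤_ M.C))} (D : F.OperadData A) {ι κ : Type} [Finite ι] [Finite κ]
  {G G' : ι → Q.Arr} {H : κ → Q.Arr} {f f' : Q.Arr} {p : ι → F.El A.left} {r : κ → F.El A.left}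

theorem ev_config_post (hp : ∀ i, app A.hom (p i) = F.arr (G i).hom) (T : Config G f) (b : f ⟶ f') :
    D.ev p (show Config G f' from SymMulticat.post (Q := Q.slice) b T).tree = D.ev p T.tree := by
  refine (D.ev_config_push (H := G) (r := p) (k := ⟨fun p : Σ _ : Unit, ι => p.2, fun i => ⟨(), i⟩,
    fun _ => rfl, fun _ => rfl⟩) ((Config.single b).comp (fun _ => T))).trans ?_
  refine (D.ev_config_comp (Config.single b) (fun _ => T) (fun _ => p) (fun _ => hp)).trans ?_
  exact D.ev_config_single b _ (D.deg_ev_config hp T)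

theorem ev_config_pre (hp : ∀ i, app A.hom (p i) = F.arr (G' i).hom) (T : Config G f)
    (a : ∀ i, G' i ⟶ G i) :
    D.ev p (show Config G' f from SymMulticat.pre (Q := Q.slice) a T).tree = D.ev p T.tree := by
  refine (D.ev_config_push (H := G') (r := p) (k := ⟨fun p : Σ _ : ι, Unit => p.1, fun i => ⟨i, ()⟩,
    fun _ => rfl, fun _ => rfl⟩) (T.comp (fun i => Config.single (a i)))).trans ?_
  refine (D.ev_config_comp T (fun i => Config.single (a i)) (fun i _ => p i)
    (fun i _ => hp i)).trans ?_
  congr 1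
  exact funext fun i => D.ev_config_single (a i) _ (hp i)

/-- A morphism between configurations composes with one-node trees, which evaluation ignores by the
unit law, and renames the nodes. So the value depends only on the class of the labelled
configuration. -/
theorem ev_eltHom {T : Config G f} {T' : Config H f'} (m : EltHom (Q := Q.slice) T T')
    (hp : ∀ i, app A.hom (p i) = F.arr (G i).hom) (hr : ∀ i, r (m.perm i) = p i) :
    D.ev p T.tree = D.ev r T'.tree := by
  obtain ⟨e, inp, out, rfl⟩ := m
  refine Eq.trans ?_ (D.ev_config_push (H := H) (r := r) (k := e) _).symm
  have hi : ∀ i, app A.hom (r (e i)) = F.arr (H (e i)).hom := fun i => by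
    rw [hr, hp]
    exact (arr_eq (inp i)).symm
  refine Eq.trans ?_ (D.ev_config_pre hi _ inp).symm
  have hre : (fun i => r (e i)) = p := funext hr
  rw [hre]
  exact (D.ev_config_post hp T out).symm

end OperadData

/-! The free operad on a graph. -/

variable {A : Over (M.T.obj (⊤_ M.C))}

/-- An arrow of the class given by an element of a graph. -/
noncomputable def arrOf (a : F.El A.left) : Q.Arr := (OperadData.exists_deg a).choose

theorem deg_eq_arrOf (a : F.El A.left) : app A.hom a = F.arr (arrOf a).hom :=
  (OperadData.exists_deg a).choose_spec.1

variable (Q) in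
/-- A representative of a class of objects. -/
noncomputable def repObj (s : Q.Cls) : Q.Obj := Quotient.out s

theorem cls_repObj (s : Q.Cls) : cls (repObj Q s) = s :=
  Quotient.out_eq (s := isIsomorphicSetoid _) s

variable (F A) in
/-- The elements of the free operad. -/
@[ext] structure FrEl : Type where
  /-- The underlying tree. -/
  tree : Sk (F.El A.left) Q.Cls
  /-- The sort. -/
  srt : Q.Cls
  -- Only the existence of edge labels is recorded, since they are unique; this keeps equality of
  -- elements an equality of skeletons and sorts.
  exists_tree : ∃ T : Tree Q (arrOf (F := F) (A := A)) (repObj Q) (repObj Q srt), T.sk = tree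

variable (F A) in
/-- The object underlying the free operad. -/
noncomputable def frObj : M.C := F.objMk (FrEl.srt : FrEl F A → _)

/-- The tree that underlies an element of the free operad. -/
noncomputable def frSk (e : F.El (frObj F A)) : Sk (F.El A.left) Q.Cls := (elEquiv (FrEl.srt : FrEl F A → _) e).tree

theorem fr_ext {e e' : F.El (frObj F A)} (h₁ : frSk e = frSk e') (h₂ : sort e = sort e') :
    e = e' := by
  refine (elEquiv (F := F) (FrEl.srt : FrEl F A → _)).injective (FrEl.ext h₁ ?_)
  exact (sort_eq _ _).symm.trans (h₂.trans (sort_eq _ _))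

variable {L K : Type} {X : L → Q.Obj} {Y : K → Q.Obj} {x y z : Q.Obj}

theorem exists_rep (T : Tree Q (arrOf (F := F) (A := A)) X y) :
    ∃ T' : Tree Q (arrOf (F := F) (A := A)) (repObj Q) (repObj Q (cls y)),
      T'.sk = T.sk.map (fun i => i) fun l => cls (X l) := by
  refine ⟨(T.relabel (fun l => cls (X l)) fun l => (cls_exact (cls_repObj _)).some.hom).post
    (cls_exact (cls_repObj _).symm).some.hom, ?_⟩
  rw [Tree.sk_post, Tree.sk_relabel]

/-- The element of the free operad given by a tree. -/
noncomputable def frMk (T : Tree Q (arrOf (F := F) (A := A)) X y) : F.El (frObj F A) :=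
  (elEquiv (FrEl.srt : FrEl F A → _)).symm
    ⟨T.sk.map (fun i => i) fun l => cls (X l), cls y, exists_rep T⟩

theorem frSk_frMk (T : Tree Q (arrOf (F := F) (A := A)) X y) :
    frSk (frMk T) = T.sk.map (fun i => i) fun l => cls (X l) := by
  exact congrArg FrEl.tree (Equiv.apply_symm_apply _ _)

@[simp] theorem sort_frMk (T : Tree Q (arrOf (F := F) (A := A)) X y) : sort (frMk T) = cls y :=
  sort_elEquiv_symm _ _

theorem frMk_eq {T : Tree Q (arrOf (F := F) (A := A)) X y} {T' : Tree Q (arrOf (F := F) (A := A)) Y z}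
    (e : T.sk.map (fun i => i) (fun l => cls (X l)) = T'.sk.map (fun i => i) (fun l => cls (Y l)))
    (e' : cls y = cls z) : frMk T = frMk T' :=
  fr_ext ((frSk_frMk T).trans (e.trans (frSk_frMk T').symm)) (by rw [sort_frMk, sort_frMk, e'])

theorem frMk_post (T : Tree Q (arrOf (F := F) (A := A)) X y) (a : y ⟶ z) :
    frMk (T.post a) = frMk T :=
  frMk_eq (by rw [Tree.sk_post]) (cls_eq (have := h.isIso a; asIso a)).symm

theorem frMk_relabel (T : Tree Q (arrOf (F := F) (A := A)) X y) (k : L → K) (a : ∀ l, Y (k l) ⟶ X l) :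
    frMk (T.relabel k a) = frMk T := by
  refine frMk_eq ?_ rfl
  rw [Tree.sk_relabel, Sk.map_map]
  congr 1
  exact funext fun l => cls_eq (have := h.isIso (a l); asIso (a l))

theorem exists_frMk (e : F.El (frObj F A)) (hy : sort e = cls y) :
    ∃ T : Tree Q (arrOf (F := F) (A := A)) (repObj Q) y, frMk T = e := by
  obtain ⟨T, hT⟩ := (elEquiv (FrEl.srt : FrEl F A → _) e).exists_tree
  have hs : (elEquiv (FrEl.srt : FrEl F A → _) e).srt = sort e := (sort_eq _ e).symm
  refine ⟨T.post (cls_exact ((cls_repObj _).trans (hs.trans hy))).some.hom, ?_⟩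
  rw [frMk_post]
  refine fr_ext ?_ ?_
  · rw [frSk_frMk, hT]
    simp only [cls_repObj]
    exact Sk.map_id _
  · rw [sort_frMk, cls_repObj, hs]

theorem exists_tree (e : F.El (frObj F A)) :
    ∃ (y : Q.Obj) (T : Tree Q (arrOf (F := F) (A := A)) (repObj Q) y), frMk T = e :=
  ⟨_, exists_frMk e (cls_repObj (sort e)).symm⟩

/-- Shows that the degree is independent of the tree chosen to represent an element. -/
theorem sim_of_frMk_eq {T : Tree Q (arrOf (F := F) (A := A)) X y}
    {T' : Tree Q (arrOf (F := F) (A := A)) Y z} (e : frMk T = frMk T') :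
    ∃ q : T.Leaf ≃ T'.Leaf, Sim T.eval q T'.eval id := by
  have a : cls y = cls z := by rw [← sort_frMk T, e, sort_frMk]
  obtain ⟨q, hq, _⟩ := Tree.exists_sim h (T := T) (T' := T') (cls_exact a).some.hom
    (by rw [← frSk_frMk, e, frSk_frMk])
  exact ⟨q, hq⟩

variable (F A) in
/-- The free operad as a graph. -/
noncomputable def frGraph : Over (M.T.obj (⊤_ M.C)) :=
  Over.mk (homMk (F := F) (X := frObj F A)
    (fun e => F.arr (exists_frMk e (cls_repObj (sort e)).symm).choose.eval)
    (fun _ => (sort_arr _).trans (cls_repObj _)))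

theorem deg_frMk (T : Tree Q (arrOf (F := F) (A := A)) X y) :
    app (frGraph F A).hom (frMk T) = F.arr T.eval := by
  refine (app_homMk (F := F) (X := frObj F A) _
    (fun _ => (sort_arr _).trans (cls_repObj _)) _).trans ?_
  obtain ⟨q, hq⟩ := sim_of_frMk_eq (exists_frMk (frMk T) (cls_repObj (sort (frMk T))).symm).choose_spec
  exact arr_eq_of_sim hq

section

variable {ι : Type} [Finite ι] {u : ι → Q.Obj} {f : Q.Hom u y}

/-- The value of any representing tree is isomorphic to `f`, and the isomorphism can be used to
rename its leaves by the inputs of `f`. Other trees can then be grafted at these inputs. -/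
theorem exists_lift_of_deg {e : F.El (frObj F A)} (he : app (frGraph F A).hom e = F.arr f) :
    ∃ P : Tree Q (arrOf (F := F) (A := A)) u y, Sim P.eval P.leafLabel f id ∧ frMk P = e := by
  obtain ⟨_, T, rfl⟩ := exists_tree e
  rw [deg_frMk] at he
  obtain ⟨m⟩ := exists_eltHom_of_arr he
  obtain ⟨P, hP, hk⟩ := T.exists_lift h m
  refine ⟨P, hP, frMk_eq (hk _ _ fun l => ?_) ?_⟩
  · exact cls_eq (have := h.isIso (m.inp l); asIso (m.inp l))
  · exact (cls_eq (have := h.isIso m.out; asIso m.out)).symm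

open Classical in
/-- The composition of the free operad. -/
noncomputable def frCmp (e : F.El (frObj F A)) (f : Q.Hom u y) (q : ι → F.El (frObj F A)) :
    F.El (frObj F A) :=
  -- Such trees exist whenever the degree and the sorts are compatible, so the default `e` is never
  -- used in the operad laws.
  if H : ∃ (P : Tree Q (arrOf (F := F) (A := A)) u y)
      (t : ∀ i, Tree Q (arrOf (F := F) (A := A)) (repObj Q) (u i)),
      Sim P.eval P.leafLabel f id ∧ frMk P = e ∧ ∀ i, frMk (t i) = q i then
    frMk (H.choose.graft H.choose_spec.choose) else e

/-- By `Tree.lift_unique` the tree chosen in the definition is `P`, and the skeleton of a graft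
depends only on the skeletons of its parts. -/
theorem frCmp_spec {P : Tree Q (arrOf (F := F) (A := A)) u y} (s : Sim P.eval P.leafLabel f id)
    {q : ι → F.El (frObj F A)} (hq : ∀ i, sort (q i) = cls (u i)) :
    frSk (frCmp (frMk P) f q) = P.sk.bind (fun i => frSk (q i)) ∧
      sort (frCmp (frMk P) f q) = cls y := by
  choose t ht using fun i => exists_frMk (q i) (hq i)
  have H : ∃ (P' : Tree Q (arrOf (F := F) (A := A)) u y)
      (t : ∀ i, Tree Q (arrOf (F := F) (A := A)) (repObj Q) (u i)),
      Sim P'.eval P'.leafLabel f id ∧ frMk P' = frMk P ∧ ∀ i, frMk (t i) = q i := ⟨P, t, s, rfl, ht⟩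
  rw [frCmp, dif_pos H]
  obtain ⟨s', e, ht'⟩ := H.choose_spec.choose_spec
  refine ⟨?_, sort_frMk _⟩
  rw [frSk_frMk, Tree.sk_graft, Sk.map_bind, Sk.map_id]
  rw [congrArg Tree.sk (Tree.lift_unique h s' s (by rw [← frSk_frMk, e, frSk_frMk]))]
  congr 1
  funext i
  rw [← ht' i, frSk_frMk]

theorem frCmp_frMk {P : Tree Q (arrOf (F := F) (A := A)) u y} (s : Sim P.eval P.leafLabel f id)
    (t : ∀ i, Tree Q (arrOf (F := F) (A := A)) X (u i)) :
    frCmp (frMk P) f (fun i => frMk (t i)) = frMk (P.graft t) := by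
  obtain ⟨h₁, h₂⟩ := frCmp_spec s (q := fun i => frMk (t i)) (fun i => sort_frMk _)
  refine fr_ext (h₁.trans ?_) (h₂.trans (sort_frMk _).symm)
  rw [frSk_frMk, Tree.sk_graft, Sk.map_bind, Sk.map_id]
  simp only [frSk_frMk]

end

/-- Each `P i` has the inputs of `g i` as its leaves; `t i` is the same tree with its leaves placed
among the inputs of the composite and its root moved along `a i`, ready for grafting. -/
theorem exists_lift_of_degs {ι : Type} [Finite ι] {κ : ι → Type} [∀ i, Finite (κ i)]
    {u : ι → Q.Obj} {v : ∀ i, κ i → Q.Obj} {w : ι → Q.Obj} (g : ∀ i, Q.Hom (v i) (w i))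
    (a : ∀ i, w i ⟶ u i) {q : ι → F.El (frObj F A)}
    (hq : ∀ i, app (frGraph F A).hom (q i) = F.arr (g i)) :
    ∃ (P : ∀ i, Tree Q (arrOf (F := F) (A := A)) (v i) (w i))
      (t : ∀ i, Tree Q (arrOf (F := F) (A := A)) (fun k : Σ i, κ i => v k.1 k.2) (u i)),
      (∀ i, Sim (P i).eval (P i).leafLabel (g i) id) ∧ (∀ i, frMk (P i) = q i) ∧
      (∀ i, Sim (t i).eval (t i).leafLabel (g i) (Sigma.mk i)) ∧
      (∀ i, (t i).sk = (P i).sk.map (fun i => i) (Sigma.mk i)) ∧ (∀ i, frMk (t i) = q i) := by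
  choose P hP e using fun i => exists_lift_of_deg (hq i)
  refine ⟨P, fun i => ((P i).relabel (Y := fun k : Σ i, κ i => v k.1 k.2) (Sigma.mk i)
    fun l => 𝟙 _).post (a i), hP, e, fun i => ?_, fun i => ?_, fun i => ?_⟩
  · exact ((Tree.sim_post _ _).symm h).trans (((Tree.sim_relabel h _ _ _).symm h).trans
      ((hP i).map (Sigma.mk i)))
  · rw [Tree.sk_post, Tree.sk_relabel]
  · rw [frMk_post, frMk_relabel, e]

variable (F A) in
/-- The free operad. -/
noncomputable def frData : F.OperadData (frGraph F A) where
  one s := frMk (.leaf s (𝟙 (repObj Q s)) : Tree Q (arrOf (F := F) (A := A)) (repObj Q) (repObj Q s))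
  cmp e f q := frCmp e f q
  deg_one a := by
    refine (deg_frMk _).trans (arr_eq_of_sim (sim_iota h _ _ ?_ id id rfl))
    exact (cls_exact (cls_repObj _)).some.hom
  deg_cmp f g a e q he hq := by
    obtain ⟨P, hP, rfl⟩ := exists_lift_of_deg he
    obtain ⟨_, t, -, -, ht, -, e⟩ := exists_lift_of_degs g a hq
    obtain rfl := funext e
    refine (congrArg _ (frCmp_frMk hP t)).trans ((deg_frMk _).trans ?_)
    exact arr_eq_of_sim (Sim.graft h hP t a ht)
  cmp_eq {_ _ _ _ _ _ _ _ f f'} e q q' he hq hq' m hm := by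
    obtain ⟨P, hP, rfl⟩ := exists_lift_of_deg he
    -- Carrying the leaves and the root of `P` along `m` turns the tree for `f` into the tree for
    -- `f'`.
    have hP' := ((Tree.sim_post (P.relabel m.perm m.inp) m.out).symm h).trans
      (((Tree.sim_relabel h P m.perm m.inp).symm h).trans ((hP.map m.perm).trans
        (⟨m, fun _ => rfl⟩ : Sim f m.perm f' id)))
    have e : frMk P = frMk ((P.relabel m.perm m.inp).post m.out) := by rw [frMk_post, frMk_relabel]
    obtain ⟨h₁, h₂⟩ := frCmp_spec hP hq
    obtain ⟨h₁', h₂'⟩ := frCmp_spec hP' hq'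
    rw [← e] at h₁' h₂'
    refine fr_ext ?_ ?_
    · rw [h₁, h₁', Tree.sk_post, Tree.sk_relabel, Sk.map_eq_bind, Sk.bind_bind]
      simp only [Sk.bind, hm]
    · rw [h₂, h₂']
      exact cls_eq (have := h.isIso m.out; asIso m.out)
  one_cmp a e he := by
    -- The identity is represented by an edge at `a` itself, instead of at the chosen representative
    -- of its class, so that its value is literally the identity arrow of `a`.
    have eq : frMk (.leaf (cls a) (𝟙 (repObj Q (cls a))) :
        Tree Q (arrOf (F := F) (A := A)) (repObj Q) (repObj Q (cls a))) =
        frMk (.leaf () (𝟙 a) : Tree Q (arrOf (F := F) (A := A)) (fun _ => a) a) :=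
      frMk_eq (congrArg Sk.leaf (cls_repObj _)) (cls_repObj _)
    rw [eq]
    obtain ⟨h₁, h₂⟩ := frCmp_spec (F := F) (A := A)
      (P := (.leaf () (𝟙 a) : Tree Q (arrOf (F := F) (A := A)) (fun _ => a) a))
      (f := Q.iota (𝟙 a)) (Sim.refl _ _) (q := fun _ => e) (fun _ => he)
    exact fr_ext h₁ (h₂.trans he.symm)
  cmp_one f e he := by
    obtain ⟨P, hP, rfl⟩ := exists_lift_of_deg he
    obtain ⟨h₁, h₂⟩ := frCmp_spec hP (q := fun i => frMk (.leaf (cls _) (𝟙 (repObj Q (cls _))) :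
        Tree Q (arrOf (F := F) (A := A)) (repObj Q) (repObj Q (cls _))))
        (fun i => (sort_frMk _).trans (cls_repObj _))
    refine fr_ext (h₁.trans ?_) (h₂.trans (sort_frMk _).symm)
    rw [frSk_frMk, Sk.map_eq_bind]
    congr 1
    funext i
    rw [frSk_frMk]
    exact congrArg Sk.leaf (cls_repObj _)
  assoc f g a e q r he hq hr := by
    obtain ⟨P, hP, rfl⟩ := exists_lift_of_deg he
    obtain ⟨P', t, hP', e', ht, hk, e⟩ := exists_lift_of_degs g a hq
    have hi := fun i => frCmp_spec (hP' i) (hr i)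
    simp only [e'] at hi
    have hu : ∀ i, cls _ = cls _ := fun i => cls_eq (have := h.isIso (a i); asIso (a i))
    obtain ⟨h₁, h₂⟩ := frCmp_spec hP (q := fun i => frCmp (q i) (g i) (r i))
      (fun i => (hi i).2.trans (hu i))
    obtain rfl := funext e
    obtain ⟨h₁', h₂'⟩ := frCmp_spec (Sim.graft h hP t a ht) (q := fun k => r k.1 k.2)
      (fun k => hr k.1 k.2)
    rw [← frCmp_frMk hP t] at h₁' h₂'
    -- On skeletons, associativity is the associativity of grafting.
    refine fr_ext (h₁.trans (Eq.trans ?_ h₁'.symm)) (h₂.trans h₂'.symm)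
    rw [Tree.sk_graft, Sk.bind_bind]
    congr 1
    funext i
    rw [(hi i).1]
    simp only [hk, Sk.map_eq_bind, Sk.bind_bind]
    rfl

end MonadPair.IsoData

/-! ### The universal property of the free operad and the resulting monad. -/

namespace MonadPair.IsoData

open SymMulticat

variable {M : MonadPair} {Q : SymMulticat} {h : Q.Tidy} {F : M.IsoData (Q.zeta h)}
  {A B : Over (M.T.obj (⊤_ M.C))}

/-- The tree with one node. -/
noncomputable def corolla (a : F.El A.left) : Tree Q (arrOf (F := F) (A := A)) (arrOf a).src (arrOf a).tgt :=
  .node a (𝟙 _) fun j => .leaf j (𝟙 _)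

theorem sim_corolla (a : F.El A.left) :
    Sim (corolla a).eval (corolla a).leafLabel (arrOf a).hom id := by
  have := sim_push (Q := Q) (⟨fun p : Σ _ : Fin (arrOf a).n, Unit => p.1, fun i => ⟨i, ()⟩,
    fun _ => rfl, fun _ => rfl⟩ : (Σ _ : Fin (arrOf a).n, Unit) ≃ Fin (arrOf a).n)
    (x := (arrOf a).src) (Q.comp (arrOf a).hom (fun i => Q.iota (𝟙 _))) id
  rw [Q.comp_one] at this
  exact ((sim_post (𝟙 _) (Q.comp (arrOf a).hom (fun i => Q.iota (𝟙 _))) _).symm h).trans this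

/-- The insertion of generators. -/
noncomputable def frUnit (a : F.El A.left) : F.El (frObj F A) := frMk (corolla a)

theorem deg_frUnit (a : F.El A.left) : app (frGraph F A).hom (frUnit a) = app A.hom a :=
  (deg_frMk _).trans ((arr_eq_of_sim (sim_corolla a)).trans (deg_eq_arrOf a).symm)

theorem sort_frUnit (a : F.El A.left) : sort (frUnit a) = sort a :=
  (sort_app (frGraph F A).hom (frUnit a)).symm.trans ((congrArg sort (deg_frUnit a)).trans
    (sort_app _ _))

/-- Every element of the free operad is thus the value of a tree of generators, which makes operad
morphisms out of it determined by the generators. -/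
theorem ev_frUnit {L : Type} {X : L → Q.Obj} {y : Q.Obj}
    (T : Tree Q (arrOf (F := F) (A := A)) X y) : (frData F A).ev frUnit T = frMk T := by
  induction T with
  | leaf l a =>
    exact frMk_eq (congrArg Sk.leaf (cls_repObj _)) ((cls_repObj _).trans
      (cls_eq (have := h.isIso a; asIso a)))
  | @node y i a s ih =>
    refine (congrArg (frCmp (frUnit i) (arrOf i).hom) (funext ih)).trans
      ((frCmp_frMk (sim_corolla i) s).trans ?_)
    refine frMk_eq ?_ (cls_eq (have := h.isIso a; asIso a))
    congr 1
    simp only [corolla, Tree.graft, Tree.post_id, Tree.sk]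

section

variable (P : Operad M.T) (g : A ⟶ P.A)

theorem deg_app_graph (a : F.El A.left) :
    app P.A.hom (app g.left a) = F.arr (arrOf a).hom := by
  rw [← app_comp, app_congr (Over.w g), deg_eq_arrOf]

/-- The extension of a map of graphs to the free operad, on elements. -/
noncomputable def frLiftFun (e : F.El (frObj F A)) : F.El P.A.left :=
  (OperadData.ofOperad F P).ev (fun a => app g.left a) (exists_tree e).choose_spec.choose

theorem frLiftFun_frMk {L : Type} {X : L → Q.Obj} {y : Q.Obj}
    (T : Tree Q (arrOf (F := F) (A := A)) X y) :
    frLiftFun P g (frMk T) = (OperadData.ofOperad F P).ev (fun a => app g.left a) T := by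
  refine OperadData.ev_congr _ _ _ ?_
  rw [← frSk_frMk, ← frSk_frMk, (exists_tree (frMk T)).choose_spec.choose_spec]

theorem frLiftFun_frUnit (a : F.El A.left) : frLiftFun P g (frUnit a) = app g.left a :=
  (frLiftFun_frMk P g _).trans
    ((OperadData.ofOperad F P).cmp_one (arrOf a).hom _ (deg_app_graph P g a))

/-- The extension of a map of graphs to the free operad. -/
noncomputable def frLift : (frData F A).toOperad ⟶ P :=
  (frData F A).homOfFun P (frLiftFun P g)
    (fun e => by
      obtain ⟨y, T, rfl⟩ := exists_tree e
      rw [frLiftFun_frMk, deg_frMk]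
      exact OperadData.deg_ev _ (deg_app_graph P g) T)
    (fun s => by
      refine (frLiftFun_frMk P g _).trans ?_
      exact congrArg (OperadData.ofOperad F P).one (cls_repObj s))
    (fun f e q he hq => by
      obtain ⟨T, hT, rfl⟩ := exists_lift_of_deg he
      choose t ht using fun i => exists_frMk (q i) (hq i)
      obtain rfl := funext ht
      refine (congrArg (frLiftFun P g) (frCmp_frMk hT t)).trans ?_
      simp only [frLiftFun_frMk]
      exact OperadData.ev_graft_of_sim _ (deg_app_graph P g) T hT t)

end

variable (F A) in
/-- The insertion of generators, as a map of graphs. -/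
noncomputable def frUnitHom : A ⟶ frGraph F A :=
  Over.homMk (homMk (F := F) frUnit sort_frUnit) (hom_ext (F := F) fun a => by
      exact (app_comp _ _ a).trans ((congrArg _ (app_homMk (F := F) frUnit sort_frUnit a)).trans
        (deg_frUnit a)))

theorem app_frUnitHom (a : F.El A.left) : app (frUnitHom F A).left a = frUnit a :=
  app_homMk (F := F) (X := A.left) frUnit sort_frUnit a

theorem over_hom_ext {f g : A ⟶ B} (e : ∀ a : F.El A.left, app f.left a = app g.left a) : f = g :=
  Over.OverMorphism.ext (hom_ext e)

variable (F A) in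
/-- The universal property of the free operad. -/
noncomputable def frEquiv (P : Operad M.T) : ((frData F A).toOperad ⟶ P) ≃ (A ⟶ P.A) where
  toFun k := frUnitHom F A ≫ OperadHom.map k
  invFun g := frLift P g
  left_inv k := by
    refine OperadHom.ext (over_hom_ext (F := F) fun e => ?_)
    refine (OperadData.app_homOfFun _ _ _ _ _ _ _).trans ?_
    obtain ⟨y, T, rfl⟩ := exists_tree e
    -- With the element written as a value of generators, `map_ev` computes `k` on it from its
    -- restriction to `A`.
    rw [frLiftFun_frMk, ← ev_frUnit T]
    refine Eq.trans ?_ (OperadData.map_ev _ _ (fun a => (deg_frUnit a).trans (deg_eq_arrOf a)) _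
      (OperadData.app_hom_one _ P k) (OperadData.app_hom_cmp _ P k) T).symm
    congr 1
    funext a
    exact (app_comp (frUnitHom F A).left _ a).trans (congrArg _ (app_frUnitHom a))

  right_inv g := over_hom_ext (F := F) fun a => by
    refine (app_comp (frUnitHom F A).left _ a).trans ((congrArg _ (app_frUnitHom a)).trans ?_)
    exact (OperadData.app_homOfFun _ _ _ _ _ _ _).trans (frLiftFun_frUnit P g a)

variable (F) in
/-- The free-operad functor. -/
noncomputable def frFunctor : Over (M.T.obj (⊤_ M.C)) ⥤ Operad M.T :=
  Adjunction.leftAdjointOfEquiv (G := operadForget M.T) (fun A P => frEquiv F A P)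
    fun A _ _ _ _ => (Category.assoc (frUnitHom F A) _ _).symm

variable (F) in
/-- Free operads exist. -/
noncomputable def frAdjunction : F.frFunctor ⊣ operadForget M.T :=
  Adjunction.adjunctionOfEquivLeft (G := operadForget M.T) (fun A P => frEquiv F A P)
    fun A _ _ _ _ => (Category.assoc (frUnitHom F A) _ _).symm

theorem hasFreeOperads (F : M.IsoData (Q.zeta h)) : M.HasFreeOperads := (frAdjunction F).isRightAdjoint

/-- The lift is defined through the data recovered from `D.toOperad`. These agree with `D` on
identities and on all compatible compositions, so evaluation is the same in both. -/
theorem app_frLift (D : F.OperadData B) (g : A ⟶ B) {L : Type} {X : L → Q.Obj} {y : Q.Obj}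
    (T : Tree Q (arrOf (F := F) (A := A)) X y) :
    app (CommaMorphism.left (OperadHom.map (frLift D.toOperad g))) (frMk T) =
      D.ev (fun a => app g.left a) T := by
  refine (OperadData.app_homOfFun _ _ _ _ _ _ _).trans ((frLiftFun_frMk D.toOperad g T).trans ?_)
  have h₁ : ∀ s, D.one s = (OperadData.ofOperad F D.toOperad).one s := fun s => by
    refine Eq.trans ?_ (D.app_hom_one D.toOperad (𝟙 _) s)
    exact (app_id _).symm
  have h₂ : ∀ {ι : Type} [Finite ι] {x : ι → Q.Obj} {y : Q.Obj} (f : Q.Hom x y) (p : F.El B.left)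
      (q : ι → F.El B.left), app B.hom p = F.arr f → (∀ i, sort (q i) = cls (x i)) →
      D.cmp p f q = (OperadData.ofOperad F D.toOperad).cmp p f q := fun f p q hp hq => by
    have := D.app_hom_cmp D.toOperad (𝟙 _) f p q hp hq
    have e : ∀ z : F.El B.left, app (CommaMorphism.left (OperadHom.map (𝟙 D.toOperad))) z = z :=
      fun z => app_id z
    refine (e _).symm.trans (this.trans ?_)
    exact congr (congrArg (fun z => (OperadData.ofOperad F D.toOperad).cmp z f) (e p))
      (funext fun i => e _)
  exact (D.map_ev (OperadData.ofOperad F D.toOperad) (deg_app_graph D.toOperad g) (fun z => z) h₁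
    h₂ T).symm

variable (F) in
/-- The monad of free operads. -/
noncomputable def frMonad : Monad (Over (M.T.obj (⊤_ M.C))) := F.frAdjunction.toMonad

theorem app_frMonad_η (a : F.El A.left) : app (F.frMonad.η.app A).left a = frUnit a := by
  have : F.frAdjunction.unit.app A = frUnitHom F A ≫ 𝟙 _ :=
    Adjunction.adjunctionOfEquivLeft_unit_app (G := operadForget M.T)
      (fun A P => frEquiv F A P) _ A
  exact (app_congr (congrArg CommaMorphism.left (this.trans (Category.comp_id _))) a).trans
    (app_frUnitHom a)

theorem app_frMonad_map (k : A ⟶ B) {L : Type} {X : L → Q.Obj} {y : Q.Obj}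
    (T : Tree Q (arrOf (F := F) (A := A)) X y) :
    app (F.frMonad.map k).left (frMk T) =
      (frData F B).ev (fun a => frUnit (app k.left a)) T := by
  have : F.frFunctor.map k = frLift (frData F B).toOperad (k ≫ frUnitHom F B ≫ 𝟙 _) := rfl
  have e : frUnitHom F B ≫ 𝟙 (frGraph F B) = frUnitHom F B := Category.comp_id _
  refine (app_congr (congrArg (fun t => CommaMorphism.left (OperadHom.map t)) (this.trans
    (congrArg (fun t => frLift (frData F B).toOperad (k ≫ t)) e))) _).trans
    ((app_frLift (frData F B) (k ≫ frUnitHom F B) T).trans ?_)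
  congr 1
  funext a
  exact (app_comp k.left _ a).trans (app_frUnitHom _)

/-- The counit extends the identity map of the underlying graph, so multiplication evaluates a tree
whose nodes are elements of the free operad. -/
theorem app_frMonad_μ {L : Type} {X : L → Q.Obj} {y : Q.Obj}
    (T : Tree Q (arrOf (F := F) (A := frGraph F A)) X y) :
    app (F.frMonad.μ.app A).left (frMk T) = (frData F A).ev (fun a => a) T := by
  have : F.frAdjunction.counit.app (F.frFunctor.obj A) = frLift (frData F A).toOperad (𝟙 _) :=
    Adjunction.adjunctionOfEquivLeft_counit_app (G := operadForget M.T)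
      (fun A P => frEquiv F A P) _ (F.frFunctor.obj A)
  refine (app_congr (congrArg (fun t => CommaMorphism.left (OperadHom.map t)) this) _).trans
    ((app_frLift (frData F A) (𝟙 _) T).trans ?_)
  congr 1
  funext a
  exact app_id a

end MonadPair.IsoData

/-! ### Graphs as sets over the classes of objects of the slice. -/

namespace MonadPair.IsoData

open SymMulticat

variable {M : MonadPair} {Q : SymMulticat} {h : Q.Tidy} {F : M.IsoData (Q.zeta h)}
  {A B : Over (M.T.obj (⊤_ M.C))}

/-- Objects of the slice are arrows of `Q`, and all morphisms between them are invertible because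
the slice is tidy. -/
theorem cls_arr_eq_iff {f g : Q.Arr} :
    cls (Q := Q.slice) f = cls (Q := Q.slice) g ↔ F.arr f.hom = F.arr g.hom := by
  constructor
  · intro e
    obtain ⟨a⟩ := cls_exact (Q := Q.slice) e
    exact arr_eq a.hom
  · intro e
    obtain ⟨m⟩ := exists_eltHom_of_arr e
    have := h.slice.isIso (x := f) (y := g) m
    exact cls_eq (Q := Q.slice) (asIso (show (show Q.slice.Obj from f) ⟶ g from m))

variable (F) in
/-- The elements of `T 1` are the classes of objects of the slice. -/
noncomputable def arrCls : F.El (M.T.obj (⊤_ M.C)) ≃ Q.slice.Cls where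
  toFun b := cls (Q := Q.slice) (exists_arr b).choose
  invFun := Quotient.lift (s := isIsomorphicSetoid Q.slice.Obj) (fun f : Q.Arr => F.arr f.hom)
    fun _ _ ⟨a⟩ => arr_eq a.hom
  left_inv b := (exists_arr b).choose_spec.symm
  right_inv s := by
    obtain ⟨f, rfl⟩ := Quotient.exists_rep s
    exact cls_arr_eq_iff.2 (exists_arr (F.arr f.hom)).choose_spec.symm

theorem arrCls_arr (f : Q.Arr) : F.arrCls (F.arr f.hom) = cls (Q := Q.slice) f :=
  F.arrCls.eq_symm_apply.1 rfl

theorem arrCls_eq_iff {b : F.El (M.T.obj (⊤_ M.C))} {f : Q.Arr} :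
    F.arrCls b = cls (Q := Q.slice) f ↔ b = F.arr f.hom := by
  rw [← arrCls_arr (F := F), F.arrCls.apply_eq_iff_eq]

variable (F) in
/-- Graphs as objects over the set of classes of objects of the slice. -/
noncomputable def sliceU : Over (M.T.obj (⊤_ M.C)) ⥤ Over Q.slice.Cls where
  obj A := Over.mk (TypeCat.ofHom fun a : F.El A.left => F.arrCls (app A.hom a))
  map {A B} k := Over.homMk (TypeCat.ofHom fun a : F.El A.left => (app k.left a : F.El B.left)) (by
    ext a
    exact congrArg F.arrCls ((app_comp (F := F) _ _ a).symm.trans (app_congr (F := F) (Over.w k) a)))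
  map_id A := by
    ext a
    exact app_id (F := F) (X := A.left) a
  map_comp k l := by
    ext a
    exact app_comp (F := F) k.left l.left a

/-- Bijectivity on objects requires genuine equality of objects over a set, including equality of
the underlying types. -/
theorem _root_.CategoryTheory.Over.ext_type {S : Type} {X Y : Over S} (he : X.left = Y.left)
    (hh : ∀ a, Y.hom (cast he a) = X.hom a) : X = Y := by
  obtain ⟨X, ⟨⟨⟩⟩, f⟩ := X
  obtain ⟨Y, ⟨⟨⟩⟩, g⟩ := Y
  change X = Y at he
  subst he
  obtain rfl : f = g := by
    ext a
    exact (hh a).symm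
  rfl

theorem _root_.CategoryTheory.Over.exists_of_eq {S : Type} {X Y : Over S} (e : X = Y) :
    ∃ he : X.left = Y.left, ∀ a, Y.hom (cast he a) = X.hom a := by
  subst e
  exact ⟨rfl, fun _ => rfl⟩

theorem sort_eq_of_arrCls {a : F.El A.left} {b : F.El B.left}
    (e : F.arrCls (app A.hom a) = F.arrCls (app B.hom b)) : sort a = sort b := by
  rw [← sort_app A.hom, F.arrCls.injective e, sort_app]

/-- The class of an arrow determines the class of its target. So the underlying sets over `S_Q`
coincide, and `F.U` is injective on objects; the structure maps are then compared elementwise. -/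
theorem sliceU_obj_injective : Function.Injective (F.sliceU.obj) := by
  intro A B e
  obtain ⟨he, hh⟩ := Over.exists_of_eq e
  have hl : A.left = B.left := F.isIso.bijective_obj.1 (Over.ext_type he fun a =>
    sort_eq_of_arrCls (hh a))
  obtain ⟨X, ⟨⟨⟩⟩, f⟩ := A
  obtain ⟨Y, ⟨⟨⟩⟩, g⟩ := B
  change X = Y at hl
  subst hl
  obtain rfl : f = g := hom_ext (F := F) fun a => (F.arrCls.injective (hh a)).symm
  rfl

theorem _root_.CategoryTheory.Over.cast_eq {S : Type} {X Y : Over S} (e : X = Y)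
    (he : X.left = Y.left) (a : X.left) :
    cast he a = ((Over.forget S).mapIso (eqToIso e)).toEquiv a := by
  subst e
  rfl

theorem sliceU_obj_surjective : Function.Surjective (F.sliceU.obj) := by
  intro Y
  -- An element over the class of an arrow gets the class of the target of that arrow as its sort.
  let s : Y.left → Q.Cls := fun a => sort (F.arrCls.symm (Y.hom a))
  let f : F.objMk s ⟶ M.T.obj (⊤_ M.C) := homMk (F := F)
    (fun a => F.arrCls.symm (Y.hom (elEquiv s a))) fun a => (sort_eq s a).symm
  have he : F.El (F.objMk s) = Y.left := congrArg (fun o : Over Q.Cls => o.left) (over_objMk s)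
  refine ⟨Over.mk f, Over.ext_type he fun a => ?_⟩
  have hc : cast he a = elEquiv s a := Over.cast_eq (over_objMk s) he a
  refine (congrArg Y.hom hc).trans ((F.arrCls.eq_symm_apply.1 ?_).symm)
  exact app_homMk (F := F) (X := F.objMk s) _ (fun a => (sort_eq s a).symm) a

theorem isIso_sliceU : (sliceU F).IsIso where
  faithful := ⟨fun {A B k l} e => over_hom_ext (F := F) fun a =>
    congrArg (fun t : F.sliceU.obj A ⟶ F.sliceU.obj B =>
      (t.left : (F.sliceU.obj A).left → (F.sliceU.obj B).left) a) e⟩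
  full := ⟨fun {A B} k => by
    have hk : ∀ a : F.El A.left, app (F := F) B.hom (k.left a) = app A.hom a := fun a =>
      F.arrCls.injective (over_w k a)
    have hs : ∀ a : F.El A.left, sort (F := F) (X := B.left) (k.left a) = sort a := fun a =>
      sort_eq_of_arrCls (over_w k a)
    refine ⟨Over.homMk (homMk (F := F) (Y := B.left) (fun a => k.left a) hs)
      (hom_ext (F := F) fun a => ?_), ?_⟩
    · exact (app_comp _ _ _).trans ((congrArg _ (app_homMk _ hs a)).trans (hk a))
    · ext a
      exact app_homMk (F := F) (Y := B.left) (fun a => k.left a) hs a⟩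
  bijective_obj := ⟨sliceU_obj_injective, sliceU_obj_surjective⟩

end MonadPair.IsoData

/-! ### Labelled configurations correspond to elements of the free operad. -/

namespace SymMulticat

variable {Q : SymMulticat}

theorem Sim.mkT_eq (h : Q.Tidy) {A : Over Q.Cls} {ι κ : Type} [Finite ι] [Finite κ]
    {x : ι → Q.Obj} {x' : κ → Q.Obj} {y y' : Q.Obj} {f : Q.Hom x y} {f' : Q.Hom x' y'}
    {l : ι → A.left} {l' : κ → A.left} {hl : ∀ i, A.hom (l i) = cls (x i)}
    {hl' : ∀ i, A.hom (l' i) = cls (x' i)} (s : Sim f l f' l') : mkT f l hl = mkT f' l' hl' := by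
  obtain ⟨m, hm⟩ := s
  exact h.mkT_eq m hm

/-- A configuration from a tree. -/
def Config.ofSim (h : Q.Tidy) {ι : Type} {G : ι → Q.Arr} {f : Q.Arr} (T : Tree Q G f.src f.tgt)
    (hn : T.nodeLabel.Bijective) (s : Sim T.eval T.leafLabel f.hom id) : Config G f where
  tree := T
  node_bij := hn
  leaf_bij := s.bijective
  eval_eq := Sim.push_eq h s

instance Tree.finiteNode {ι L : Type} {G : ι → Q.Arr} {X : L → Q.Obj} {y : Q.Obj}
    (T : Tree Q G X y) : Finite T.Node :=
  Set.finite_univ_iff.1 ((List.finite_toSet T.nodes).subset fun N _ => T.nodup_nodes.2 N)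

theorem sk_config_post {ι : Type} [Finite ι] {G : ι → Q.Arr} {f f' : Q.Arr} (T : Config G f)
    (b : f ⟶ f') :
    (show Config G f' from SymMulticat.post (Q := Q.slice) b T).tree.sk =
      T.tree.sk.map (fun i => i) (EltHom.perm b) := by
  refine (Tree.sk_mapNode (G := G) (fun p : Σ _ : Unit, ι => p.2)
    ((Config.single b).comp (fun _ => T)).tree).trans ?_
  refine (congrArg (Sk.map _ _) ((Tree.sk_post _ _).trans ((Tree.sk_graft _ _).trans
    (congrArg (Sk.bind _) (Tree.sk_mapNode (G := fun p : Σ _ : Unit, ι => G p.2)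
      (Sigma.mk ()) T.tree))))).trans ?_
  refine (congrArg (Sk.map _ _) (Sk.map_eq_bind (EltHom.perm b) _).symm).trans ?_
  rw [Sk.map_map, Sk.map_map]

end SymMulticat

namespace MonadPair.IsoData

open SymMulticat

variable {M : MonadPair} {Q : SymMulticat} {h : Q.Tidy} {F : M.IsoData (Q.zeta h)}
  {A B : Over (M.T.obj (⊤_ M.C))}

section

variable {ι : Type} [Finite ι] {G : ι → Q.Arr} {f : Q.Arr}

theorem deg_of_sliceU {a : F.El A.left} {g : Q.Arr}
    (e : (F.sliceU.obj A).hom a = cls (Q := Q.slice) g) : app A.hom a = F.arr g.hom :=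
  arrCls_eq_iff.1 e

theorem sliceU_of_deg {a : F.El A.left} {g : Q.Arr} (e : app A.hom a = F.arr g.hom) :
    (F.sliceU.obj A).hom a = cls (Q := Q.slice) g :=
  arrCls_eq_iff.2 e

/-- The value of a labelled configuration in an operad. -/
noncomputable def evT (D : F.OperadData B) (k : F.El A.left → F.El B.left)
    (hk : ∀ a, app B.hom (k a) = app A.hom a) (t : (TObj (Q := Q.slice) (F.sliceU.obj A)).left) :
    F.El B.left :=
  Quotient.lift (s := isIsomorphicSetoid (Lab (Q := Q.slice) (F.sliceU.obj A)))
    (fun a => D.ev (fun i => k (a.lab i)) (Config.tree a.arr.hom))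
    (fun a _ ⟨m⟩ => D.ev_eltHom m.hom.1 (fun i => (hk _).trans (deg_of_sliceU (a.compat i)))
      fun i => congrArg k (m.hom.2 i)) t

theorem evT_mkT (D : F.OperadData B) (k : F.El A.left → F.El B.left)
    (hk : ∀ a, app B.hom (k a) = app A.hom a) (T : Config G f) (l : ι → F.El A.left)
    (hl : ∀ i, (F.sliceU.obj A).hom (l i) = cls (Q := Q.slice) (G i)) :
    evT D k hk (mkT (Q := Q.slice) (A := F.sliceU.obj A) T l hl) =
      D.ev (fun i => k (l i)) T.tree :=
  (D.ev_eltHom (Arr.toOfHom (Q := Q.slice) T) (fun i => (hk _).trans (deg_of_sliceU (hl i)))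
    fun i => congrArg (fun i => k (l i)) ((Finite.equivFin ι).symm_apply_apply i)).symm

/-- Precomposing with isomorphisms changes the sources into the arrows chosen for the labels without
changing the class. The tree can then be relabelled along `l` to have its nodes in `A`. -/
theorem exists_mkT_arrOf (t : (TObj (Q := Q.slice) (F.sliceU.obj A)).left) :
    ∃ (n : ℕ) (l : Fin n → F.El A.left) (f : Q.Arr)
      (T : Config (fun i => arrOf (F := F) (A := A) (l i)) f),
      t = mkT (Q := Q.slice) (A := F.sliceU.obj A) T l
        (fun i => sliceU_of_deg (deg_eq_arrOf (l i))) := by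
  obtain ⟨a, rfl⟩ := exists_mkT h.slice t
  have b : ∀ i, EltHom (arrOf (F := F) (A := A) (a.lab i)).hom (Arr.hom (Q := Q) (a.arr.src i)) :=
    fun i => (exists_eltHom_of_arr ((deg_eq_arrOf (F := F) (A := A) (a.lab i)).symm.trans
      (deg_of_sliceU (a.compat i)))).some
  exact ⟨a.arr.n, a.lab, a.arr.tgt, SymMulticat.pre (Q := Q.slice) b a.arr.hom,
    Sim.mkT_eq h.slice (sim_pre (Q := Q.slice) b a.arr.hom a.lab)⟩

end

variable (F A) in
/-- Labelled configurations as elements of the free operad. -/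
noncomputable def nf (t : (TObj (Q := Q.slice) (F.sliceU.obj A)).left) : F.El (frObj F A) :=
  evT (frData F A) frUnit deg_frUnit t

theorem nf_mkT_arrOf {n : ℕ} (l : Fin n → F.El A.left) {f : Q.Arr}
    (T : Config (fun i => arrOf (F := F) (A := A) (l i)) f)
    (hl : ∀ i, (F.sliceU.obj A).hom (l i) = cls (Q := Q.slice) (arrOf (F := F) (A := A) (l i))) :
    nf F A (mkT (Q := Q.slice) (A := F.sliceU.obj A) T l hl) =
      frMk (T.tree.mapNode (G := arrOf (F := F) (A := A)) l) := by
  refine (evT_mkT (frData F A) frUnit deg_frUnit T l hl).trans ?_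
  exact ((frData F A).ev_mapNode (H := arrOf (F := F) (A := A)) l T.tree).symm.trans (ev_frUnit _)

/-- The canonical version of a tree is a configuration whose sources are indexed by the nodes;
labelling each node by its original label recovers the tree. -/
theorem nf_surjective : Function.Surjective (nf F A) := by
  intro e
  obtain ⟨y, T, rfl⟩ := exists_tree e
  obtain ⟨C, hn, -, hC, hk⟩ := T.exists_can h
  let f : Q.Arr := Arr.ofHom T.eval
  let m : EltHom T.eval f.hom := Arr.toOfHom T.eval
  let D := (C.relabel (Y := f.src) m.perm m.inp).post m.out
  have hD : D.sk = C.sk.map (fun i => i) m.perm := by rw [Tree.sk_post, Tree.sk_relabel]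
  have hs : Sim D.eval D.leafLabel f.hom id :=
    ((Tree.sim_post _ _).symm h).trans (((Tree.sim_relabel h _ _ _).symm h).trans
      ((hC.map m.perm).trans (⟨m, fun _ => rfl⟩ : Sim T.eval m.perm f.hom id)))
  have hb : D.nodeLabel.Bijective := by
    rw [Tree.nodeLabel_bijective_iff, hD, Sk.labels_map, hn, List.map_id']
    exact T.nodup_nodes
  refine ⟨mkT (Q := Q.slice) (A := F.sliceU.obj A) (Config.ofSim h D hb hs) T.nodeLabel
    (fun N => sliceU_of_deg (deg_eq_arrOf (T.nodeLabel N))), ?_⟩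
  refine (evT_mkT (frData F A) frUnit deg_frUnit (Config.ofSim h D hb hs) T.nodeLabel _).trans ?_
  refine ((frData F A).ev_mapNode (H := arrOf (F := F) (A := A)) T.nodeLabel D).symm.trans
    ((ev_frUnit _).trans (frMk_eq ?_ rfl))
  rw [Tree.sk_mapNode, hD, Sk.map_map, Sk.map_map, ← hk, Sk.map_map]
  congr 1
  exact funext fun l => cls_eq (have := h.isIso (m.inp l); asIso (m.inp l))

/-- The nodes and leaves of a configuration are labelled bijectively. If two trees agree after
passing to labels in `A` and classes of objects, they differ by bijections of the nodes and of the
leaves, and these form an isomorphism of labelled configurations. -/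
theorem nf_injective : Function.Injective (nf F A) := by
  intro t t' e
  obtain ⟨n, l, f, T, rfl⟩ := exists_mkT_arrOf t
  obtain ⟨n', l', f', T', rfl⟩ := exists_mkT_arrOf t'
  rw [nf_mkT_arrOf, nf_mkT_arrOf] at e
  have e₁ := congrArg frSk e
  have e₂ := congrArg sort e
  rw [frSk_frMk, frSk_frMk, Tree.sk_mapNode, Tree.sk_mapNode, Sk.map_map, Sk.map_map] at e₁
  rw [sort_frMk, sort_frMk] at e₂
  have n₁ := T.tree.nodeLabel_bijective_iff.1 T.node_bij
  have n₂ := T'.tree.nodeLabel_bijective_iff.1 T'.node_bij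
  have l₁ := T.tree.leafLabel_bijective_iff.1 T.leaf_bij
  have l₂ := T'.tree.leafLabel_bijective_iff.1 T'.leaf_bij
  obtain ⟨p, q, hpq, hp, hq⟩ := Sk.exists_equiv n₁.1 n₂.1 n₁.2 n₂.2 l₁.1 l₂.1 l₁.2 l₂.2 e₁
  obtain rfl : l = fun i => l' (p i) := funext fun i => (hp i).symm
  let D := ((T.tree.mapNode (G := fun i => arrOf (F := F) (A := A) (l' i)) p).relabel
    (Y := f'.src) q fun j => (cls_exact (hq j)).some.hom).post (cls_exact e₂).some.hom
  have hD : D = T'.tree := Tree.sk_injective h (by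
    rw [Tree.sk_post, Tree.sk_relabel, Tree.sk_mapNode, Sk.map_map]; exact hpq)
  have hs : Sim T.tree.eval (fun j => q (T.tree.leafLabel j)) T'.tree.eval T'.tree.leafLabel := by
    rw [← hD]
    exact ((Tree.sim_mapNode (G := fun i => arrOf (F := F) (A := A) (l' i)) p T.tree).map q).trans
      ((Tree.sim_relabel h _ _ _).trans (Tree.sim_post _ _))
  -- The bijection of leaves underlies a morphism between the targets `f` and `f'` in `elt(Q)`, that
  -- is, an object-morphism of the slice.
  obtain ⟨m, hm⟩ := ((T.sim.map q).symm h).trans (hs.trans T'.sim)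
  have hm : EltHom.perm m = q := Equiv.ext hm
  have hT : Config.push (F := fun i => arrOf (F := F) (A := A) (l' i)) p
      (SymMulticat.post (Q := Q.slice) (y := f) (z := f') m T) = T' := by
    refine Config.ext (Tree.sk_injective h ?_)
    refine (Tree.sk_mapNode (G := fun i => arrOf (F := F) (A := A) (l' i)) p _).trans ?_
    refine (congrArg _ (sk_config_post T m)).trans ?_
    rw [Sk.map_map, hm]
    exact hpq
  refine Sim.mkT_eq h.slice ((sim_post (Q := Q.slice) (y := f) (y' := f') m T _).trans ?_)
  have := sim_push (Q := Q.slice) p (x := fun i => arrOf (F := F) (A := A) (l' i))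
    (SymMulticat.post (Q := Q.slice) (y := f) (z := f') m T) l'
  exact hT ▸ this

end MonadPair.IsoData

/-! ### Comparison of the free-operad monad with the monad of the slice. -/

/-- The map `nf` goes from configurations to the free operad, opposite to the transformation of an
opfunctor; this reverses its compatibility with multiplications. -/
theorem CategoryTheory.Iso.comp_inv_eq_of_comp_hom_eq {C : Type*} [Category C] {K : C ⥤ C}
    {X Y Z : C} (i : K.obj X ≅ Y) (j : K.obj Y ≅ Z) (m : K.obj (K.obj X) ⟶ K.obj X) (n : Z ⟶ Y)
    (e : m ≫ i.hom = K.map i.hom ≫ j.hom ≫ n) : n ≫ i.inv = j.inv ≫ K.map i.inv ≫ m := by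
  rw [Iso.comp_inv_eq, Category.assoc, Category.assoc, e, ← K.map_comp_assoc, Iso.inv_hom_id,
    K.map_id, Category.id_comp, Iso.inv_hom_id_assoc]

namespace MonadPair.IsoData

open SymMulticat

variable {M : MonadPair} {Q : SymMulticat} {h : Q.Tidy} {F : M.IsoData (Q.zeta h)}
  {A B : Over (M.T.obj (⊤_ M.C))}

theorem nf_map (k : A ⟶ B) (t : (TObj (Q := Q.slice) (F.sliceU.obj A)).left) :
    nf F B (((TFunctor Q.slice).map (F.sliceU.map k)).left t) =
      app (F := F) (F.frMonad.map k).left (nf F A t) := by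
  obtain ⟨n, l, f, T, rfl⟩ := exists_mkT_arrOf t
  rw [nf_mkT_arrOf]
  refine Eq.trans ?_ (app_frMonad_map k _).symm
  refine (evT_mkT (frData F B) frUnit deg_frUnit T (fun i => app k.left (l i)) fun i => ?_).trans ?_
  · exact (over_w (F.sliceU.map k) (l i)).trans (sliceU_of_deg (deg_eq_arrOf (l i)))
  · exact ((frData F B).ev_mapNode (H := arrOf (F := F) (A := A))
      (r := fun a => frUnit (app k.left a)) l T.tree).symm

theorem nf_eta (a : F.El A.left) :
    nf F A (etaFun (Q := Q.slice) (F.sliceU.obj A) a) = frUnit a := by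
  refine (congrArg (nf F A) (h.slice.eta_eq (A := F.sliceU.obj A) a
    (sliceU_of_deg (deg_eq_arrOf a)))).trans ?_
  refine (evT_mkT (frData F A) frUnit deg_frUnit (Config.single (𝟙 (arrOf a))) (fun _ => a) _).trans
    ((frData F A).ev_config_single (𝟙 (arrOf a)) _ ?_)
  exact (deg_frUnit a).trans (deg_eq_arrOf a)

/-- Reduces the multiplication of the free-operad monad to evaluation of a configuration at its own
labels. -/
theorem app_μ_nf (t : (TObj (Q := Q.slice) (F.sliceU.obj (frGraph F A))).left) :
    app (F := F) (F.frMonad.μ.app A).left (nf F (frGraph F A) t) =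
      evT (frData F A) (fun e => e) (fun _ => rfl) t := by
  obtain ⟨n, l, f, T, rfl⟩ := exists_mkT_arrOf t
  rw [nf_mkT_arrOf]
  refine (app_frMonad_μ _).trans (Eq.trans ?_ (evT_mkT (frData F A) _ _ T l _).symm)
  exact (frData F A).ev_mapNode (H := arrOf (F := F) (A := frGraph F A)) l T.tree

theorem deg_nf (t : (TObj (Q := Q.slice) (F.sliceU.obj A)).left) :
    (F.sliceU.obj (frGraph F A)).hom (nf F A t) = (TObj (Q := Q.slice) (F.sliceU.obj A)).hom t := by
  obtain ⟨n, l, f, T, rfl⟩ := exists_mkT_arrOf t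
  refine sliceU_of_deg ?_
  refine (congrArg _ (evT_mkT (frData F A) frUnit deg_frUnit T l _)).trans ?_
  exact (frData F A).deg_ev_config (fun i => (deg_frUnit _).trans (deg_eq_arrOf _)) T

variable (F A) in
/-- Labelled configurations and elements of the free operad, as objects over the set of classes. -/
noncomputable def nfHom :
    TObj (Q := Q.slice) (F.sliceU.obj A) ⟶ F.sliceU.obj (F.frMonad.obj A) :=
  Over.homMk (V := F.sliceU.obj (frGraph F A)) (TypeCat.ofHom (nf F A)) (by
    ext t
    exact deg_nf t)

theorem isIso_nfHom : IsIso (nfHom F A) := by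
  have : IsIso ((Over.forget _).map (nfHom F A)) :=
    (isIso_iff_bijective _).2 ⟨nf_injective, nf_surjective⟩
  exact isIso_of_reflects_iso _ (Over.forget _)

/-- Both sides are values in the free operad: of a composite configuration on one side, and of the
outer configuration at the values of the inner ones on the other. `ev_config_comp` equates them. -/
theorem nf_mu (t : (TObj (TObj (Q := Q.slice) (F.sliceU.obj A))).left) :
    nf F A ((h.slice.muHom (F.sliceU.obj A)).left t) = app (F := F) (F.frMonad.μ.app A).left
      (nf F (frGraph F A) (((TFunctor Q.slice).map (nfHom F A)).left t)) := by
  obtain ⟨n, x, y, f, g, u, l, hl, hg, rfl⟩ := h.slice.exists_mkT_mkT t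
  refine Eq.trans ?_ (app_μ_nf _).symm
  refine (congrArg (nf F A) (h.slice.mu_mkT f (fun i => (g i).hom) l hl u hg)).trans ?_
  refine (evT_mkT (frData F A) frUnit deg_frUnit (Config.comp f
    (fun i => SymMulticat.post (Q := Q.slice) (u i) (g i).hom)) (fun p => l p.1 p.2)
      (fun p => hl p.1 p.2)).trans ?_
  have hd : ∀ i j, app (frGraph F A).hom (frUnit (F := F) (A := A) (l i j)) =
      F.arr (Arr.hom (Q := Q) ((g i).src j)) := fun i j =>
    (deg_frUnit _).trans (deg_of_sliceU (hl i j))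
  refine ((frData F A).ev_config_comp f _ (fun i j => frUnit (l i j)) hd).trans ?_
  refine Eq.trans ?_ (evT_mkT (A := frGraph F A) (frData F A) (fun e => e) (fun _ => rfl) f
    (fun i => nf F A (mkT (Q := Q.slice) (A := F.sliceU.obj A) (g i).hom (l i) (hl i)))
    (fun i => (deg_nf _).trans (hg i))).symm
  congr 1
  funext i
  -- The object-isomorphism inserted by the multiplication of `T_{Q⁺}` does not affect the value.
  refine ((frData F A).ev_config_post (hd i) (g i).hom (u i)).trans ?_
  exact (evT_mkT (frData F A) frUnit deg_frUnit (g i).hom (l i) (hl i)).symm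

variable (F) in
/-- The monad of free operads as a monad on graphs. -/
noncomputable def frPair : MonadPair where
  C := Over (M.T.obj (⊤_ M.C))
  T := F.frMonad

variable (F A) in
/-- Labelled configurations correspond to elements of the free operad. -/
noncomputable def nfObjIso :
    TObj (Q := Q.slice) (F.sliceU.obj A) ≅ F.sliceU.obj (F.frMonad.obj A) :=
  have := isIso_nfHom (F := F) (A := A)
  asIso (nfHom F A)

variable (F) in
/-- The natural isomorphism between labelled configurations and elements of free operads. -/
noncomputable def nfIso : F.sliceU ⋙ TFunctor Q.slice ≅ F.frMonad.toFunctor ⋙ F.sliceU :=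
  NatIso.ofComponents (fun A => nfObjIso F A) fun {A B} k => by
    ext t
    exact nf_map k t

theorem map_η_nfObjIso_inv (A : Over (M.T.obj (⊤_ M.C))) :
    F.sliceU.map (F.frMonad.η.app A) ≫ (nfObjIso F A).inv = etaHom (F.sliceU.obj A) := by
  refine (Iso.comp_inv_eq (nfObjIso F A)).2 ?_
  ext a
  exact (app_frMonad_η (F := F) (A := A) a).trans (nf_eta (F := F) (A := A) a).symm

theorem map_μ_nfObjIso_inv (A : Over (M.T.obj (⊤_ M.C))) :
    F.sliceU.map (F.frMonad.μ.app A) ≫ (nfObjIso F A).inv =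
      (nfObjIso F (F.frMonad.obj A)).inv ≫
        (TFunctor Q.slice).map (nfObjIso F A).inv ≫ h.slice.muHom (F.sliceU.obj A) := by
  refine CategoryTheory.Iso.comp_inv_eq_of_comp_hom_eq (K := TFunctor Q.slice)
    (X := F.sliceU.obj A) (nfObjIso F A) (nfObjIso F (F.frMonad.obj A))
    (h.slice.muHom (F.sliceU.obj A)) _ ?_
  ext t
  exact nf_mu t

variable (F) in
/-- The monad of free operads is the monad of the slice. -/
noncomputable def frIsoData : F.frPair.IsoData (Q.slice.zeta h.slice) where
  U := F.sliceU
  isIso := isIso_sliceU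
  φ := (nfIso F).symm
  unit A := map_η_nfObjIso_inv A
  mult A := map_μ_nfObjIso_inv A

/-- Replacing the monad by an isomorphic one. -/
noncomputable def ofMonadIso {C : Type 1} [Category.{0} C] [HasFiniteLimits C] {T T' : Monad C}
    {N : MonadPair} (G : IsoData (MonadPair.mk C T') N) (e : T.toFunctor ≅ T'.toFunctor)
    (hη : ∀ X, T.η.app X ≫ e.hom.app X = T'.η.app X)
    (hμ : ∀ X, T.μ.app X ≫ e.hom.app X =
      e.hom.app (T.obj X) ≫ T'.map (e.hom.app X) ≫ T'.μ.app X) :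
    IsoData (MonadPair.mk C T) N where
  U := G.U
  isIso := G.isIso
  φ := Functor.isoWhiskerRight e G.U ≪≫ G.φ
  unit X := by
    refine Eq.trans ?_ (G.unit X)
    change G.U.map (T.η.app X) ≫ G.U.map (e.hom.app X) ≫ G.φ.hom.app X =
      G.U.map (T'.η.app X) ≫ G.φ.hom.app X
    rw [← hη, Functor.map_comp, Category.assoc]
  mult X := by
    change G.U.map (T.μ.app X) ≫ G.U.map (e.hom.app X) ≫ G.φ.hom.app X =
      (G.U.map (e.hom.app (T.obj X)) ≫ G.φ.hom.app (T.obj X)) ≫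
        N.T.map (G.U.map (e.hom.app X) ≫ G.φ.hom.app X) ≫ N.T.μ.app (G.U.obj X)
    have h₁ : G.U.map (T'.map (e.hom.app X)) ≫ G.φ.hom.app (T'.obj X) =
      G.φ.hom.app (T.obj X) ≫ N.T.map (G.U.map (e.hom.app X)) := G.φ.hom.naturality (e.hom.app X)
    have h₂ : G.U.map (T'.μ.app X) ≫ G.φ.hom.app X = G.φ.hom.app (T'.obj X) ≫
      N.T.map (G.φ.hom.app X) ≫ N.T.μ.app (G.U.obj X) := G.mult X
    rw [← Category.assoc, ← Functor.map_comp, hμ, Functor.map_comp, Functor.map_comp,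
      Functor.map_comp, Category.assoc, Category.assoc, Category.assoc, Category.assoc, h₂,
      reassoc_of% h₁]

/-- The inductive step. The monad of `M.prime` comes from an arbitrarily chosen left adjoint, so it
is first replaced by the isomorphic monad of the explicit free operads. -/
theorem nonempty_prime (F : M.IsoData (Q.zeta h)) :
    Nonempty (M.prime.IsoData (Q.slice.zeta h.slice)) := by
  have H := F.hasFreeOperads
  have : (operadForget M.T).IsRightAdjoint := H
  have e : M.prime = MonadPair.mk (Over (M.T.obj (⊤_ M.C)))
      (Adjunction.ofIsRightAdjoint (operadForget M.T)).toMonad := by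
    rw [MonadPair.prime, dif_pos H]
  obtain ⟨e', h₁, h₂⟩ := Adjunction.exists_toMonad_iso
    (Adjunction.ofIsRightAdjoint (operadForget M.T)) F.frAdjunction
  rw [e]
  exact ⟨ofMonadIso (T' := F.frMonad) F.frIsoData e' h₁ h₂⟩

end MonadPair.IsoData

/-! ### Transport of monads along isomorphisms of categories. -/

/-- The monad on the source of a fully faithful functor that corresponds to a monad on the target,
if the latter preserves the image. -/
noncomputable def CategoryTheory.Monad.ofFullyFaithful {C D : Type*} [Category C] [Category D]
    (N : Monad D) (U : C ⥤ D) [U.Full] [U.Faithful] (R : C → C)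
    (φ : ∀ X, U.obj (R X) ≅ N.obj (U.obj X)) : Monad C where
  obj := R
  map {X Y} f := U.preimage ((φ X).hom ≫ N.map (U.map f) ≫ (φ Y).inv)
  map_id X := U.map_injective (by simp)
  map_comp f g := U.map_injective (by simp)
  η :=
    { app X := U.preimage (N.η.app (U.obj X) ≫ (φ X).inv)
      naturality X Y f := U.map_injective (by
        have h : U.map f ≫ N.η.app (U.obj Y) = N.η.app (U.obj X) ≫ N.map (U.map f) :=
          N.η.naturality (U.map f)
        simpa using h) }
  μ :=
    { app X := U.preimage ((φ (R X)).hom ≫ N.map (φ X).hom ≫ N.μ.app (U.obj X) ≫ (φ X).inv)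
      naturality X Y f := U.map_injective (by
        have h {W : D} (z : _ ⟶ W) : N.map (N.map (U.map f)) ≫ N.μ.app (U.obj Y) ≫ z =
            N.μ.app (U.obj X) ≫ N.map (U.map f) ≫ z := by
          simpa using congrArg (· ≫ z) (N.μ.naturality (U.map f))
        simpa using congrArg (N.map (φ X).hom ≫ ·) (h (φ Y).inv)) }
  assoc X := U.map_injective (by
    have h {W : D} (z : _ ⟶ W) : N.map (N.map (φ X).hom) ≫ N.μ.app (N.obj (U.obj X)) ≫ z =
        N.μ.app (U.obj (R X)) ≫ N.map (φ X).hom ≫ z := by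
      simpa using congrArg (· ≫ z) (N.μ.naturality (φ X).hom)
    have h' {W : D} (z : _ ⟶ W) : N.map (N.μ.app (U.obj X)) ≫ N.μ.app (U.obj X) ≫ z =
        N.μ.app (N.obj (U.obj X)) ≫ N.μ.app (U.obj X) ≫ z := by
      simpa using congrArg (· ≫ z) (N.assoc (U.obj X))
    simpa using congrArg (N.map (φ (R X)).hom ≫ ·)
      ((congrArg (N.map (N.map (φ X).hom) ≫ ·) (h' (φ X).inv)).trans
        (h (N.μ.app (U.obj X) ≫ (φ X).inv))))
  left_unit X := U.map_injective (by
    have h {W : D} (z : _ ⟶ W) : (φ X).hom ≫ N.η.app (N.obj (U.obj X)) ≫ z =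
        N.η.app (U.obj (R X)) ≫ N.map (φ X).hom ≫ z := by
      simpa using congrArg (· ≫ z) (N.η.naturality (φ X).hom)
    have h' {W : D} (z : _ ⟶ W) : N.η.app (N.obj (U.obj X)) ≫ N.μ.app (U.obj X) ≫ z = z := by
      simp
    simpa using (h (N.μ.app (U.obj X) ≫ (φ X).inv)).symm.trans
      ((congrArg ((φ X).hom ≫ ·) (h' (φ X).inv)).trans (Iso.hom_inv_id _)))
  right_unit X := U.map_injective (by
    simp)

/-- Transport of a monad along an isomorphism of categories. -/
noncomputable def MonadPair.IsoData.ofIsIso {C : Type 1} [Category.{0} C] [HasFiniteLimits C]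
    (N : MonadPair) (U : C ⥤ N.C) (hU : U.IsIso) (R : C → C)
    (φ : ∀ X, U.obj (R X) ≅ N.T.obj (U.obj X)) :
    (MonadPair.mk C (N.T.ofFullyFaithful U R φ)).IsoData N where
  U := U
  isIso := hU
  φ := NatIso.ofComponents φ fun f => by simp [Monad.ofFullyFaithful]
  unit X := by
    change _ ≫ (φ X).hom = _
    simp [Monad.ofFullyFaithful]
  mult X := by
    change _ ≫ (φ X).hom = (φ (R X)).hom ≫ N.T.map (φ X).hom ≫ _
    simp [Monad.ofFullyFaithful]

/-- A category on which the unit of a monad is invertible. -/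
noncomputable def MonadPair.IsoData.ofIsIsoUnit {C : Type 1} [Category.{0} C] [HasFiniteLimits C]
    (N : MonadPair) (U : C ⥤ N.C) (hU : U.IsIso) (hη : IsIso N.T.η) :
    (MonadPair.mk C (Monad.id C)).IsoData N where
  U := U
  isIso := hU
  φ := Functor.isoWhiskerLeft U (asIso N.T.η)
  unit X := (congrArg (· ≫ N.T.η.app (U.obj X)) (U.map_id X)).trans (Category.id_comp _)
  -- The comparison is the unit itself, so compatibility with multiplication is a unit law.
  mult X := (congrArg (· ≫ N.T.η.app (U.obj X)) (U.map_id X)).trans ((Category.id_comp _).trans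
    ((Category.comp_id _).symm.trans
      (congrArg (N.T.η.app (U.obj X) ≫ ·) (N.T.right_unit (U.obj X)).symm)))

theorem CategoryTheory.Over.isIso_map {S S' : Type} (e : S ≃ S') :
    (Over.map (TypeCat.ofHom e)).IsIso where
  faithful := ⟨fun {A B k l} h => by
    ext a
    exact congrArg (fun t : (Over.map (TypeCat.ofHom e)).obj A ⟶ (Over.map (TypeCat.ofHom e)).obj B =>
      (t.left : A.left → B.left) a) h⟩
  full := ⟨fun {A B} k => ⟨Over.homMk (TypeCat.ofHom fun a : A.left => (k.left a : B.left)) (by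
    ext a
    exact e.injective (ConcreteCategory.congr_hom (Over.w k) a)), by
    ext; rfl⟩⟩
  bijective_obj := by
    constructor
    · intro A B h
      obtain ⟨he, hh⟩ := Over.exists_of_eq h
      exact Over.ext_type he fun a => e.injective (hh a)
    · intro B
      exact ⟨Over.mk (TypeCat.ofHom fun a : B.left => e.symm (B.hom a)), Over.ext_type rfl fun a =>
        (e.apply_symm_apply (B.hom a)).symm⟩

/-- Sets as objects over a one-element set. -/
def CategoryTheory.Over.ofUnique (S : Type) [Unique S] : Type ⥤ Over S where
  obj X := Over.mk (TypeCat.ofHom fun _ : X => (default : S))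
  map f := Over.homMk f
  map_id _ := rfl
  map_comp _ _ := rfl

theorem CategoryTheory.Over.isIso_ofUnique (S : Type) [Unique S] : (Over.ofUnique S).IsIso where
  faithful := ⟨fun {A B k l} e => congrArg (fun t => CommaMorphism.left t) e⟩
  full := ⟨fun k => ⟨k.left, by ext; rfl⟩⟩
  bijective_obj := by
    constructor
    · intro A B h
      exact (Over.exists_of_eq h).1
    · intro B
      exact ⟨B.left, Over.ext_type rfl fun a => Subsingleton.elim _ _⟩

/-! ### The base of the induction and the sets `S_k`. -/

namespace SymMulticat

variable {Q : SymMulticat} {A : Over Q.Cls}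

theorem Tidy.etaFun_injective (h : Q.Tidy) : Function.Injective (etaFun A) := by
  intro a b e
  obtain ⟨m, hm⟩ := h.exists_eltHom e
  exact (hm ()).symm

/-- Every arrow of `I` has exactly one input, so a labelled arrow is the unit at its only label. -/
theorem isIso_trivial_η : IsIso (trivial.zeta tidy_trivial).T.η := by
  have h (A : Over trivial.Cls) : IsIso (etaHom A) := by
    have : IsIso ((Over.forget _).map (etaHom A)) := by
      refine (isIso_iff_bijective _).2 ⟨tidy_trivial.etaFun_injective, fun t => ?_⟩
      obtain ⟨a, rfl⟩ := exists_mkT tidy_trivial t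
      obtain ⟨e⟩ : Nonempty (Unit ≃ Fin a.arr.n) := by
        have : Nat.card (Fin a.arr.n) = 1 := PLift.down (α := Nat.card (Fin a.arr.n) = 1) a.arr.hom
        rw [Nat.card_eq_fintype_card, Fintype.card_fin] at this
        rw [this]
        exact ⟨Equiv.ofUnique _ _⟩
      refine ⟨a.lab (e ()), (tidy_trivial.eta_eq (x := ⟨()⟩) _ (a.compat _)).trans
        (tidy_trivial.mkT_eq ⟨e, fun _ => ⟨⟨rfl⟩⟩, ⟨⟨rfl⟩⟩, rfl⟩ fun _ => rfl)⟩
    exact isIso_of_reflects_iso _ (Over.forget _)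
  have (A : (trivial.zeta tidy_trivial).C) : IsIso ((trivial.zeta tidy_trivial).T.η.app A) := h A
  exact NatIso.isIso_of_isIso_app _

/-- The set of isomorphism classes of objects of `I` has one element. -/
instance uniqueTrivialCls : Unique trivial.Cls where
  default := cls (Q := trivial) ⟨()⟩
  uniq s := by
    obtain ⟨x, rfl⟩ := Quotient.exists_rep s
    rfl

end SymMulticat

namespace MonadPair.IsoData

open SymMulticat

/-- Sets with the identity monad are the monad of `I`. -/
noncomputable def trivialIsoData : setMonad.IsoData (trivial.zeta tidy_trivial) :=
  ofIsIsoUnit (trivial.zeta tidy_trivial) (Over.ofUnique trivial.Cls) (Over.isIso_ofUnique _)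
    isIso_trivial_η

/-- Only a strict isomorphism has to be carried along: free operads and cartesianness at each stage
follow from it. -/
theorem nonempty_iterPrime (k : ℕ) :
    Nonempty ((setMonad.iterPrime k).IsoData ((trivial.iterSlice k).zeta (tidy_iterSlice k))) := by
  induction k with
  | zero => exact ⟨trivialIsoData⟩
  | succ k ih =>
    obtain ⟨F⟩ := ih
    exact F.nonempty_prime

variable {Q : SymMulticat} (h : Q.Tidy) {S : Type} (e : S ≃ Q.Cls)

/-- The objects over `S` that correspond to the values of the monad of `Q`. -/
noncomputable def transportObjIso (X : Over S) :
    (Over.map (TypeCat.ofHom e)).obj ((Over.map (TypeCat.ofHom e.symm)).obj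
      (TObj ((Over.map (TypeCat.ofHom e)).obj X))) ≅ TObj ((Over.map (TypeCat.ofHom e)).obj X) :=
  Over.isoMk (Iso.refl _) (by
    ext t
    exact (e.apply_symm_apply _).symm)

/-- The monad of `Q` as a monad on the objects over a set in bijection with the set of classes. -/
noncomputable def transport : Monad (Over S) :=
  have := Over.isIso_map e
  (Q.zetaMonad h).ofFullyFaithful (Over.map (TypeCat.ofHom e)) _ (transportObjIso e)

/-- The transported monad is isomorphic to the monad of `Q`. -/
noncomputable def transportIsoData : (MonadPair.mk (Over S) (transport h e)).IsoData (Q.zeta h) :=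
  ofIsIso (Q.zeta h) (Over.map (TypeCat.ofHom e)) (Over.isIso_map e) _ (transportObjIso e)

/-- The value of the transported monad at the identity is the set of classes of objects of the
slice. -/
noncomputable def transportEquiv :
    ((transport h e).obj (Over.mk (𝟙 S))).left ≃ Q.slice.Cls :=
  -- The identity of `S` is a terminal object, but `arrCls` is stated for the chosen one.
  have i : (transport h e).obj (Over.mk (𝟙 S)) ≅ (transport h e).obj (⊤_ (Over S)) :=
    (transport h e).mapIso (Over.mkIdTerminal.uniqueUpToIso terminalIsTerminal)
  ((Over.forget S).mapIso i).toEquiv.trans (transportIsoData h e).arrCls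

/-- The sets `S_k`, with bijections to the sets of classes of objects of the iterated slices. -/
noncomputable def stage : ∀ k, Σ S : Type, S ≃ (trivial.iterSlice k).Cls
  | 0 => ⟨Unit, Equiv.ofUnique Unit trivial.Cls⟩
  -- The next set is the underlying set of `T_k(id)` itself, and only its bijection with the classes
  -- is constructed; the required equalities of sets then hold by definition.
  | k + 1 => ⟨_, transportEquiv (tidy_iterSlice k) (stage k).2⟩

end MonadPair.IsoData

theorem mainTheorem2 :
    ∃ (tidy : ∀ k, (SymMulticat.trivial.iterSlice k).Tidy)
      (S : ℕ → Type) (T : ∀ k, Monad (Over (S k)))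
      (hζ : ∀ k, ((SymMulticat.trivial.iterSlice k).zeta (tidy k)).IsCartesian)
      (hp : ∀ k, (setMonad.iterPrime k).IsCartesian)
      (hT : ∀ k, (MonadPair.mk (Over (S k)) (T k)).IsCartesian),
      S 0 = Unit ∧
      (∀ k, S (k + 1) = ((T k).obj (Over.mk (𝟙 (S k)))).left) ∧
      ∀ k, (setMonad.iterPrime k).HasFreeOperads ∧
        Nonempty (CartMonad.mk ((SymMulticat.trivial.iterSlice k).zeta (tidy k)) (hζ k) ≅
          CartMonad.mk (setMonad.iterPrime k) (hp k)) ∧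
        Nonempty (CartMonad.mk (setMonad.iterPrime k) (hp k) ≅
          CartMonad.mk (MonadPair.mk (Over (S k)) (T k)) (hT k)) := by
  have F k := (MonadPair.IsoData.nonempty_iterPrime k).some
  have hζ k := (SymMulticat.tidy_iterSlice k).isCartesian
  have G k := MonadPair.IsoData.transportIsoData (SymMulticat.tidy_iterSlice k)
    (MonadPair.IsoData.stage k).2
  exact ⟨SymMulticat.tidy_iterSlice, fun k => (MonadPair.IsoData.stage k).1,
    fun k => MonadPair.IsoData.transport (SymMulticat.tidy_iterSlice k)
      (MonadPair.IsoData.stage k).2,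
    hζ, fun k => (F k).isCartesian (hζ k), fun k => (G k).isCartesian (hζ k), rfl, fun k => rfl,
    fun k => ⟨(F k).hasFreeOperads, ⟨((F k).toIso _ (hζ k)).symm⟩,
      ⟨(F k).toIso _ (hζ k) ≪≫ ((G k).toIso _ (hζ k)).symm⟩⟩⟩
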